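/- Let $d\ge 2$, $\nu\in\mathbb N$ with $\nu\ge1$, and $\mu\in\mathbb R\setminus\{0\}$. Let $\kappa_1=(1,0,\dots,0)$, $\kappa_2=(1,1,0,\dots,0)$, $\kappa_3=(0,1,0,\dots,0)\in\mathbb R^d$ and $\kappa_0=0$. For $\alpha_1,\alpha_2,\alpha_3\in\mathcal S(\mathbb R^d)$, $J\in\mathbb R$ and $\varepsilon>0$ consider $$ i\varepsilon\partial_t u^\varepsilon+\frac{\varepsilon^2}{2}\Delta u^\varepsilon=\mu\,\varepsilon^J|u^\varepsilon|^{2\nu}u^\varepsilon,\qquad u^\varepsilon(0,x)=\sum_{j=1}^3\alpha_j(x)e^{i\kappa_j\cdot x/\varepsilon},\qquad x\in\mathbb R^d. \tag{1}$$ Say that $\ell_1,\dots,\ell_{2\nu+1}\in\mathbb R^d$ generate $\kappa\in\mathbb R^d$ by resonance if $\sum_{k=1}^{2\nu+1}(-1)^{k+1}\ell_k=\kappa$ and $\sum_{k=1}^{2\nu+1}(-1)^{k+1}|\ell_k|^2=|\kappa|^2$. Let $\Phi\subset\mathbb R^d$ be the smallest set containing $\kappa_1,\kappa_2,\kappa_3$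 that is stable under resonance; it contains $\kappa_0=0$. For $\kappa\in\Phi$ let $I_\kappa$ be the set of tuples in $\Phi^{2\nu+1}$ that generate $\kappa$ by resonance. The profiles $(a^\varepsilon_\kappa)_{\kappa\in\Phi}$ are the solution of the transport system $$ \partial_t a^\varepsilon_\kappa+\kappa\cdot\nabla a^\varepsilon_\kappa=-i\mu\,\varepsilon^{J-1}\sum_{(\ell_1,\dots,\ell_{2\nu+1})\in I_\kappa}a^\varepsilon_{\ell_1}\overline{a^\varepsilon_{\ell_2}}\cdots a^\varepsilon_{\ell_{2\nu+1}},\qquad \kappa\in\Phi, \tag{2}$$ with $a^\varepsilon_{\kappa_j}(0)=\alpha_j$ for $j=1,2,3$ and $a^\varepsilon_\kappa(0)=0$ for $\kappa\in\Phi\setminus\{\kappa_1,\kappa_2,\kappa_3\}$. Let $X$ be the space of families $(a_\kappa)_{\kappa\in\Phi}$ with $\sum_{\kappa\in\Phi}\big(\|\widehat{a_\kappa}\|_{L^1}+\|\widehat{a_\kappa}\|_{L^2}\big)<\infty$, and write $a^\varepsilon_0$ for the zero mode ($\kappa=\kappa_0=0$). For $s\le 0$ let $\|f\|_{H^s}^2=\int(1+|\xi|^2)^s|\widehat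 f(\xi)|^2d\xi$, where $\widehat f(\xi)=(2\pi)^{-d/2}\int e^{-ix\cdot\xi}f(x)\,dx$. Then there exist $\alpha_1,\alpha_2,\alpha_3\in\mathcal S(\mathbb R^d)$ and $T>0$ (depending only on $d,\nu,\mu$) such that the following holds for all $s,J\in\mathbb R$ with $s<1-J<0$ and $J<2$. There is $\varepsilon_0>0$ such that for every $\varepsilon\in(0,\varepsilon_0]$ problem (1) has a unique solution $u^\varepsilon\in C([0,T];L^2\cap L^\infty)$ and system (2) has a unique solution $a^\varepsilon\in C([0,T];X)$. Moreover, for every $t\in(0,T]$ one has $a_0^\varepsilon(t)\ne0$ for all sufficiently small $\varepsilon>0$, and as $\varepsilon\to0$ $$\|u^\varepsilon(t)\|_{H^s}\sim\|a^\varepsilon_0(t)\|_{H^s}\approx\varepsilon^{J-1},\qquad \|u^\varepsilon(0)\|_{H^s}=o\big(\|u^\varepsilon(t)\|_{H^s}\big),\qquad \|u^\varepsilon(0)\|_{H^s}\approx\varepsilon^{|s|}.$$ Here $\Lambda^\varepsilon\sim\Upsilon^\varepsilon$ means that the ratio tends to $1$, and $\Lambda^\varepsilon\approx\Upsilon^\varepsilon$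 means that each of the two is $O$ of the other. -/

import Mathlib

open MeasureTheory Filter Topology Set Asymptotics
open scoped FourierTransform SchwartzMap Laplacian ENNReal ComplexConjugate

namespace WeakNLS

/-- The space `ℝ^d` with its Euclidean norm. -/
abbrev E (d : ℕ) : Type := EuclideanSpace ℝ (Fin d)

/-! ### Fourier transform on `L²` and Sobolev norms -/

/-- The Fourier–Plancherel transform of an `L²` function, with Mathlib's normalization
`𝓕 f (ξ) = ∫ e^{-2π i x·ξ} f(x) dx` (and the value `0` if `f` is not in `L²`). -/
noncomputable def fourierL2 {d : ℕ} (f : E d → ℂ) : E d → ℂ :=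
  open Classical in
  if h : MemLp f 2 (volume : Measure (E d)) then
    ((𝓕 (MemLp.toLp f h) : Lp (α := E d) ℂ 2 volume) : E d → ℂ)
  else 0

/-- The `H^s(ℝ^d)` norm (`s ≤ 0`) of an `L²` function. With
`f^(ξ) = (2π)^{-d/2} ∫ e^{-i x·ξ} f(x) dx` one has, after the change of variables `ξ = 2π η`,
`∫ ⟨ξ⟩^{2s} |f^(ξ)|² dξ = ∫ ⟨2πη⟩^{2s} |𝓕 f(η)|² dη`, where `⟨ξ⟩ = (1 + |ξ|²)^{1/2}`. -/
noncomputable def sobolevNorm {d : ℕ} (s : ℝ) (f : E d → ℂ) : ℝ :=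
  √(∫ η : E d, (1 + ‖(2 * Real.pi) • η‖ ^ 2) ^ s * ‖fourierL2 f η‖ ^ 2)

/-! ### The nonlinear Schrödinger equation -/

/-- `u ∈ C([0,T]; L^p(ℝ^d))`. -/
def ContinuousInLp {d : ℕ} (p : ℝ≥0∞) (T : ℝ) (u : ℝ → E d → ℂ) : Prop :=
  (∀ t ∈ Icc 0 T, MemLp (u t) p (volume : Measure (E d))) ∧
  ∀ t ∈ Icc 0 T, Tendsto (fun τ => eLpNorm (u τ - u t) p (volume : Measure (E d)))
    (𝓝[Icc 0 T] t) (𝓝 0)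

/-- `u ∈ C([0,T]; L² ∩ L^∞)` solves
`i ε ∂_t u + (ε²/2) Δ u = μ ε^J |u|^{2ν} u`, `u(0) = u₀`,
on `[0,T]`: the equation holds for every time, tested against every Schwartz function. -/
structure IsNLSSolution {d : ℕ} (ν : ℕ) (μ J ε T : ℝ) (u₀ : E d → ℂ) (u : ℝ → E d → ℂ) :
    Prop where
  continuous_two : ContinuousInLp 2 T u
  continuous_top : ContinuousInLp ∞ T u
  initial : u 0 =ᵐ[volume] u₀
  equation : ∀ φ : 𝓢(E d, ℂ), ∀ t ∈ Icc 0 T, ∃ g' : ℂ,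
    HasDerivWithinAt (fun τ => ∫ x, u τ x * φ x) g' (Icc 0 T) t ∧
    Complex.I * ε * g' + (ε : ℂ) ^ 2 / 2 * (∫ x, u t x * (Δ φ) x) =
      μ * ((ε ^ J : ℝ) : ℂ) * (∫ x, (‖u t x‖ : ℂ) ^ (2 * ν) * u t x * φ x)

/-- The three initial wave vectors
`κ₁ = (1,0,…,0)`, `κ₂ = (1,1,0,…,0)`, `κ₃ = (0,1,0,…,0)`. -/
noncomputable def waveVec (d : ℕ) : Fin 3 → E d :=
  ![WithLp.toLp 2 fun i => if (i : ℕ) = 0 then 1 else 0,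
    WithLp.toLp 2 fun i => if (i : ℕ) = 0 ∨ (i : ℕ) = 1 then 1 else 0,
    WithLp.toLp 2 fun i => if (i : ℕ) = 1 then 1 else 0]

/-- The initial datum `∑_j α_j(x) e^{i κ_j·x/ε}`. -/
noncomputable def initialDatum {d : ℕ} (α : Fin 3 → 𝓢(E d, ℂ)) (ε : ℝ) (x : E d) : ℂ :=
  ∑ j, α j x * Complex.exp (Complex.I * ((inner ℝ (waveVec d j) x / ε : ℝ) : ℂ))

/-! ### Resonances and the profile system -/

/-- The wave vectors `ℓ_1, …, ℓ_{2ν+1}` generate `κ` by resonance: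
`∑ (-1)^{k+1} ℓ_k = κ` and `∑ (-1)^{k+1} |ℓ_k|² = |κ|²` (here `k` is counted from `0`). -/
def IsResonance {d : ℕ} (ν : ℕ) (ℓ : Fin (2 * ν + 1) → E d) (κ : E d) : Prop :=
  ∑ k : Fin (2 * ν + 1), (-1 : ℝ) ^ (k : ℕ) • ℓ k = κ ∧
    ∑ k : Fin (2 * ν + 1), (-1 : ℝ) ^ (k : ℕ) * ‖ℓ k‖ ^ 2 = ‖κ‖ ^ 2

/-- The set `Φ` of relevant wave vectors: the smallest set containing `Φ₀` and
stable under resonance. -/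
inductive Relevant {d : ℕ} (ν : ℕ) (Φ₀ : Set (E d)) : E d → Prop
  | initial (κ : E d) (hκ : κ ∈ Φ₀) : Relevant ν Φ₀ κ
  | resonance (ℓ : Fin (2 * ν + 1) → E d) (κ : E d) (hℓ : ∀ k, Relevant ν Φ₀ (ℓ k))
      (h : IsResonance ν ℓ κ) : Relevant ν Φ₀ κ

/-- The set `Φ` generated by the three initial wave vectors; it serves as the index set of
the profiles. -/
abbrev Modes (d ν : ℕ) : Type := {κ : E d // Relevant ν (range (waveVec d)) κ}

theorem sum_alternating {V : Type*} [AddCommGroup V] [Module ℝ V] (n : ℕ) (f : ℕ → V)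
    (hf : ∀ k, 3 ≤ k → f k = f 0) :
    ∑ k : Fin (2 * (n + 1) + 1), (-1 : ℝ) ^ (k : ℕ) • f k = f 0 - f 1 + f 2 := by
  rw [Fin.sum_univ_eq_sum_range (fun k => (-1 : ℝ) ^ k • f k),
    show 2 * (n + 1) + 1 = 3 + 2 * n by ring, Finset.sum_range_add]
  have h : ∑ x ∈ Finset.range (2 * n), (-1 : ℝ) ^ (3 + x) • f (3 + x) = 0 := by
    simp_rw [fun x => hf (3 + x) (by omega), pow_add]
    rw [← Finset.sum_smul, ← Finset.mul_sum, neg_one_geom_sum]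
    simp
  rw [h]
  simp [Finset.sum_range_succ, sub_eq_add_neg]

theorem norm_waveVec_sq {d : ℕ} (hd : 2 ≤ d) :
    ‖waveVec d 0‖ ^ 2 = 1 ∧ ‖waveVec d 1‖ ^ 2 = 2 ∧ ‖waveVec d 2‖ ^ 2 = 1 := by
  obtain ⟨m, rfl⟩ : ∃ m, d = m + 2 := ⟨d - 2, by omega⟩
  have h2 : waveVec (m + 2) 2 = WithLp.toLp 2 fun i : Fin (m + 2) => if (i : ℕ) = 1 then 1 else 0 := rfl
  rw [h2]
  refine ⟨?_, ?_, ?_⟩ <;>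
  · rw [EuclideanSpace.norm_sq_eq, Fin.sum_univ_succ, Fin.sum_univ_succ]
    norm_num [waveVec]

theorem relevant_zero {d ν : ℕ} (hd : 2 ≤ d) (hν : 1 ≤ ν) :
    Relevant ν (range (waveVec d)) (0 : E d) := by
  obtain ⟨n, rfl⟩ : ∃ n, ν = n + 1 := ⟨ν - 1, by omega⟩
  obtain ⟨h0, h1, h2⟩ := norm_waveVec_sq hd
  have hadd : waveVec d 0 - waveVec d 1 + waveVec d 2 = 0 := by
    ext i
    simp only [waveVec, Matrix.cons_val_zero, Matrix.cons_val_one, Matrix.cons_val,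
      PiLp.add_apply, PiLp.sub_apply, PiLp.zero_apply]
    by_cases hi : (i : ℕ) = 0
    · simp [hi]
    · by_cases hi' : (i : ℕ) = 1 <;> simp [hi, hi']
  let σ : ℕ → Fin 3 := fun k => if k = 1 then 1 else if k = 2 then 2 else 0
  refine Relevant.resonance (fun k => waveVec d (σ k)) 0
    (fun k => Relevant.initial _ ⟨_, rfl⟩) ⟨?_, ?_⟩
  · refine (sum_alternating n (fun k => waveVec d (σ k)) fun k hk => ?_).trans hadd
    have h1' : k ≠ 1 := by omega
    have h2' : k ≠ 2 := by omega
    simp [σ, h1', h2']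
  · refine (sum_alternating n (fun k => ‖waveVec d (σ k)‖ ^ 2) fun k hk => ?_).trans ?_
    · have h1' : k ≠ 1 := by omega
      have h2' : k ≠ 2 := by omega
      simp [σ, h1', h2']
    · change ‖waveVec d 0‖ ^ 2 - ‖waveVec d 1‖ ^ 2 + ‖waveVec d 2‖ ^ 2 = ‖(0 : E d)‖ ^ 2
      rw [h0, h1, h2, norm_zero]
      norm_num

/-- The zero mode `κ₀ = 0`. -/
noncomputable def zeroMode {d ν : ℕ} (hd : 2 ≤ d) (hν : 1 ≤ ν) : Modes d ν :=
  ⟨0, relevant_zero hd hν⟩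

/-- The resonant set `I_κ`: the tuples of relevant wave vectors that generate `κ`. -/
abbrev ResonantTuple {d ν : ℕ} (κ : Modes d ν) : Type :=
  {ℓ : Fin (2 * ν + 1) → Modes d ν // IsResonance ν (fun k => (ℓ k : E d)) κ}

/-- The nonlinear term `∑_{ℓ ∈ I_κ} a_{ℓ_1} conj(a_{ℓ_2}) a_{ℓ_3} ⋯ a_{ℓ_{2ν+1}}`. -/
noncomputable def interaction {d ν : ℕ} (a : Modes d ν → E d → ℂ) (κ : Modes d ν) (x : E d) :
    ℂ :=
  ∑' ℓ : ResonantTuple κ, ∏ k : Fin (2 * ν + 1),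
    if Even (k : ℕ) then a (ℓ.1 k) x else conj (a (ℓ.1 k) x)

/-- The norm `∑_κ (‖a_κ^‖_{L¹} + ‖a_κ^‖_{L²})` of the profile space `X`
(up to constant factors that come from the normalization of the Fourier transform). -/
noncomputable def profileNorm {d ν : ℕ} (a : Modes d ν → E d → ℂ) : ℝ≥0∞ :=
  ∑' κ, (eLpNorm (fourierL2 (a κ)) 1 (volume : Measure (E d)) +
    eLpNorm (fourierL2 (a κ)) 2 (volume : Measure (E d)))

/-- `a ∈ X`: all `a_κ` have Fourier transform in `L¹ ∩ L²` (and are identified with their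
continuous representatives), and these are summable over `κ`. -/
def MemX {d ν : ℕ} (a : Modes d ν → E d → ℂ) : Prop :=
  (∀ κ, Continuous (a κ) ∧ MemLp (a κ) 2 (volume : Measure (E d))) ∧ profileNorm a < ∞

/-- `a ∈ C([0,T]; X)` solves the profile system
`∂_t a_κ + κ·∇ a_κ = -i μ ε^{J-1} ∑_{ℓ ∈ I_κ} a_{ℓ_1} conj(a_{ℓ_2}) ⋯ a_{ℓ_{2ν+1}}`
with `a_κ(0) = α_j` if `κ = κ_j` is one of the three initial wave vectors and
`a_κ(0) = 0` otherwise. The transport derivative is the derivative along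
the characteristic line `τ ↦ (τ, x + (τ - t) κ)` through `(t, x)`. -/
structure IsProfileSolution {d ν : ℕ} (μ J ε T : ℝ) (α : Fin 3 → 𝓢(E d, ℂ))
    (a : ℝ → Modes d ν → E d → ℂ) : Prop where
  mem : ∀ t ∈ Icc 0 T, MemX (a t)
  continuous : ∀ t ∈ Icc 0 T,
    Tendsto (fun τ => profileNorm (a τ - a t)) (𝓝[Icc 0 T] t) (𝓝 0)
  initial_mode : ∀ (κ : Modes d ν) (j : Fin 3), (κ : E d) = waveVec d j → a 0 κ = α j
  initial_zero : ∀ κ : Modes d ν, (∀ j : Fin 3, (κ : E d) ≠ waveVec d j) → a 0 κ = 0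
  transport : ∀ (κ : Modes d ν) (x : E d), ∀ t ∈ Icc 0 T,
    HasDerivWithinAt (fun τ => a τ κ (x + (τ - t) • (κ : E d)))
      (-Complex.I * μ * ((ε ^ (J - 1) : ℝ) : ℂ) * interaction (a t) κ x) (Icc 0 T) t

end WeakNLS

/-!
In the interaction picture both problems take the form `c' = λ F(τ, c)`, with a bounded multilinear
`F(τ, c) = U(-τ) N(U(τ)c, …, U(τ)c)`, an isometric group `U`, and the same small coefficient
`λ = -iμ ε^{J-1}`. For the Schrödinger equation the space is the Wiener space `W` of functions with
Fourier transform in `L¹ ∩ L²`, an algebra (`W.exists_mul`); for the profile system it is the space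
`Y` of summable families in `W`, where summability of the interactions uses that a tuple generates
at most one mode. `exists_evolution` solves such equations on `[0, T]` for small `λ` and shows that
the solution is `c(0) + λ ∫₀ᵗ F(τ, c(0)) dτ` up to an error `O(|λ|²)` that is uniform in `ε`. It
remains to compute the first Duhamel iterates.

For the Schrödinger equation, `field_nlsData` writes `F(τ, c(0))` as a sum over tuples of initial
wave vectors. If the alternating sum of the tuple is not zero, then the term oscillates at
frequency `1/ε` and tends to zero in `H^s`, `s < 0` (`W.tendsto_weight_shift`). If it is zero, then
the alternating sum of the squared lengths is zero as well, because `|κ_j|²` equals the sum of the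
coordinates of `κ_j` (`alternating_norm_sq_eq_zero`); so there is no fast phase, and the term
converges to a product of transported profiles. The sum of these limits, `zeroModeSource`, is
exactly the source of the zero mode in the profile system (`mode_zero_field`). Consequently
`‖u(t)‖_{H^s} / |λ|` and `‖a₀(t)‖_{H^s} / |λ|` have the same limit, the `H^s` norm of
`∫₀ᵗ zeroModeSource` (`tendsto_weight_nls`, `tendsto_weight_profile`). The initial datum does not
contribute: its frequencies have size `1/ε`, so its norm is comparable to `ε^{|s|}`
(`isTheta_weight_nlsData`), and `|s| > J - 1`.

The amplitudes are positive multiples of one band-limited function that is positive at the origin.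
Then `zeroModeSource` has positive real part at the origin for small times, and the limit is not
zero (`exists_time_integral_ne_zero`).

Uniqueness for the profile system follows by integration along characteristics and Gronwall's
inequality (`profileSolution_unique`). For the Schrödinger equation, in the weaker space
`L² ∩ L^∞`, the difference of two solutions is tested with freely evolving Schwartz functions,
which removes the Laplacian and leaves a Lipschitz nonlinearity (`nlsSolution_unique`).
-/

namespace WeakNLS

variable {d : ℕ}

/-! ### Fourier transforms of integrable and of square integrable functions -/

theorem ae_eq_of_forall_schwartz {f g : E d → ℂ} (hf : LocallyIntegrable f)
    (hg : LocallyIntegrable g) (h : ∀ φ : 𝓢(E d, ℂ), ∫ x, φ x * f x = ∫ x, φ x * g x) :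
    f =ᵐ[volume] g := by
  refine ae_eq_of_integral_contDiff_smul_eq hf hg fun ψ hψ hc => ?_
  have hc' : HasCompactSupport (fun x => (ψ x : ℂ)) := hc.comp_left (g := Complex.ofReal) rfl
  have h' := h (hc'.toSchwartzMap (Complex.ofRealCLM.contDiff.comp hψ))
  simp only [Complex.real_smul]
  exact h'

theorem integral_schwartz_mul_fourierInv {f : E d → ℂ} (hf : Integrable f) (φ : 𝓢(E d, ℂ)) :
    ∫ x, φ x * 𝓕⁻ f x = ∫ x, (𝓕⁻ φ : 𝓢(E d, ℂ)) x * f x := by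
  have h := VectorFourier.integral_fourierIntegral_smul_eq_flip (μ := volume) (ν := volume)
    (L := -innerₗ (E d)) (f := (φ : E d → ℂ)) (g := f) Real.continuous_fourierChar
    (by simpa using! continuous_inner.neg) φ.integrable hf
  have h1 : ∀ (ψ : E d → ℂ) x,
      VectorFourier.fourierIntegral Real.fourierChar volume (-innerₗ (E d)) ψ x = 𝓕⁻ ψ x := by
    intro ψ x
    simp [VectorFourier.fourierIntegral, Real.fourierInv_eq]
  have h2 : ∀ (ψ : E d → ℂ) x,
      VectorFourier.fourierIntegral Real.fourierChar volume (-innerₗ (E d)).flip ψ x = 𝓕⁻ ψ x := by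
    intro ψ x
    simp [VectorFourier.fourierIntegral, Real.fourierInv_eq, real_inner_comm]
  simp only [h1, h2, smul_eq_mul] at h
  rw [← h]
  simp [SchwartzMap.fourierInv_coe]

theorem integral_schwartz_mul_fourierInv_L2 (f : Lp (α := E d) ℂ 2 volume) (φ : 𝓢(E d, ℂ)) :
    ∫ x, φ x * (𝓕⁻ f : Lp (α := E d) ℂ 2 volume) x = ∫ x, (𝓕⁻ φ : 𝓢(E d, ℂ)) x * f x := by
  have h := congrArg (fun D => D φ) (Lp.fourierInv_toTemperedDistribution_eq f)
  simpa [TemperedDistribution.fourierInv_apply] using h.symm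

theorem locallyIntegrable_Lp2 (f : Lp (α := E d) ℂ 2 volume) :
    LocallyIntegrable (f : E d → ℂ) := (Lp.memLp f).locallyIntegrable (by norm_num)

theorem continuous_fourierInv_of_integrable {f : E d → ℂ} (hf : Integrable f) :
    Continuous (𝓕⁻ f : E d → ℂ) := by
  have h : Continuous (𝓕 f : E d → ℂ) :=
    VectorFourier.fourierIntegral_continuous Real.continuous_fourierChar
      (by simpa using! continuous_inner) hf
  have h2 : (𝓕⁻ f : E d → ℂ) = fun x => 𝓕 f (-x) := by
    ext x; exact Real.fourierInv_eq_fourier_neg f x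
  rw [h2]
  exact h.comp continuous_neg

theorem norm_fourierInv_le (f : E d → ℂ) (x : E d) : ‖𝓕⁻ f x‖ ≤ ∫ ξ, ‖f ξ‖ := by
  rw [Real.fourierInv_eq]
  exact (norm_integral_le_integral_norm _).trans (by simp)

/-- For a function in `L¹ ∩ L²` the two inverse Fourier transforms agree. -/
theorem fourierInv_ae_eq {f : E d → ℂ} (hf : Integrable f) (g : Lp (α := E d) ℂ 2 volume)
    (hfg : f =ᵐ[volume] g) :
    (𝓕⁻ f : E d → ℂ) =ᵐ[volume] (𝓕⁻ g : Lp (α := E d) ℂ 2 volume) := by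
  refine ae_eq_of_forall_schwartz (continuous_fourierInv_of_integrable hf).locallyIntegrable
    (locallyIntegrable_Lp2 _) fun φ => ?_
  rw [integral_schwartz_mul_fourierInv hf, integral_schwartz_mul_fourierInv_L2]
  refine integral_congr_ae ?_
  filter_upwards [hfg] with x hx
  rw [hx]

/-- If the inverse Fourier transform of an integrable function is square integrable, then
so is the function. -/
theorem ae_eq_of_fourierInv_ae_eq {f : E d → ℂ} (hf : Integrable f)
    (g : Lp (α := E d) ℂ 2 volume)
    (hfg : (𝓕⁻ f : E d → ℂ) =ᵐ[volume] (𝓕⁻ g : Lp (α := E d) ℂ 2 volume)) :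
    f =ᵐ[volume] g := by
  refine ae_eq_of_forall_schwartz hf.locallyIntegrable (locallyIntegrable_Lp2 _) fun φ => ?_
  have h1 := integral_schwartz_mul_fourierInv hf (𝓕 φ)
  have h2 := integral_schwartz_mul_fourierInv_L2 g (𝓕 φ)
  rw [FourierTransform.fourierInv_fourier_eq] at h1 h2
  rw [← h1, ← h2]
  refine integral_congr_ae ?_
  filter_upwards [hfg] with x hx
  rw [hx]

theorem fourierL2_of_memLp {f : E d → ℂ} (hf : MemLp f 2 (volume : Measure (E d))) :
    fourierL2 f = ((𝓕 (MemLp.toLp f hf) : Lp (α := E d) ℂ 2 volume) : E d → ℂ) := dif_pos hf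

/-! ### The Wiener space -/

/-- The space of functions in `L¹ ∩ L²`, encoded as the pairs of classes in `L¹ × L²` that
agree almost everywhere. Its elements are the Fourier transforms of the functions under
consideration. -/
def wienerSubmodule (d : ℕ) :
    Submodule ℂ (Lp (α := E d) ℂ 1 volume × Lp (α := E d) ℂ 2 volume) where
  carrier := {p | (p.1 : E d → ℂ) =ᵐ[volume] p.2}
  zero_mem' := (Lp.coeFn_zero ..).trans (Lp.coeFn_zero ..).symm
  add_mem' {a b} ha hb := by
    replace ha : (a.1 : E d → ℂ) =ᵐ[volume] a.2 := ha
    replace hb : (b.1 : E d → ℂ) =ᵐ[volume] b.2 := hb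
    change ((a.1 + b.1 : Lp (α := E d) ℂ 1 volume) : E d → ℂ) =ᵐ[volume]
      ((a.2 + b.2 : Lp (α := E d) ℂ 2 volume) : E d → ℂ)
    exact (Lp.coeFn_add _ _).trans ((ha.add hb).trans (Lp.coeFn_add _ _).symm)
  smul_mem' c a ha := by
    replace ha : (a.1 : E d → ℂ) =ᵐ[volume] a.2 := ha
    change ((c • a.1 : Lp (α := E d) ℂ 1 volume) : E d → ℂ) =ᵐ[volume]
      ((c • a.2 : Lp (α := E d) ℂ 2 volume) : E d → ℂ)
    exact (Lp.coeFn_smul _ _).trans ((ha.const_smul c).trans (Lp.coeFn_smul _ _).symm)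

/-- The Wiener space `L¹ ∩ L²` on the Fourier side, with the maximum of the two norms. It is a type
synonym of the submodule, with only the structure needed below. -/
def W (d : ℕ) : Type := wienerSubmodule d

noncomputable instance : NormedAddCommGroup (W d) :=
  inferInstanceAs (NormedAddCommGroup (wienerSubmodule d))

noncomputable instance : NormedSpace ℂ (W d) :=
  inferInstanceAs (NormedSpace ℂ (wienerSubmodule d))

/-- Agreement almost everywhere is a closed condition, since it can be tested against Schwartz
functions. -/
theorem isClosed_wienerSubmodule (d : ℕ) : IsClosed (wienerSubmodule d :
    Set (Lp (α := E d) ℂ 1 volume × Lp (α := E d) ℂ 2 volume)) := by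
  have h : (wienerSubmodule d : Set (Lp (α := E d) ℂ 1 volume × Lp (α := E d) ℂ 2 volume)) =
      ⋂ φ : 𝓢(E d, ℂ), {p | Lp.toTemperedDistributionCLM ℂ volume 1 p.1 φ =
        Lp.toTemperedDistributionCLM ℂ volume 2 p.2 φ} := by
    ext p
    simp only [mem_iInter, mem_ofPred_eq, Lp.toTemperedDistributionCLM_apply,
      Lp.toTemperedDistribution_apply, smul_eq_mul]
    constructor
    · intro (hp : (p.1 : E d → ℂ) =ᵐ[volume] p.2) φ
      refine integral_congr_ae ?_
      filter_upwards [hp] with x hx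
      rw [hx]
    · intro hp
      exact ae_eq_of_forall_schwartz ((Lp.memLp p.1).locallyIntegrable le_rfl)
        (locallyIntegrable_Lp2 _) hp
  rw [h]
  refine isClosed_iInter fun φ => ?_
  have hev : Continuous fun D : 𝓢'(E d, ℂ) => D φ := by fun_prop
  refine isClosed_eq ?_ ?_
  · exact hev.comp ((Lp.toTemperedDistributionCLM ℂ volume 1).continuous.comp continuous_fst)
  · exact hev.comp ((Lp.toTemperedDistributionCLM ℂ volume 2).continuous.comp continuous_snd)

instance : CompleteSpace (W d) := (isClosed_wienerSubmodule d).completeSpace_coe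

namespace W

/-- A representative of an element of the Wiener space. -/
noncomputable def fn (z : W d) : E d → ℂ := z.1.1

/-- The element of the Wiener space given by a function in `L¹ ∩ L²`. -/
noncomputable def ofFun (f : E d → ℂ) (h1 : MemLp f 1 (volume : Measure (E d)))
    (h2 : MemLp f 2 (volume : Measure (E d))) : W d :=
  ⟨(h1.toLp f, h2.toLp f), h1.coeFn_toLp.trans h2.coeFn_toLp.symm⟩

theorem fn_ae (z : W d) : z.fn =ᵐ[volume] z.1.2 := z.2

theorem memLp_one (z : W d) : MemLp z.fn 1 (volume : Measure (E d)) := Lp.memLp z.1.1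

theorem memLp_two (z : W d) : MemLp z.fn 2 (volume : Measure (E d)) :=
  (memLp_congr_ae z.fn_ae).2 (Lp.memLp z.1.2)

theorem integrable (z : W d) : Integrable z.fn := memLp_one_iff_integrable.1 z.memLp_one

theorem fn_ofFun {f : E d → ℂ} (h1 : MemLp f 1 (volume : Measure (E d)))
    (h2 : MemLp f 2 (volume : Measure (E d))) : (ofFun f h1 h2).fn =ᵐ[volume] f := h1.coeFn_toLp

theorem ext {z w : W d} (h : z.fn =ᵐ[volume] w.fn) : z = w := by
  apply Subtype.ext
  apply Prod.ext
  · exact Lp.ext h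
  · exact Lp.ext (z.fn_ae.symm.trans (h.trans w.fn_ae))

theorem fn_add (z w : W d) : (z + w).fn =ᵐ[volume] z.fn + w.fn := Lp.coeFn_add z.1.1 w.1.1

theorem fn_sub (z w : W d) : (z - w).fn =ᵐ[volume] z.fn - w.fn := Lp.coeFn_sub z.1.1 w.1.1

theorem fn_smul (c : ℂ) (z : W d) : (c • z).fn =ᵐ[volume] c • z.fn := Lp.coeFn_smul c z.1.1

theorem norm_fst (z : W d) : ‖z.1.1‖ = (eLpNorm z.fn 1 (volume : Measure (E d))).toReal :=
  Lp.norm_def _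

theorem norm_snd (z : W d) : ‖z.1.2‖ = (eLpNorm z.fn 2 (volume : Measure (E d))).toReal := by
  rw [Lp.norm_def, eLpNorm_congr_ae z.fn_ae]

theorem norm_eq (z : W d) : ‖z‖ = max (eLpNorm z.fn 1 (volume : Measure (E d))).toReal
    (eLpNorm z.fn 2 (volume : Measure (E d))).toReal := by
  rw [← norm_fst, ← norm_snd]; rfl

theorem integral_norm_le (z : W d) : ∫ ξ, ‖z.fn ξ‖ ≤ ‖z‖ := by
  rw [norm_eq, eLpNorm_one_eq_lintegral_enorm, ← integral_norm_eq_lintegral_enorm z.integrable.1]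
  exact le_max_left _ _

/-- The `L²` component, as a continuous linear map. -/
noncomputable def toL2 : W d →L[ℂ] Lp (α := E d) ℂ 2 volume :=
  LinearMap.mkContinuous
    { toFun := fun z => z.1.2
      map_add' := fun _ _ => rfl
      map_smul' := fun _ _ => rfl } 1
    (fun z => by rw [one_mul]; exact le_max_right ‖z.1.1‖ ‖z.1.2‖)

theorem toL2_ae (z : W d) : z.fn =ᵐ[volume] toL2 z := z.fn_ae

theorem norm_toL2_le (z : W d) : ‖toL2 z‖ ≤ ‖z‖ := le_max_right ‖z.1.1‖ ‖z.1.2‖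

/-- The function whose Fourier transform is the given element of the Wiener space. -/
noncomputable def phys (z : W d) : E d → ℂ := 𝓕⁻ z.fn

theorem phys_add (z w : W d) : (z + w).phys = z.phys + w.phys := by
  ext x
  simp only [phys, Real.fourierInv_eq, Pi.add_apply]
  rw [← integral_add ((Real.fourierIntegral_convergent_iff (-x)).2 z.integrable |>.congr ?_)
    ((Real.fourierIntegral_convergent_iff (-x)).2 w.integrable |>.congr ?_)]
  · refine integral_congr_ae ?_
    filter_upwards [fn_add z w] with ξ hξ
    simp [hξ, smul_add]
  · simp
  · simp

theorem phys_smul (c : ℂ) (z : W d) : (c • z).phys = c • z.phys := by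
  ext x
  simp only [phys, Real.fourierInv_eq, Pi.smul_apply]
  rw [← integral_smul]
  refine integral_congr_ae ?_
  filter_upwards [fn_smul c z] with ξ hξ
  rw [hξ, Pi.smul_apply, smul_comm]

theorem continuous_phys (z : W d) : Continuous z.phys :=
  continuous_fourierInv_of_integrable z.integrable

theorem norm_phys_le (z : W d) (x : E d) : ‖z.phys x‖ ≤ ‖z‖ :=
  (norm_fourierInv_le _ x).trans z.integral_norm_le

theorem phys_ae (z : W d) : z.phys =ᵐ[volume] (𝓕⁻ (toL2 z) : Lp (α := E d) ℂ 2 volume) :=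
  fourierInv_ae_eq z.integrable _ z.fn_ae

theorem memLp_phys (z : W d) : MemLp z.phys 2 (volume : Measure (E d)) :=
  (memLp_congr_ae z.phys_ae).2 (Lp.memLp _)

theorem toLp_phys (z : W d) : z.memLp_phys.toLp = (𝓕⁻ (toL2 z) : Lp (α := E d) ℂ 2 volume) :=
  Lp.ext (z.memLp_phys.coeFn_toLp.trans z.phys_ae)

theorem fourierL2_phys (z : W d) : fourierL2 z.phys =ᵐ[volume] z.fn := by
  rw [fourierL2_of_memLp z.memLp_phys, toLp_phys, FourierTransform.fourier_fourierInv_eq]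
  exact z.fn_ae.symm

theorem eLpNorm_phys (z : W d) : eLpNorm z.phys 2 (volume : Measure (E d)) =
    eLpNorm z.fn 2 (volume : Measure (E d)) := by
  rw [eLpNorm_congr_ae z.phys_ae, eLpNorm_congr_ae z.toL2_ae,
    ← ENNReal.toReal_eq_toReal_iff' (Lp.eLpNorm_ne_top _) (Lp.eLpNorm_ne_top _), ← Lp.norm_def,
    ← Lp.norm_def, ← Lp.norm_fourier_eq, FourierTransform.fourier_fourierInv_eq]

theorem phys_injective : Function.Injective (phys : W d → E d → ℂ) := fun z w h =>
  ext (z.fourierL2_phys.symm.trans (h ▸ w.fourierL2_phys))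

theorem eLpNorm_top_phys_le (z : W d) :
    eLpNorm z.phys ∞ (volume : Measure (E d)) ≤ ENNReal.ofReal ‖z‖ := by
  rw [eLpNorm_exponent_top]
  refine eLpNormEssSup_le_of_ae_bound (Eventually.of_forall z.norm_phys_le)

/-- A continuous square integrable function with integrable Fourier transform is the inverse
transform of an element of the Wiener space. -/
theorem exists_phys_eq {f : E d → ℂ} (hc : Continuous f) (h2 : MemLp f 2 (volume : Measure (E d)))
    (h1 : eLpNorm (fourierL2 f) 1 (volume : Measure (E d)) < ∞) : ∃ z : W d, z.phys = f := by
  have e := fourierL2_of_memLp h2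
  have m2 : MemLp (fourierL2 f) 2 (volume : Measure (E d)) := by rw [e]; exact Lp.memLp _
  refine ⟨ofFun (fourierL2 f) ⟨m2.1, h1⟩ m2, ?_⟩
  refine (Continuous.ae_eq_iff_eq volume (continuous_phys _) hc).1 ?_
  refine (phys_ae _).trans ?_
  have : toL2 (ofFun (fourierL2 f) ⟨m2.1, h1⟩ m2) = 𝓕 (h2.toLp f) := by
    refine Lp.ext ((toL2_ae _).symm.trans ((fn_ofFun _ _).trans ?_))
    rw [e]
  rw [this, FourierTransform.fourierInv_fourier_eq]
  exact h2.coeFn_toLp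

/-- Evaluation at a point, as a continuous linear form. -/
noncomputable def evalCLM (x : E d) : W d →L[ℂ] ℂ :=
  LinearMap.mkContinuous
    { toFun := fun z => z.phys x
      map_add' := fun z w => by rw [phys_add]; rfl
      map_smul' := fun c z => by rw [phys_smul]; rfl } 1
    (fun z => by simpa using z.norm_phys_le x)

@[simp] theorem evalCLM_apply (x : E d) (z : W d) : evalCLM x z = z.phys x := rfl

@[simp] theorem phys_zero : (0 : W d).phys = 0 := funext fun x => (evalCLM x).map_zero

theorem phys_sub (z w : W d) : (z - w).phys = z.phys - w.phys :=
  funext fun x => (evalCLM x).map_sub z w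

end W

end WeakNLS

namespace WeakNLS

variable {d : ℕ}

/-! ### Products and Fourier multipliers on the Wiener space -/

/-- Dominated convergence for multiplication operators on `L^p`. -/
theorem tendsto_eLpNorm_mul_zero {ι : Type*} {l : Filter ι} [l.IsCountablyGenerated] {p : ℝ≥0∞}
    (hp : p ≠ 0) (hp' : p ≠ ∞) {m : ι → E d → ℂ} (hm : ∀ i, AEStronglyMeasurable (m i))
    {C : ℝ} (hC : ∀ i η, ‖m i η‖ ≤ C) {f : E d → ℂ}
    (hf : MemLp f p (volume : Measure (E d)))
    (hlim : ∀ η, Tendsto (fun i => m i η) l (𝓝 0)) :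
    Tendsto (fun i => eLpNorm (m i * f) p (volume : Measure (E d))) l (𝓝 0) := by
  have hpp : 0 < p.toReal := ENNReal.toReal_pos hp hp'
  simp only [eLpNorm_eq_lintegral_rpow_enorm_toReal hp hp']
  have key : Tendsto (fun i => ∫⁻ x, ‖(m i * f) x‖ₑ ^ p.toReal) l (𝓝 (∫⁻ _ : E d, 0)) := by
    refine tendsto_lintegral_filter_of_dominated_convergence'
      (fun x => (ENNReal.ofReal C * ‖f x‖ₑ) ^ p.toReal) ?_ ?_ ?_ ?_
    · exact Eventually.of_forall fun i => ((hm i).mul hf.1).enorm.pow_const _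
    · refine Eventually.of_forall fun i => Eventually.of_forall fun x => ?_
      rw [Pi.mul_apply, enorm_mul]
      gcongr
      rw [← ofReal_norm]
      exact ENNReal.ofReal_le_ofReal (hC i x)
    · have h := hf.2
      rw [eLpNorm_eq_lintegral_rpow_enorm_toReal hp hp',
        ENNReal.rpow_lt_top_iff_of_pos (by positivity)] at h
      simp_rw [ENNReal.mul_rpow_of_nonneg _ _ hpp.le]
      rw [lintegral_const_mul'' _ (hf.1.enorm.pow_const _)]
      exact (ENNReal.mul_lt_top (ENNReal.rpow_lt_top_of_nonneg hpp.le ENNReal.ofReal_ne_top) h).ne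
    · refine Eventually.of_forall fun x => ?_
      have h1 : Tendsto (fun i => ‖(m i * f) x‖ₑ) l (𝓝 0) := by
        have h2 : Tendsto (fun i => (m i * f) x) l (𝓝 0) := by
          simpa using (hlim x).mul_const (f x)
        simpa using h2.enorm
      have h2 := (ENNReal.continuous_rpow_const (y := p.toReal)).tendsto 0 |>.comp h1
      simpa [Function.comp_def, ENNReal.zero_rpow_of_pos hpp] using h2
  rw [lintegral_zero] at key
  have h2 := (ENNReal.continuous_rpow_const (y := 1 / p.toReal)).tendsto 0 |>.comp key
  rwa [ENNReal.zero_rpow_of_pos (by positivity)] at h2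

namespace W

theorem tendsto_of_eLpNorm {ι : Type*} {l : Filter ι} {z : ι → W d} {w : W d}
    (h1 : Tendsto (fun i => eLpNorm ((z i).fn - w.fn) 1 (volume : Measure (E d))) l (𝓝 0))
    (h2 : Tendsto (fun i => eLpNorm ((z i).fn - w.fn) 2 (volume : Measure (E d))) l (𝓝 0)) :
    Tendsto z l (𝓝 w) := by
  rw [tendsto_iff_norm_sub_tendsto_zero]
  simp only [norm_eq]
  have h : ∀ p : ℝ≥0∞, ∀ i, eLpNorm (z i - w).fn p (volume : Measure (E d)) =
      eLpNorm ((z i).fn - w.fn) p volume := fun p i => eLpNorm_congr_ae (fn_sub _ _)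
  simp only [h]
  have h1' := (ENNReal.tendsto_toReal ENNReal.zero_ne_top).comp h1
  have h2' := (ENNReal.tendsto_toReal ENNReal.zero_ne_top).comp h2
  simpa using h1'.max h2'

theorem norm_phase (x : ℝ) : ‖Complex.exp (-Complex.I * x)‖ = 1 := by
  rw [Complex.norm_exp]; simp

theorem memLp_phase_mul {p : ℝ≥0∞} (ω : C(E d, ℝ)) {f : E d → ℂ}
    (hf : MemLp f p (volume : Measure (E d))) :
    MemLp (fun η => Complex.exp (-Complex.I * ω η) * f η) p (volume : Measure (E d)) := by
  have hc : Continuous fun η => Complex.exp (-Complex.I * ω η) := by fun_prop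
  refine (memLp_congr_norm (hc.aestronglyMeasurable.mul hf.1) hf.1 ?_).2 hf
  exact Eventually.of_forall fun x => by rw [Pi.mul_apply, norm_mul, norm_phase, one_mul]

/-- Multiplication of the Fourier transform by the phase `e^{-iω}`. -/
noncomputable def phase (ω : C(E d, ℝ)) : W d →ₗᵢ[ℂ] W d where
  toFun z := ofFun (fun η => Complex.exp (-Complex.I * ω η) * z.fn η)
    (memLp_phase_mul ω z.memLp_one) (memLp_phase_mul ω z.memLp_two)
  map_add' z w := by
    refine ext ?_
    filter_upwards [fn_ofFun (memLp_phase_mul ω (z + w).memLp_one)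
        (memLp_phase_mul ω (z + w).memLp_two), fn_ofFun (memLp_phase_mul ω z.memLp_one)
        (memLp_phase_mul ω z.memLp_two), fn_ofFun (memLp_phase_mul ω w.memLp_one)
        (memLp_phase_mul ω w.memLp_two), fn_add z w,
        fn_add (ofFun _ (memLp_phase_mul ω z.memLp_one) (memLp_phase_mul ω z.memLp_two))
          (ofFun _ (memLp_phase_mul ω w.memLp_one) (memLp_phase_mul ω w.memLp_two))]
      with η h1 h2 h3 h4 h5
    rw [h1, h5, Pi.add_apply, h2, h3, h4, Pi.add_apply, mul_add]
  map_smul' c z := by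
    refine ext ?_
    filter_upwards [fn_ofFun (memLp_phase_mul ω (c • z).memLp_one)
        (memLp_phase_mul ω (c • z).memLp_two), fn_ofFun (memLp_phase_mul ω z.memLp_one)
        (memLp_phase_mul ω z.memLp_two), fn_smul c z,
        fn_smul c (ofFun _ (memLp_phase_mul ω z.memLp_one) (memLp_phase_mul ω z.memLp_two))]
      with η h1 h2 h3 h4
    simp only [RingHom.id_apply]
    rw [h1, h4, Pi.smul_apply, h2, h3, Pi.smul_apply, smul_eq_mul, smul_eq_mul]
    ring
  norm_map' z := by
    change ‖ofFun _ _ _‖ = ‖z‖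
    simp only [norm_eq]
    have h : ∀ p : ℝ≥0∞, eLpNorm (ofFun (fun η => Complex.exp (-Complex.I * ω η) * z.fn η)
        (memLp_phase_mul ω z.memLp_one) (memLp_phase_mul ω z.memLp_two)).fn p
          (volume : Measure (E d)) = eLpNorm z.fn p volume := by
      intro p
      rw [eLpNorm_congr_ae (fn_ofFun _ _)]
      refine eLpNorm_congr_norm_ae (Eventually.of_forall fun x => ?_)
      rw [norm_mul, norm_phase, one_mul]
    rw [h, h]

theorem fn_phase (ω : C(E d, ℝ)) (z : W d) :
    (phase ω z).fn =ᵐ[volume] fun η => Complex.exp (-Complex.I * ω η) * z.fn η :=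
  fn_ofFun (memLp_phase_mul ω z.memLp_one) (memLp_phase_mul ω z.memLp_two)

theorem phase_phase (ω₁ ω₂ : C(E d, ℝ)) (z : W d) :
    phase ω₁ (phase ω₂ z) = phase (ω₁ + ω₂) z := by
  refine ext ?_
  filter_upwards [fn_phase ω₁ (phase ω₂ z), fn_phase ω₂ z, fn_phase (ω₁ + ω₂) z] with η h1 h2 h3
  rw [h1, h2, h3, ← mul_assoc, ← Complex.exp_add, ContinuousMap.add_apply]
  push_cast
  ring_nf

@[simp] theorem phase_zero (z : W d) : phase 0 z = z := by
  refine ext ?_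
  filter_upwards [fn_phase 0 z] with η h1
  simp [h1]

theorem tendsto_phase {ι : Type*} {l : Filter ι} [l.IsCountablyGenerated] {ω : ι → C(E d, ℝ)}
    {ω₀ : C(E d, ℝ)} (h : ∀ η, Tendsto (fun i => ω i η) l (𝓝 (ω₀ η))) (z : W d) :
    Tendsto (fun i => phase (ω i) z) l (𝓝 (phase ω₀ z)) := by
  set m : ι → E d → ℂ := fun i η =>
    Complex.exp (-Complex.I * ω i η) - Complex.exp (-Complex.I * ω₀ η) with hm
  have hmeas : ∀ i, AEStronglyMeasurable (m i) volume := fun i => by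
    have : Continuous (m i) := by simp only [hm]; fun_prop
    exact this.aestronglyMeasurable
  have hb : ∀ i η, ‖m i η‖ ≤ 2 := fun i η => by
    refine (norm_sub_le _ _).trans ?_
    rw [norm_phase, norm_phase]; norm_num
  have hl : ∀ η, Tendsto (fun i => m i η) l (𝓝 0) := fun η => by
    have hc : Continuous fun x : ℝ => Complex.exp (-Complex.I * x) := by fun_prop
    have h1 := (hc.tendsto (ω₀ η)).comp (h η)
    simpa [hm, Function.comp_def] using h1.sub_const (Complex.exp (-Complex.I * ω₀ η))
  have he : ∀ p : ℝ≥0∞, ∀ i, eLpNorm ((phase (ω i) z).fn - (phase ω₀ z).fn) p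
      (volume : Measure (E d)) = eLpNorm (m i * z.fn) p volume := fun p i => by
    refine eLpNorm_congr_ae ?_
    filter_upwards [fn_phase (ω i) z, fn_phase ω₀ z] with η h1 h2
    rw [Pi.sub_apply, h1, h2, Pi.mul_apply, hm, sub_mul]
  refine tendsto_of_eLpNorm ?_ ?_
  · simp only [he]
    exact tendsto_eLpNorm_mul_zero one_ne_zero ENNReal.one_ne_top hmeas hb z.memLp_one hl
  · simp only [he]
    exact tendsto_eLpNorm_mul_zero two_ne_zero ENNReal.ofNat_ne_top hmeas hb z.memLp_two hl

theorem memLp_shift {p : ℝ≥0∞} (h : E d) {f : E d → ℂ}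
    (hf : MemLp f p (volume : Measure (E d))) :
    MemLp (fun η => f (η - h)) p (volume : Measure (E d)) :=
  hf.comp_measurePreserving (measurePreserving_sub_right volume h)

/-- Translation by `h` on the Fourier side. -/
noncomputable def shift (h : E d) (z : W d) : W d :=
  ofFun (fun η => z.fn (η - h)) (memLp_shift h z.memLp_one) (memLp_shift h z.memLp_two)

theorem fn_shift (h : E d) (z : W d) : (shift h z).fn =ᵐ[volume] fun η => z.fn (η - h) :=
  fn_ofFun (memLp_shift h z.memLp_one) (memLp_shift h z.memLp_two)

theorem norm_shift (h : E d) (z : W d) : ‖shift h z‖ = ‖z‖ := by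
  simp only [norm_eq]
  have : ∀ p : ℝ≥0∞, eLpNorm (shift h z).fn p (volume : Measure (E d)) =
      eLpNorm z.fn p volume := fun p => by
    rw [eLpNorm_congr_ae (fn_shift h z)]
    exact eLpNorm_comp_measurePreserving z.integrable.1 (measurePreserving_sub_right volume h)
  rw [this, this]

theorem phys_congr {f : E d → ℂ} {z : W d} (h : z.fn =ᵐ[volume] f) : z.phys = 𝓕⁻ f := by
  ext x
  simp only [phys, Real.fourierInv_eq]
  refine integral_congr_ae ?_
  filter_upwards [h] with η hη
  rw [hη]

theorem phys_shift (h : E d) (z : W d) (x : E d) :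
    (shift h z).phys x = Complex.exp (2 * Real.pi * Complex.I * (inner ℝ h x : ℝ)) * z.phys x := by
  rw [phys_congr (fn_shift h z), phys, Real.fourierInv_eq', Real.fourierInv_eq',
    ← integral_add_right_eq_self _ h, ← integral_const_mul]
  congr 1
  ext η
  simp only [add_sub_cancel_right, smul_eq_mul, ← mul_assoc, ← Complex.exp_add, inner_add_left]
  push_cast
  ring_nf

/-- A linear phase acts as a translation in physical space. -/
theorem phys_phase_linear (κ : E d) (ω : C(E d, ℝ)) (hω : ∀ η, ω η = 2 * Real.pi * inner ℝ κ η)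
    (z : W d) (x : E d) : (phase ω z).phys x = z.phys (x - κ) := by
  rw [phys_congr (fn_phase ω z), phys, Real.fourierInv_eq', Real.fourierInv_eq']
  congr 1
  ext η
  simp only [smul_eq_mul, ← mul_assoc, ← Complex.exp_add, hω, inner_sub_right,
    real_inner_comm κ η]
  push_cast
  ring_nf

theorem exists_conj (z : W d) : ∃ w : W d, w.phys = (fun x => conj (z.phys x)) ∧ ‖w‖ = ‖z‖ := by
  have hmp : MeasurePreserving (fun η : E d => -η) volume volume :=
    Measure.measurePreserving_neg volume
  have hmem : ∀ p : ℝ≥0∞, MemLp z.fn p (volume : Measure (E d)) →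
      MemLp (fun η => conj (z.fn (-η))) p (volume : Measure (E d)) := fun p hp =>
    (hp.comp_measurePreserving hmp).star
  refine ⟨ofFun _ (hmem 1 z.memLp_one) (hmem 2 z.memLp_two), ?_, ?_⟩
  · ext x
    rw [phys_congr (fn_ofFun _ _), phys, Real.fourierInv_eq', Real.fourierInv_eq', ← integral_conj,
      ← integral_neg_eq_self]
    congr 1
    ext η
    simp [← Complex.exp_conj, Complex.conj_ofNat]
  · simp only [norm_eq]
    have : ∀ p : ℝ≥0∞, eLpNorm (ofFun _ (hmem 1 z.memLp_one) (hmem 2 z.memLp_two)).fn p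
        (volume : Measure (E d)) = eLpNorm z.fn p volume := fun p => by
      rw [eLpNorm_congr_ae (fn_ofFun _ _), ← eLpNorm_comp_measurePreserving z.integrable.1 hmp]
      exact eLpNorm_congr_norm_ae (Eventually.of_forall fun x => by simp)
    rw [this, this]

open scoped Convolution in
/-- The Wiener space is an algebra under pointwise multiplication in physical space. On the Fourier
side the product is the convolution, which is bounded in `L¹` by Young's inequality; the `L²` bound
is the one of a product with a bounded function in physical space. -/
theorem exists_mul (z w : W d) : ∃ v : W d, v.phys = z.phys * w.phys ∧ ‖v‖ ≤ ‖z‖ * ‖w‖ := by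
  set g : E d → ℂ := z.fn ⋆[ContinuousLinearMap.mul ℂ ℂ] w.fn with hg
  have hgi : Integrable g := z.integrable.integrable_convolution _ w.integrable
  have hphys : (𝓕⁻ g : E d → ℂ) = z.phys * w.phys := by
    ext x
    simp only [phys, Pi.mul_apply, Real.fourierInv_eq_fourier_neg]
    exact Real.fourier_mul_convolution_eq z.integrable w.integrable (-x)
  have hbound : eLpNorm (z.phys * w.phys) 2 (volume : Measure (E d)) ≤
      ENNReal.ofReal ‖z‖ * eLpNorm w.phys 2 volume := by
    have := eLpNorm_le_mul_eLpNorm_of_ae_le_mul (μ := (volume : Measure (E d)))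
      (f := z.phys * w.phys) (g := w.phys) (c := ‖z‖)
      (Eventually.of_forall fun x => by
        rw [Pi.mul_apply, norm_mul]
        exact mul_le_mul_of_nonneg_right (z.norm_phys_le x) (norm_nonneg _)) 2
    exact this
  have hprod2 : MemLp (z.phys * w.phys) 2 (volume : Measure (E d)) :=
    ⟨(z.continuous_phys.mul w.continuous_phys).aestronglyMeasurable,
      hbound.trans_lt (ENNReal.mul_lt_top ENNReal.ofReal_lt_top w.memLp_phys.2)⟩
  have hg2 : g =ᵐ[volume] (𝓕 (hprod2.toLp) : Lp (α := E d) ℂ 2 volume) := by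
    refine ae_eq_of_fourierInv_ae_eq hgi _ ?_
    rw [FourierTransform.fourierInv_fourier_eq, hphys]
    exact hprod2.coeFn_toLp.symm
  have hgm2 : MemLp g 2 (volume : Measure (E d)) := (memLp_congr_ae hg2).2 (Lp.memLp _)
  refine ⟨ofFun g (memLp_one_iff_integrable.2 hgi) hgm2, ?_, ?_⟩
  · rw [phys_congr (fn_ofFun _ _), hphys]
  · have hw2 : ‖w.1.2‖ ≤ ‖w‖ := le_max_right _ _
    rw [norm_eq, eLpNorm_congr_ae (fn_ofFun _ _), eLpNorm_congr_ae (fn_ofFun _ _)]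
    refine max_le ?_ ?_
    · rw [eLpNorm_one_eq_lintegral_enorm, ← integral_norm_eq_lintegral_enorm hgi.1]
      have h1 : ∫ x, ‖g x‖ ≤ ∫ x, ((fun η => ‖z.fn η‖) ⋆[ContinuousLinearMap.mul ℝ ℝ]
          (fun η => ‖w.fn η‖)) x := by
        refine integral_mono hgi.norm
          (z.integrable.norm.integrable_convolution _ w.integrable.norm) fun x => ?_
        simp only [hg, convolution_def]
        refine (norm_integral_le_integral_norm _).trans (le_of_eq ?_)
        simp
      rw [integral_convolution _ z.integrable.norm w.integrable.norm] at h1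
      refine h1.trans ?_
      exact mul_le_mul z.integral_norm_le w.integral_norm_le
        (integral_nonneg fun _ => norm_nonneg _) (norm_nonneg _)
    · have h2 : eLpNorm g 2 (volume : Measure (E d)) = eLpNorm (z.phys * w.phys) 2 volume := by
        rw [eLpNorm_congr_ae hg2, ← eLpNorm_congr_ae hprod2.coeFn_toLp,
          ← ENNReal.toReal_eq_toReal_iff' (Lp.eLpNorm_ne_top _) (Lp.eLpNorm_ne_top _),
          ← Lp.norm_def, ← Lp.norm_def, Lp.norm_fourier_eq]
      rw [h2]
      refine (ENNReal.toReal_mono (ENNReal.mul_lt_top ENNReal.ofReal_lt_top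
        w.memLp_phys.2).ne hbound).trans ?_
      rw [ENNReal.toReal_mul, ENNReal.toReal_ofReal (norm_nonneg _), eLpNorm_phys, ← norm_snd]
      gcongr

/-- The factor in position `k` of the nonlinearity: factors in odd position are conjugated. -/
noncomputable def factor (k : ℕ) : W d →ₗ[ℝ] (E d → ℂ) where
  toFun z := fun x => if Even k then z.phys x else conj (z.phys x)
  map_add' z w := by ext x; simp only [phys_add, Pi.add_apply]; split_ifs <;> simp
  map_smul' c z := by
    ext x
    have h : (c • z).phys = c • z.phys := by
      rw [← Complex.coe_smul c z, phys_smul, Complex.coe_smul]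
    simp only [h, Pi.smul_apply, RingHom.id_apply]; split_ifs <;> simp

theorem factor_apply (k : ℕ) (z : W d) (x : E d) :
    factor k z x = if Even k then z.phys x else conj (z.phys x) := rfl

/-- The pointwise product of the inverse Fourier transforms, with the factors in odd position
conjugated. -/
noncomputable def physProd (d n : ℕ) : MultilinearMap ℝ (fun _ : Fin n => W d) (E d → ℂ) :=
  (MultilinearMap.mkPiAlgebra ℝ (Fin n) (E d → ℂ)).compLinearMap (fun k => factor (k : ℕ))

theorem physProd_apply {n : ℕ} (z : Fin n → W d) (x : E d) :
    physProd d n z x = ∏ k : Fin n, if Even (k : ℕ) then (z k).phys x else conj ((z k).phys x) := by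
  simp [physProd, Finset.prod_apply, factor_apply]

theorem exists_factor (k : ℕ) (z : W d) : ∃ w : W d, w.phys = factor k z ∧ ‖w‖ = ‖z‖ := by
  by_cases hk : Even k
  · exact ⟨z, by ext x; simp [factor_apply, hk], rfl⟩
  · obtain ⟨w, h, hn⟩ := exists_conj z
    exact ⟨w, by ext x; simp [factor_apply, hk, h], hn⟩

theorem exists_physProd : ∀ (n : ℕ) (z : Fin (n + 1) → W d),
    ∃ w : W d, w.phys = physProd d (n + 1) z ∧ ‖w‖ ≤ ∏ k, ‖z k‖
  | 0, z => by
    obtain ⟨w, h, hn⟩ := exists_factor 0 (z 0)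
    exact ⟨w, by ext x; simp [h, physProd_apply, factor_apply], by simp [hn]⟩
  | n + 1, z => by
    obtain ⟨w, h, hn⟩ := exists_physProd n (fun k => z k.castSucc)
    obtain ⟨w', h', hn'⟩ := exists_factor (n + 1) (z (Fin.last _))
    obtain ⟨v, hv, hvn⟩ := exists_mul w w'
    refine ⟨v, ?_, ?_⟩
    · ext x
      rw [hv, h, h', Pi.mul_apply, physProd_apply, physProd_apply,
        Fin.prod_univ_castSucc (n := n + 1)]
      rfl
    · rw [Fin.prod_univ_castSucc]
      refine hvn.trans ?_
      rw [hn']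
      gcongr

/-- `phys` as a real linear map. -/
noncomputable def physL : W d →ₗ[ℝ] (E d → ℂ) := factor 0

theorem physL_apply (z : W d) : physL z = z.phys := by
  ext x; simp [physL, factor_apply]

theorem physL_injective : Function.Injective (physL : W d →ₗ[ℝ] (E d → ℂ)) := fun z w h =>
  phys_injective (by rwa [physL_apply, physL_apply] at h)

/-- The product `(z₀, …, zₙ) ↦ z₀ z̄₁ z₂ z̄₃ ⋯` of physical space, as a multilinear map on the
Wiener space. -/
noncomputable def mulConjAux (d n : ℕ) :
    MultilinearMap ℝ (fun _ : Fin (n + 1) => W d) (W d) :=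
  (LinearEquiv.ofInjective physL physL_injective).symm.toLinearMap.compMultilinearMap
    ((physProd d (n + 1)).codRestrict (LinearMap.range physL) fun z => by
      obtain ⟨w, h, -⟩ := exists_physProd n z
      exact ⟨w, by rw [physL_apply, h]⟩)

theorem phys_mulConjAux {n : ℕ} (z : Fin (n + 1) → W d) :
    (mulConjAux d n z).phys = physProd d (n + 1) z := by
  have h := (LinearEquiv.ofInjective (physL (d := d)) physL_injective).apply_symm_apply
    (((physProd d (n + 1)).codRestrict (LinearMap.range physL) fun z => by
        obtain ⟨w, h, -⟩ := exists_physProd n z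
        exact ⟨w, by rw [physL_apply, h]⟩) z)
  have h' := congrArg Subtype.val h
  rw [LinearEquiv.ofInjective_apply, physL_apply] at h'
  exact h'

theorem norm_mulConjAux_le {n : ℕ} (z : Fin (n + 1) → W d) : ‖mulConjAux d n z‖ ≤ ∏ k, ‖z k‖ := by
  obtain ⟨w, h, hn⟩ := exists_physProd n z
  rwa [phys_injective ((phys_mulConjAux z).trans h.symm)]

/-- The product `(z₀, …, zₙ) ↦ z₀ z̄₁ z₂ z̄₃ ⋯` of physical space, as a continuous multilinear
map on the Wiener space. -/
noncomputable def mulConj (d n : ℕ) :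
    ContinuousMultilinearMap ℝ (fun _ : Fin (n + 1) => W d) (W d) :=
  (mulConjAux d n).mkContinuous 1 fun z => by rw [one_mul]; exact norm_mulConjAux_le z

theorem phys_mulConj {n : ℕ} (z : Fin (n + 1) → W d) :
    (mulConj d n z).phys = physProd d (n + 1) z := phys_mulConjAux z

theorem norm_mulConj_le {n : ℕ} (z : Fin (n + 1) → W d) : ‖mulConj d n z‖ ≤ ∏ k, ‖z k‖ :=
  norm_mulConjAux_le z

end W

end WeakNLS

namespace WeakNLS

/-! ### Summable families of elements of the Wiener space -/

/-- The space of summable families of elements of the Wiener space. -/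
def Y (d : ℕ) (K : Type) : Type := lp (fun _ : K => W d) 1

section Families

variable {d : ℕ} {K : Type}

noncomputable instance : NormedAddCommGroup (Y d K) :=
  inferInstanceAs (NormedAddCommGroup (lp (fun _ : K => W d) 1))

noncomputable instance : NormedSpace ℂ (Y d K) :=
  inferInstanceAs (NormedSpace ℂ (lp (fun _ : K => W d) 1))

instance : CompleteSpace (Y d K) :=
  inferInstanceAs (CompleteSpace (lp (fun _ : K => W d) 1))

namespace Y

/-- The component `a κ` of a summable family. -/
noncomputable def mode (κ : K) : Y d K →L[ℂ] W d :=
  LinearMap.mkContinuous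
    { toFun := fun a => a.1 κ
      map_add' := fun _ _ => rfl
      map_smul' := fun _ _ => rfl } 1
    (fun a => by rw [one_mul]; exact lp.norm_apply_le_norm one_ne_zero _ _)

/-- The summable family with the given components. -/
def mk (f : K → W d) (hf : Summable fun κ => ‖f κ‖) : Y d K :=
  (⟨f, memℓp_gen (by simpa using hf)⟩ : lp (fun _ : K => W d) 1)

@[simp] theorem mode_mk (f : K → W d) (hf : Summable fun κ => ‖f κ‖) (κ : K) :
    mode κ (mk f hf) = f κ := rfl

theorem ext {a b : Y d K} (h : ∀ κ, mode κ a = mode κ b) : a = b := lp.ext (funext h)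

theorem hasSum_norm (a : Y d K) : HasSum (fun κ => ‖mode κ a‖) ‖a‖ := by
  have h := lp.hasSum_norm (p := 1) (by simp) (a : lp (fun _ : K => W d) 1)
  simpa using! h

theorem norm_mode_le (a : Y d K) (κ : K) : ‖mode κ a‖ ≤ ‖a‖ :=
  lp.norm_apply_le_norm one_ne_zero _ _

theorem norm_mk (f : K → W d) (hf : Summable fun κ => ‖f κ‖) : ‖mk f hf‖ = ∑' κ, ‖f κ‖ :=
  (hasSum_norm (mk f hf)).tsum_eq.symm

end Y

theorem hasSum_pi_prod (n : ℕ) (f : Fin n → K → ℝ) (s : Fin n → ℝ) (h0 : ∀ k x, 0 ≤ f k x)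
    (h : ∀ k, HasSum (f k) (s k)) : HasSum (fun ℓ : Fin n → K => ∏ k, f k (ℓ k)) (∏ k, s k) := by
  induction n with
  | zero => simp [hasSum_unique]
  | succ n IH =>
    have ih := IH (fun k => f k.succ) (fun k => s k.succ) (fun k => h0 _) (fun k => h _)
    have hf : (0 : K → ℝ) ≤ f 0 := fun x => h0 0 x
    have hg : (0 : (Fin n → K) → ℝ) ≤ fun ℓ => ∏ k, f k.succ (ℓ k) := fun ℓ =>
      Finset.prod_nonneg fun k _ => h0 _ _
    have hs := Summable.mul_of_nonneg (h 0).summable ih.summable hf hg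
    have h2 := HasSum.mul (h 0) ih hs
    rw [Fin.prod_univ_succ]
    refine (Equiv.hasSum_iff (Fin.consEquiv fun _ => K)).1 ?_
    have h3 : ((fun ℓ : Fin (n + 1) → K => ∏ k, f k (ℓ k)) ∘ (Fin.consEquiv fun _ => K)) =
        fun x : K × (Fin n → K) => f 0 x.1 * ∏ k, f k.succ (x.2 k) := by
      ext x
      rw [Function.comp_apply, Fin.prod_univ_succ]
      rfl
    rw [h3]
    exact h2

namespace Y

variable {n : ℕ}

theorem summable_norm_mulConj (a : Fin (n + 1) → Y d K) :
    Summable (fun ℓ : Fin (n + 1) → K => ‖W.mulConj d n fun k => mode (ℓ k) (a k)‖) ∧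
      ∑' ℓ : Fin (n + 1) → K, ‖W.mulConj d n fun k => mode (ℓ k) (a k)‖ ≤ ∏ k, ‖a k‖ := by
  have h := hasSum_pi_prod (n + 1) (fun k κ => ‖mode κ (a k)‖) (fun k => ‖a k‖)
    (fun _ _ => norm_nonneg _) (fun k => hasSum_norm _)
  have hs : Summable (fun ℓ : Fin (n + 1) → K => ‖W.mulConj d n fun k => mode (ℓ k) (a k)‖) :=
    h.summable.of_nonneg_of_le (fun _ => norm_nonneg _) fun ℓ => W.norm_mulConj_le _
  refine ⟨hs, ?_⟩
  rw [← h.tsum_eq]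
  exact hs.tsum_le_tsum (fun ℓ => W.norm_mulConj_le _) h.summable

theorem injective_sigma_snd {I : K → (Fin (n + 1) → K) → Prop}
    (hI : ∀ ℓ κ κ', I κ ℓ → I κ' ℓ → κ = κ') :
    Function.Injective (fun x : (κ : K) × {ℓ // I κ ℓ} => x.2.1) := by
  rintro ⟨κ, ℓ, h⟩ ⟨κ', ℓ', h'⟩ (rfl : ℓ = ℓ')
  obtain rfl := hI _ _ _ h h'
  rfl

theorem summable_interaction {I : K → (Fin (n + 1) → K) → Prop}
    (hI : ∀ ℓ κ κ', I κ ℓ → I κ' ℓ → κ = κ') (a : Fin (n + 1) → Y d K) :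
    Summable (fun κ => ‖∑' ℓ : {ℓ // I κ ℓ}, W.mulConj d n fun k => mode (ℓ.1 k) (a k)‖) ∧
      ∑' κ, ‖∑' ℓ : {ℓ // I κ ℓ}, W.mulConj d n fun k => mode (ℓ.1 k) (a k)‖ ≤ ∏ k, ‖a k‖ := by
  obtain ⟨hs, hle⟩ := summable_norm_mulConj a
  have hinj := injective_sigma_snd hI
  have hσ := hs.comp_injective hinj
  have h1 : ∀ κ, ‖∑' ℓ : {ℓ // I κ ℓ}, W.mulConj d n fun k => mode (ℓ.1 k) (a k)‖ ≤
      ∑' ℓ : {ℓ // I κ ℓ}, ‖W.mulConj d n fun k => mode (ℓ.1 k) (a k)‖ := fun κ =>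
    norm_tsum_le_tsum_norm (hs.comp_injective Subtype.val_injective)
  have h2 : Summable fun κ => ∑' ℓ : {ℓ // I κ ℓ}, ‖W.mulConj d n fun k => mode (ℓ.1 k) (a k)‖ :=
    hσ.sigma
  have h3 := h2.of_nonneg_of_le (fun _ => norm_nonneg _) h1
  refine ⟨h3, (h3.tsum_le_tsum h1 h2).trans ?_⟩
  refine le_trans ?_ hle
  have h4 := hσ.tsum_sigma
  simp only [Function.comp_apply] at h4
  rw [← h4]
  exact tsum_comp_le_tsum_of_inj hs (fun _ => norm_nonneg _) hinj

/-- The interaction of families of modes: the `κ`-th component of the output is the sum over all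
`ℓ` with `I κ ℓ` of the products `a₀(ℓ₀) conj(a₁(ℓ₁)) a₂(ℓ₂) ⋯`. Every `ℓ` must contribute to at
most one component. -/
noncomputable def interaction {I : K → (Fin (n + 1) → K) → Prop}
    (hI : ∀ ℓ κ κ', I κ ℓ → I κ' ℓ → κ = κ') :
    ContinuousMultilinearMap ℝ (fun _ : Fin (n + 1) => Y d K) (Y d K) :=
  MultilinearMap.mkContinuous
    { toFun := fun a => mk (fun κ => ∑' ℓ : {ℓ // I κ ℓ},
        W.mulConj d n fun k => mode (ℓ.1 k) (a k)) (summable_interaction hI a).1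
      map_update_add' := by
        intro dec a i x y
        obtain rfl : dec = instDecidableEqFin (n + 1) := Subsingleton.elim _ _
        refine ext fun κ => ?_
        rw [map_add]
        simp only [mode_mk]
        have hsum : ∀ a : Fin (n + 1) → Y d K, Summable fun ℓ : {ℓ // I κ ℓ} =>
            W.mulConj d n fun k => mode (ℓ.1 k) (a k) := fun a =>
          ((summable_norm_mulConj a).1.comp_injective Subtype.val_injective).of_norm
        rw [← (hsum _).tsum_add (hsum _)]
        refine tsum_congr fun ℓ => ?_
        have hup : ∀ z : Y d K, (fun k => mode (ℓ.1 k) (Function.update a i z k)) =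
            Function.update (fun k => mode (ℓ.1 k) (a k)) i (mode (ℓ.1 i) z) := fun z => by
          ext1 k
          by_cases hk : k = i
          · subst hk; simp
          · simp [hk]
        rw [hup, hup, hup, map_add, ContinuousMultilinearMap.map_update_add]
      map_update_smul' := by
        intro dec a i c x
        obtain rfl : dec = instDecidableEqFin (n + 1) := Subsingleton.elim _ _
        refine ext fun κ => ?_
        rw [← Complex.coe_smul, ← Complex.coe_smul, map_smul]
        simp only [mode_mk]
        rw [← tsum_const_smul'']
        refine tsum_congr fun ℓ => ?_
        have hup : ∀ z : Y d K, (fun k => mode (ℓ.1 k) (Function.update a i z k)) =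
            Function.update (fun k => mode (ℓ.1 k) (a k)) i (mode (ℓ.1 i) z) := fun z => by
          ext1 k
          by_cases hk : k = i
          · subst hk; simp
          · simp [hk]
        rw [hup, hup, map_smul, Complex.coe_smul, Complex.coe_smul,
          ContinuousMultilinearMap.map_update_smul] } 1
    fun a => by
      rw [one_mul]
      exact (norm_mk _ (summable_interaction hI a).1).trans_le (summable_interaction hI a).2

theorem mode_interaction {I : K → (Fin (n + 1) → K) → Prop}
    (hI : ∀ ℓ κ κ', I κ ℓ → I κ' ℓ → κ = κ') (a : Fin (n + 1) → Y d K) (κ : K) :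
    mode κ (interaction hI a) =
      ∑' ℓ : {ℓ // I κ ℓ}, W.mulConj d n fun k => mode (ℓ.1 k) (a k) := rfl

theorem norm_interaction_le {I : K → (Fin (n + 1) → K) → Prop}
    (hI : ∀ ℓ κ κ', I κ ℓ → I κ' ℓ → κ = κ') (a : Fin (n + 1) → Y d K) :
    ‖interaction hI a‖ ≤ ∏ k, ‖a k‖ := by
  exact (norm_mk _ (summable_interaction hI a).1).trans_le (summable_interaction hI a).2

/-- Multiplication of the Fourier transform of the `κ`-th component by `e^{-iω_κ}`. -/
noncomputable def phase (ω : K → C(E d, ℝ)) : Y d K →ₗᵢ[ℂ] Y d K where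
  toFun a := mk (fun κ => W.phase (ω κ) (mode κ a)) (by
    simpa using (hasSum_norm a).summable)
  map_add' a b := ext fun κ => by simp
  map_smul' c a := ext fun κ => by simp
  norm_map' a := by
    refine (norm_mk (fun κ => W.phase (ω κ) (mode κ a)) (by
      simpa using (hasSum_norm a).summable)).trans ?_
    simpa using (hasSum_norm a).tsum_eq

@[simp] theorem mode_phase (ω : K → C(E d, ℝ)) (a : Y d K) (κ : K) :
    mode κ (phase ω a) = W.phase (ω κ) (mode κ a) := rfl

theorem tendsto_phase {ι : Type*} {l : Filter ι} [l.IsCountablyGenerated]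
    {ω : ι → K → C(E d, ℝ)} {ω₀ : K → C(E d, ℝ)}
    (h : ∀ κ η, Tendsto (fun i => ω i κ η) l (𝓝 (ω₀ κ η))) (a : Y d K) :
    Tendsto (fun i => phase (ω i) a) l (𝓝 (phase ω₀ a)) := by
  rw [tendsto_iff_norm_sub_tendsto_zero]
  have h1 : ∀ i, ‖phase (ω i) a - phase ω₀ a‖ =
      ∑' κ, ‖W.phase (ω i κ) (mode κ a) - W.phase (ω₀ κ) (mode κ a)‖ := fun i => by
    rw [← (hasSum_norm _).tsum_eq]
    simp
  simp only [h1]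
  have h2 : Tendsto (fun i => ∑' κ, ‖W.phase (ω i κ) (mode κ a) - W.phase (ω₀ κ) (mode κ a)‖) l
      (𝓝 (∑' _ : K, (0 : ℝ))) := tendsto_tsum_of_dominated_convergence
    (bound := fun κ => ‖mode κ a‖ + ‖mode κ a‖)
    ((hasSum_norm a).summable.add (hasSum_norm a).summable)
    (fun κ => by
      have := W.tendsto_phase (h κ) (mode κ a)
      rwa [tendsto_iff_norm_sub_tendsto_zero] at this)
    (Eventually.of_forall fun i κ => by
      rw [norm_norm]
      refine (norm_sub_le _ _).trans ?_
      rw [LinearIsometry.norm_map, LinearIsometry.norm_map])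
  simpa using h2

end Y

end Families

end WeakNLS

namespace WeakNLS

/-! ### Evolution equations with a multilinear nonlinearity -/

section Evolution

variable {X : Type*} [NormedAddCommGroup X] [NormedSpace ℂ X] {n : ℕ}

/-- The vector field `F(τ, c) = U(-τ) N(U(τ)c, …, U(τ)c)` of the interaction picture. -/
noncomputable def field (N : ContinuousMultilinearMap ℝ (fun _ : Fin (n + 1) => X) X)
    (U : ℝ → X →ₗᵢ[ℂ] X) (τ : ℝ) (c : X) : X := U (-τ) (N fun _ => U τ c)

variable {N : ContinuousMultilinearMap ℝ (fun _ : Fin (n + 1) => X) X}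
  {U : ℝ → X →ₗᵢ[ℂ] X}

theorem norm_field_le (hN : ∀ m, ‖N m‖ ≤ ∏ k, ‖m k‖) (τ : ℝ) (c : X) :
    ‖field N U τ c‖ ≤ ‖c‖ ^ (n + 1) := by
  rw [field, LinearIsometry.norm_map]
  refine (hN _).trans ?_
  simp

theorem norm_field_sub_le (hN : ∀ m, ‖N m‖ ≤ ∏ k, ‖m k‖) (τ : ℝ) {c c' : X} {R : ℝ}
    (hc : ‖c‖ ≤ R) (hc' : ‖c'‖ ≤ R) :
    ‖field N U τ c - field N U τ c'‖ ≤ (n + 1) * R ^ n * ‖c - c'‖ := by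
  have hN1 : ‖N‖ ≤ 1 := N.opNorm_le_bound zero_le_one fun m => by rw [one_mul]; exact hN m
  rw [field, field, ← map_sub, LinearIsometry.norm_map]
  refine (N.norm_image_sub_le _ _).trans ?_
  have h1 : ‖(fun _ : Fin (n + 1) => U τ c)‖ = ‖c‖ := by
    rw [pi_norm_const, LinearIsometry.norm_map]
  have h2 : ‖(fun _ : Fin (n + 1) => U τ c')‖ = ‖c'‖ := by
    rw [pi_norm_const, LinearIsometry.norm_map]
  have h3 : ‖(fun _ : Fin (n + 1) => U τ c) - (fun _ : Fin (n + 1) => U τ c')‖ = ‖c - c'‖ := by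
    rw [← LinearIsometry.norm_map (U τ) (c - c'), map_sub]
    exact pi_norm_const (ι := Fin (n + 1)) (U τ c - U τ c')
  rw [h1, h2, h3, Fintype.card_fin, Nat.add_sub_cancel]
  have h4 : max ‖c‖ ‖c'‖ ≤ R := max_le hc hc'
  have h5 : (0 : ℝ) ≤ max ‖c‖ ‖c'‖ := le_max_of_le_left (norm_nonneg _)
  have h6 : max ‖c‖ ‖c'‖ ^ n ≤ R ^ n := pow_le_pow_left₀ h5 h4 n
  push_cast
  have h7 : ‖N‖ * ((n : ℝ) + 1) ≤ 1 * (n + 1) := by gcongr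
  rw [one_mul] at h7
  gcongr

theorem continuous_isometries {Z : Type*} [TopologicalSpace Z]
    (hU : ∀ x, Continuous fun t => U t x) {τ : Z → ℝ} {c : Z → X} (hτ : Continuous τ)
    (hc : Continuous c) : Continuous fun z => U (τ z) (c z) := by
  rw [continuous_iff_continuousAt]
  intro z
  rw [ContinuousAt, tendsto_iff_norm_sub_tendsto_zero]
  have h1 : Tendsto (fun w => ‖c w - c z‖ + ‖U (τ w) (c z) - U (τ z) (c z)‖) (𝓝 z) (𝓝 0) := by
    have h2 := tendsto_iff_norm_sub_tendsto_zero.1 (hc.tendsto z)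
    have h3 := tendsto_iff_norm_sub_tendsto_zero.1 (((hU (c z)).comp hτ).tendsto z)
    simpa using h2.add h3
  refine squeeze_zero (fun _ => norm_nonneg _) (fun w => ?_) h1
  have : U (τ w) (c w) - U (τ z) (c z) =
      U (τ w) (c w - c z) + (U (τ w) (c z) - U (τ z) (c z)) := by rw [map_sub]; abel
  rw [this]
  refine (norm_add_le _ _).trans ?_
  rw [LinearIsometry.norm_map]

theorem continuous_field (hU : ∀ x, Continuous fun t => U t x) {Z : Type*} [TopologicalSpace Z]
    {τ : Z → ℝ} {c : Z → X} (hτ : Continuous τ) (hc : Continuous c) :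
    Continuous fun z => field N U (τ z) (c z) :=
  continuous_isometries hU hτ.neg
    (N.cont.comp (continuous_pi fun _ => continuous_isometries hU hτ hc))

/-- Uniqueness for `c' = λ F(t, c)`. -/
theorem evolution_unique (hN : ∀ m, ‖N m‖ ≤ ∏ k, ‖m k‖) {T : ℝ} {lam : ℂ} {c c' : ℝ → X}
    (hc : ∀ t ∈ Icc 0 T, HasDerivWithinAt c (lam • field N U t (c t)) (Icc 0 T) t)
    (hc' : ∀ t ∈ Icc 0 T, HasDerivWithinAt c' (lam • field N U t (c' t)) (Icc 0 T) t)
    (h0 : c 0 = c' 0) : EqOn c c' (Icc 0 T) := by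
  have hcc : ContinuousOn c (Icc 0 T) := fun t ht => (hc t ht).continuousWithinAt
  have hcc' : ContinuousOn c' (Icc 0 T) := fun t ht => (hc' t ht).continuousWithinAt
  obtain ⟨R₁, hR₁⟩ := isCompact_Icc.exists_bound_of_continuousOn hcc
  obtain ⟨R₂, hR₂⟩ := isCompact_Icc.exists_bound_of_continuousOn hcc'
  set R := max 0 (max R₁ R₂) with hRdef
  have hR : 0 ≤ R := le_max_left _ _
  set K : NNReal := NNReal.mk (‖lam‖ * ((n + 1) * R ^ n)) (by positivity) with hK
  have hright : ∀ {f : ℝ → X} {f' : X} {t : ℝ}, t ∈ Ico 0 T →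
      HasDerivWithinAt f f' (Icc 0 T) t → HasDerivWithinAt f f' (Ici t) t := fun ht h =>
    h.mono_of_mem_nhdsWithin (mem_of_superset (Icc_mem_nhdsGE ht.2) (Icc_subset_Icc_left ht.1))
  refine ODE_solution_unique_of_mem_Icc_right (v := fun t x => lam • field N U t x)
    (s := fun _ => {x | ‖x‖ ≤ R}) (K := K) (fun t _ => ?_) hcc
    (fun t ht => hright ht (hc t (Ico_subset_Icc_self ht)))
    (fun t ht => (hR₁ t (Ico_subset_Icc_self ht)).trans
      ((le_max_left _ _).trans (le_max_right _ _))) hcc'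
    (fun t ht => hright ht (hc' t (Ico_subset_Icc_self ht)))
    (fun t ht => (hR₂ t (Ico_subset_Icc_self ht)).trans
      ((le_max_right _ _).trans (le_max_right _ _))) h0
  refine LipschitzOnWith.of_dist_le_mul fun x hx y hy => ?_
  rw [dist_eq_norm, dist_eq_norm, ← smul_sub, norm_smul, hK, NNReal.coe_mk, mul_assoc]
  gcongr
  exact norm_field_sub_le hN t hx hy

variable [CompleteSpace X]

/-- Existence for `c' = λ F(t, c)`, `c(0) = c₀` on `[0, T]` when `λ` is small, with an estimate of
the difference to the first Picard iterate that is uniform in the group `U`. -/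
theorem exists_evolution (hN : ∀ m, ‖N m‖ ≤ ∏ k, ‖m k‖) (hU : ∀ x, Continuous fun t => U t x)
    {T R : ℝ} (hT : 0 ≤ T) {lam : ℂ} (hlam : ‖lam‖ * (R + 1) ^ (n + 1) * T ≤ 1) {c₀ : X}
    (hc₀ : ‖c₀‖ ≤ R) :
    ∃ c : ℝ → X, Continuous c ∧ c 0 = c₀ ∧
      (∀ t ∈ Icc 0 T, HasDerivWithinAt c (lam • field N U t (c t)) (Icc 0 T) t) ∧
      ∀ t ∈ Icc 0 T, ‖c t - c₀ - lam • ∫ τ in (0 : ℝ)..t, field N U τ c₀‖ ≤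
        (n + 1) * (R + 1) ^ n * (R + 1) ^ (n + 1) * T ^ 2 * ‖lam‖ ^ 2 := by
  have hR : 0 ≤ R := (norm_nonneg _).trans hc₀
  have hball : ∀ x ∈ Metric.closedBall c₀ (1 : ℝ), ‖x‖ ≤ R + 1 := fun x hx => by
    rw [mem_closedBall_iff_norm] at hx
    have := norm_le_norm_add_norm_sub' x c₀
    rw [norm_sub_rev] at hx
    linarith [norm_le_norm_add_norm_sub c₀ x, norm_sub_rev x c₀]
  set G : ℝ → X → X := fun t x => lam • field N U t x with hG
  set L : NNReal := NNReal.mk (‖lam‖ * (R + 1) ^ (n + 1)) (by positivity) with hL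
  set K : NNReal := NNReal.mk (‖lam‖ * ((n + 1) * (R + 1) ^ n)) (by positivity) with hK
  have hGle : ∀ t, ∀ x, ‖x‖ ≤ R + 1 → ‖G t x‖ ≤ ‖lam‖ * (R + 1) ^ (n + 1) := fun t x hx => by
    rw [hG, norm_smul]
    gcongr
    exact (norm_field_le hN _ _).trans (by gcongr)
  have hGlip : ∀ t, ∀ x y, ‖x‖ ≤ R + 1 → ‖y‖ ≤ R + 1 →
      ‖G t x - G t y‖ ≤ ‖lam‖ * ((n + 1) * (R + 1) ^ n) * ‖x - y‖ := fun t x y hx hy => by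
    simp only [hG]
    rw [← smul_sub, norm_smul, mul_assoc]
    gcongr
    exact norm_field_sub_le hN t hx hy
  have hGc : Continuous (Function.uncurry G) :=
    (continuous_field (N := N) hU continuous_fst continuous_snd).const_smul lam
  have hPL : IsPicardLindelof G (tmin := 0) (tmax := T) ⟨0, le_rfl, hT⟩ c₀ 1 0 L K := by
    refine ⟨fun t _ => ?_, fun x _ => ?_, fun t _ x hx => ?_, ?_⟩
    · exact LipschitzOnWith.of_dist_le_mul fun x hx y hy => by
        rw [dist_eq_norm, dist_eq_norm]
        exact hGlip t x y (hball x hx) (hball y hy)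
    · exact (hGc.comp (Continuous.prodMk_left x)).continuousOn
    · exact hGle t x (hball x hx)
    · simpa [hL, hT] using hlam
  obtain ⟨α, hα⟩ := ODE.FunSpace.exists_isFixedPt_next hPL (Metric.mem_closedBall_self le_rfl)
  rw [ODE.FunSpace.isFixedPt_next_iff] at hα
  set c : ℝ → X := α.compProj with hcdef
  have hcc : Continuous c := α.continuous_compProj
  have hcR : ∀ t, ‖c t‖ ≤ R + 1 := fun t =>
    hball _ (α.compProj_mem_closedBall hPL.mul_max_le)
  have hint : ∀ t ∈ Icc 0 T, c t = c₀ + ∫ τ in (0 : ℝ)..t, G τ (c τ) := fun t ht => by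
    rw [hcdef, ODE.FunSpace.compProj_of_mem ht]
    exact hα ⟨t, ht⟩
  have hcont1 : Continuous fun τ => G τ (c τ) := hGc.comp (continuous_id.prodMk hcc)
  have hcont0 : Continuous fun τ => G τ c₀ := hGc.comp (Continuous.prodMk_left c₀)
  refine ⟨c, hcc, ?_, fun t ht => ?_, fun t ht => ?_⟩
  · simpa using hint 0 ⟨le_rfl, hT⟩
  · have h1 := (intervalIntegral.integral_hasDerivAt_right (hcont1.intervalIntegrable 0 t)
      (hcont1.stronglyMeasurableAtFilter _ _) hcont1.continuousAt).const_add c₀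
    exact h1.hasDerivWithinAt.congr hint (hint t ht)
  · have hbd1 : ∀ τ ∈ Icc 0 T, ‖c τ - c₀‖ ≤ ‖lam‖ * (R + 1) ^ (n + 1) * T := fun τ hτ => by
      rw [hint τ hτ, add_sub_cancel_left]
      refine (intervalIntegral.norm_integral_le_of_norm_le_const
        (C := ‖lam‖ * (R + 1) ^ (n + 1)) fun x _ => hGle x _ (hcR x)).trans ?_
      rw [sub_zero, abs_of_nonneg hτ.1]
      gcongr
      exact hτ.2
    have h1 : c t - c₀ - lam • ∫ τ in (0 : ℝ)..t, field N U τ c₀ =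
        ∫ τ in (0 : ℝ)..t, (G τ (c τ) - G τ c₀) := by
      rw [intervalIntegral.integral_sub (hcont1.intervalIntegrable _ _)
        (hcont0.intervalIntegrable _ _), hint t ht, add_sub_cancel_left]
      congr 1
      simp only [hG]
      exact (intervalIntegral.integral_smul _ _).symm
    rw [h1]
    refine (intervalIntegral.norm_integral_le_of_norm_le_const
      (C := ‖lam‖ * ((n + 1) * (R + 1) ^ n) * (‖lam‖ * (R + 1) ^ (n + 1) * T))
        fun x hx => ?_).trans ?_
    · rw [uIoc_of_le ht.1] at hx
      refine (hGlip x _ _ (hcR x) (hc₀.trans (by linarith))).trans ?_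
      gcongr
      exact hbd1 x ⟨hx.1.le, hx.2.trans ht.2⟩
    · rw [sub_zero, abs_of_nonneg ht.1]
      have : ‖lam‖ * ((n + 1) * (R + 1) ^ n) * (‖lam‖ * (R + 1) ^ (n + 1) * T) * t ≤
          ‖lam‖ * ((n + 1) * (R + 1) ^ n) * (‖lam‖ * (R + 1) ^ (n + 1) * T) * T := by
        gcongr
        exact ht.2
      refine this.trans (le_of_eq ?_)
      ring

end Evolution

end WeakNLS

namespace WeakNLS

variable {d ν : ℕ}

/-! ### The profile system -/

namespace W

/-- The element of the Wiener space belonging to a Schwartz function. -/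
noncomputable def ofSchwartz (φ : 𝓢(E d, ℂ)) : W d :=
  ofFun (𝓕 φ : 𝓢(E d, ℂ)) ((𝓕 φ : 𝓢(E d, ℂ)).memLp 1) ((𝓕 φ : 𝓢(E d, ℂ)).memLp 2)

theorem fn_ofSchwartz (φ : 𝓢(E d, ℂ)) : (ofSchwartz φ).fn =ᵐ[volume] (𝓕 φ : 𝓢(E d, ℂ)) :=
  fn_ofFun _ _

theorem phys_ofSchwartz (φ : 𝓢(E d, ℂ)) : (ofSchwartz φ).phys = φ := by
  rw [phys_congr (fn_ofSchwartz φ), ← SchwartzMap.fourierInv_coe,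
    FourierTransform.fourierInv_fourier_eq]

end W

namespace Y

variable {K : Type}

open Classical in
/-- The family with the single nonzero component `z` at `κ`. -/
noncomputable def single (κ : K) (z : W d) : Y d K :=
  mk (fun κ' => if κ' = κ then z else 0) (summable_of_ne_finset_zero (s := {κ}) fun κ' h => by
    rw [if_neg (by simpa using h), norm_zero])

@[simp] theorem mode_single_self (κ : K) (z : W d) : mode κ (single κ z) = z := by
  simp [single]

theorem mode_single_ne {κ κ' : K} (h : κ' ≠ κ) (z : W d) : mode κ' (single κ z) = 0 := by
  simp [single, h]

theorem summable_mulConj {n : ℕ} (a : Fin (n + 1) → Y d K) {p : (Fin (n + 1) → K) → Prop} :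
    Summable fun ℓ : {ℓ // p ℓ} => W.mulConj d n fun k => mode (ℓ.1 k) (a k) :=
  ((summable_norm_mulConj a).1.comp_injective Subtype.val_injective).of_norm

end Y

theorem isResonance_unique (ℓ : Fin (2 * ν + 1) → Modes d ν) (κ κ' : Modes d ν)
    (h : IsResonance ν (fun k => (ℓ k : E d)) κ) (h' : IsResonance ν (fun k => (ℓ k : E d)) κ') :
    κ = κ' := Subtype.ext (h.1.symm.trans h'.1)

/-- The nonlinearity of the profile system on the space of summable families. -/
noncomputable abbrev profileN (d ν : ℕ) :
    ContinuousMultilinearMap ℝ (fun _ : Fin (2 * ν + 1) => Y d (Modes d ν)) (Y d (Modes d ν)) :=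
  Y.interaction (I := fun κ ℓ => IsResonance ν (fun k => (ℓ k : E d)) κ) isResonance_unique

/-- The symbol `2π κ·η` of the transport operator `-i κ·∇`. -/
noncomputable def drift (κ : E d) : C(E d, ℝ) :=
  ⟨fun η => 2 * Real.pi * inner ℝ κ η, by fun_prop⟩

@[simp] theorem drift_apply (κ η : E d) : drift κ η = 2 * Real.pi * inner ℝ κ η := rfl

/-- The group of the free profile system. -/
noncomputable def profileU (d ν : ℕ) (t : ℝ) : Y d (Modes d ν) →ₗᵢ[ℂ] Y d (Modes d ν) :=
  Y.phase fun κ => t • drift (κ : E d)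

theorem continuous_profileU (a : Y d (Modes d ν)) : Continuous fun t => profileU d ν t a := by
  rw [continuous_iff_continuousAt]
  intro t
  refine Y.tendsto_phase (fun κ η => ?_) a
  have : Continuous fun τ : ℝ => (τ • drift (κ : E d)) η := by
    simp only [ContinuousMap.smul_apply]; fun_prop
  exact this.tendsto t

theorem mode_profileU (t : ℝ) (a : Y d (Modes d ν)) (κ : Modes d ν) :
    Y.mode κ (profileU d ν t a) = W.phase (t • drift (κ : E d)) (Y.mode κ a) := rfl

theorem phys_profileU (t : ℝ) (a : Y d (Modes d ν)) (κ : Modes d ν) (x : E d) :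
    (Y.mode κ (profileU d ν t a)).phys x = (Y.mode κ a).phys (x - t • (κ : E d)) := by
  rw [mode_profileU, W.phys_phase_linear (t • (κ : E d))]
  intro η
  simp only [ContinuousMap.smul_apply, drift_apply, inner_smul_left, smul_eq_mul]
  simp
  ring

theorem profileU_neg_cancel (t : ℝ) (a : Y d (Modes d ν)) :
    profileU d ν t (profileU d ν (-t) a) = a := by
  refine Y.ext fun κ => ?_
  rw [mode_profileU, mode_profileU, W.phase_phase, ← add_smul, add_neg_cancel, zero_smul,
    W.phase_zero]

theorem phys_mode_profileN (a : Y d (Modes d ν)) (κ : Modes d ν) (x : E d) :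
    (Y.mode κ (profileN d ν fun _ => a)).phys x =
      interaction (fun κ => (Y.mode κ a).phys) κ x := by
  rw [Y.mode_interaction, ← W.evalCLM_apply,
    ContinuousLinearMap.map_tsum _ (Y.summable_mulConj fun _ => a), interaction]
  refine tsum_congr fun ℓ => ?_
  rw [W.evalCLM_apply, W.phys_mulConj, W.physProd_apply]

/-- The mode `κ_j`. -/
noncomputable def waveMode (d ν : ℕ) (j : Fin 3) : Modes d ν :=
  ⟨waveVec d j, Relevant.initial _ ⟨j, rfl⟩⟩

theorem waveVec_injective (hd : 2 ≤ d) : Function.Injective (waveVec d) := by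
  have h0 : ∀ j : Fin 3, (waveVec d j ⟨0, by omega⟩, waveVec d j ⟨1, by omega⟩) =
      ((![(1, 0), (1, 1), (0, 1)] : Fin 3 → ℝ × ℝ) j) := by
    intro j
    fin_cases j <;> simp [waveVec]
  intro i j h
  have h1 := (h0 i).symm.trans ((by rw [h]) : _ = _) |>.trans (h0 j)
  fin_cases i <;> fin_cases j <;> simp_all

/-- The initial data of the profile system. -/
noncomputable def profileData (ν : ℕ) (α : Fin 3 → 𝓢(E d, ℂ)) : Y d (Modes d ν) :=
  ∑ j, Y.single (waveMode d ν j) (W.ofSchwartz (α j))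

theorem mode_profileData_wave (hd : 2 ≤ d) (α : Fin 3 → 𝓢(E d, ℂ)) (j : Fin 3) :
    Y.mode (waveMode d ν j) (profileData ν α) = W.ofSchwartz (α j) := by
  rw [profileData, map_sum, Finset.sum_eq_single j, Y.mode_single_self]
  · intro i _ hij
    refine Y.mode_single_ne (fun h => hij ?_) _
    exact (waveVec_injective hd (congrArg Subtype.val h)).symm
  · simp

theorem mode_profileData_other (α : Fin 3 → 𝓢(E d, ℂ)) (κ : Modes d ν)
    (h : ∀ j : Fin 3, (κ : E d) ≠ waveVec d j) : Y.mode κ (profileData ν α) = 0 := by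
  rw [profileData, map_sum]
  refine Finset.sum_eq_zero fun j _ => Y.mode_single_ne (fun h' => h j ?_) _
  rw [h']; rfl

theorem profileNorm_phys (a : Y d (Modes d ν)) :
    profileNorm (fun κ => (Y.mode κ a).phys) =
      ∑' κ, (eLpNorm (Y.mode κ a).fn 1 (volume : Measure (E d)) +
        eLpNorm (Y.mode κ a).fn 2 (volume : Measure (E d))) := by
  refine tsum_congr fun κ => ?_
  rw [eLpNorm_congr_ae (W.fourierL2_phys _), eLpNorm_congr_ae (W.fourierL2_phys _)]

theorem profileNorm_phys_le (a : Y d (Modes d ν)) :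
    profileNorm (fun κ => (Y.mode κ a).phys) ≤ ENNReal.ofReal (2 * ‖a‖) := by
  rw [profileNorm_phys, ← ((Y.hasSum_norm a).mul_left 2).tsum_eq,
    ENNReal.ofReal_tsum_of_nonneg (fun _ => by positivity) ((Y.hasSum_norm a).mul_left 2).summable]
  refine ENNReal.tsum_le_tsum fun κ => ?_
  rw [two_mul, ENNReal.ofReal_add (norm_nonneg _) (norm_nonneg _)]
  refine add_le_add ?_ ?_
  · rw [← ENNReal.ofReal_toReal (Y.mode κ a).memLp_one.2.ne]
    exact ENNReal.ofReal_le_ofReal ((W.norm_eq _).symm ▸ le_max_left _ _)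
  · rw [← ENNReal.ofReal_toReal (Y.mode κ a).memLp_two.2.ne]
    exact ENNReal.ofReal_le_ofReal ((W.norm_eq _).symm ▸ le_max_right _ _)

theorem W.ofReal_norm_le (z : W d) : ENNReal.ofReal ‖z‖ ≤
    eLpNorm (fourierL2 z.phys) 1 (volume : Measure (E d)) +
      eLpNorm (fourierL2 z.phys) 2 (volume : Measure (E d)) := by
  rw [eLpNorm_congr_ae z.fourierL2_phys, eLpNorm_congr_ae z.fourierL2_phys, W.norm_eq,
    ENNReal.ofReal_max, ENNReal.ofReal_toReal z.memLp_one.2.ne,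
    ENNReal.ofReal_toReal z.memLp_two.2.ne]
  exact max_le le_self_add le_add_self

theorem ofReal_norm_le_profileNorm (a : Y d (Modes d ν)) :
    ENNReal.ofReal ‖a‖ ≤ profileNorm (fun κ => (Y.mode κ a).phys) := by
  rw [← (Y.hasSum_norm a).tsum_eq,
    ENNReal.ofReal_tsum_of_nonneg (fun _ => by positivity) (Y.hasSum_norm a).summable]
  exact ENNReal.tsum_le_tsum fun κ => W.ofReal_norm_le _

theorem exists_of_memX {b : Modes d ν → E d → ℂ} (hb : MemX b) :
    ∃ a : Y d (Modes d ν), ∀ κ, (Y.mode κ a).phys = b κ := by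
  have h1 : ∀ κ, ∃ z : W d, z.phys = b κ := fun κ =>
    W.exists_phys_eq (hb.1 κ).1 (hb.1 κ).2
      (lt_of_le_of_lt le_self_add (lt_of_le_of_lt (ENNReal.le_tsum κ) hb.2))
  choose z hz using h1
  have hs : Summable fun κ => ‖z κ‖ := by
    have h2 : ∑' κ, ENNReal.ofReal ‖z κ‖ ≠ ∞ := by
      refine (lt_of_le_of_lt (ENNReal.tsum_le_tsum fun κ => ?_) hb.2).ne
      rw [← hz κ]
      exact W.ofReal_norm_le _
    have h3 := ENNReal.summable_toReal h2
    simpa using h3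
  exact ⟨Y.mk z hs, hz⟩

/-- The coefficient `λ = -iμ ε^{J-1}` of both nonlinearities. -/
noncomputable def coupling (μ J ε : ℝ) : ℂ := -Complex.I * μ * ((ε ^ (J - 1) : ℝ) : ℂ)

theorem norm_coupling (μ J : ℝ) {ε : ℝ} (hε : 0 < ε) :
    ‖coupling μ J ε‖ = |μ| * ε ^ (J - 1) := by
  rw [coupling, norm_mul, norm_mul, norm_neg, Complex.norm_I, one_mul, Complex.norm_real,
    Complex.norm_real, Real.norm_eq_abs, Real.norm_eq_abs, abs_of_pos (Real.rpow_pos_of_pos hε _)]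

/-- The vector field of the profile system, evaluated along the characteristics. -/
theorem phys_field_profile (t : ℝ) (c : Y d (Modes d ν)) (κ : Modes d ν) (x : E d) :
    (Y.mode κ (field (profileN d ν) (profileU d ν) t c)).phys x =
      interaction (fun κ => (Y.mode κ (profileU d ν t c)).phys) κ (x + t • (κ : E d)) := by
  rw [field, phys_profileU, phys_mode_profileN, neg_smul, sub_neg_eq_add]

/-- A solution in the interaction picture gives a solution of the profile system. -/
theorem isProfileSolution_of_evolution (hd : 2 ≤ d) {μ J ε T : ℝ} {α : Fin 3 → 𝓢(E d, ℂ)}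
    {c : ℝ → Y d (Modes d ν)} (hc : Continuous c) (h0 : c 0 = profileData ν α)
    (h : ∀ t ∈ Icc 0 T, HasDerivWithinAt c
      (coupling μ J ε • field (profileN d ν) (profileU d ν) t (c t)) (Icc 0 T) t) :
    IsProfileSolution μ J ε T α (fun t κ => (Y.mode κ (profileU d ν t (c t))).phys) where
  mem t _ := ⟨fun κ => ⟨W.continuous_phys _, W.memLp_phys _⟩,
    (profileNorm_phys_le _).trans_lt ENNReal.ofReal_lt_top⟩
  continuous t _ := by
    have hcont : Continuous fun t => profileU d ν t (c t) :=
      continuous_isometries continuous_profileU continuous_id hc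
    have h1 : Tendsto (fun τ => ENNReal.ofReal
        (2 * ‖profileU d ν τ (c τ) - profileU d ν t (c t)‖)) (𝓝[Icc 0 T] t) (𝓝 0) := by
      have h2 := tendsto_iff_norm_sub_tendsto_zero.1 (hcont.tendsto t)
      have h3 := ENNReal.tendsto_ofReal (h2.const_mul 2)
      rw [mul_zero, ENNReal.ofReal_zero] at h3
      exact h3.mono_left nhdsWithin_le_nhds
    refine tendsto_of_tendsto_of_tendsto_of_le_of_le tendsto_const_nhds h1 (fun _ => zero_le)
      fun τ => ?_
    refine le_of_eq_of_le ?_ (profileNorm_phys_le _)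
    congr 1
    ext κ x
    rw [map_sub, W.phys_sub]
    rfl
  initial_mode κ j hκ := by
    obtain rfl : κ = waveMode d ν j := Subtype.ext hκ
    ext x
    rw [phys_profileU, zero_smul, sub_zero, h0, mode_profileData_wave hd, W.phys_ofSchwartz]
  initial_zero κ hκ := by
    ext x
    rw [phys_profileU, zero_smul, sub_zero, h0, mode_profileData_other α κ hκ, W.phys_zero]
  transport κ x t ht := by
    have h1 : HasDerivWithinAt (fun τ => (Y.mode κ (c τ)).phys (x - t • (κ : E d)))
        ((Y.mode κ (coupling μ J ε • field (profileN d ν) (profileU d ν) t (c t))).phys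
          (x - t • (κ : E d))) (Icc 0 T) t :=
      (((W.evalCLM (x - t • (κ : E d))).comp (Y.mode κ)).restrictScalars ℝ).hasFDerivAt
        |>.comp_hasDerivWithinAt t (h t ht)
    rw [map_smul, W.phys_smul, Pi.smul_apply, phys_field_profile, sub_add_cancel] at h1
    refine h1.congr (fun τ _ => ?_) ?_
    · rw [phys_profileU, sub_smul]
      congr 1; abel
    · rw [phys_profileU, sub_self, zero_smul, add_zero]

/-- Every solution of the profile system comes from the interaction picture, and therefore
solutions are unique. -/
theorem profileSolution_unique (hd : 2 ≤ d) {μ J ε T : ℝ} (hT : 0 ≤ T) {α : Fin 3 → 𝓢(E d, ℂ)}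
    {c : ℝ → Y d (Modes d ν)} (h0 : c 0 = profileData ν α)
    (h : ∀ t ∈ Icc 0 T, HasDerivWithinAt c
      (coupling μ J ε • field (profileN d ν) (profileU d ν) t (c t)) (Icc 0 T) t)
    {b : ℝ → Modes d ν → E d → ℂ} (hb : IsProfileSolution μ J ε T α b) {t : ℝ}
    (ht : t ∈ Icc 0 T) : b t = fun κ => (Y.mode κ (profileU d ν t (c t))).phys := by
  have hex : ∀ t, ∃ a : Y d (Modes d ν), t ∈ Icc 0 T → ∀ κ, (Y.mode κ a).phys = b t κ := by
    intro t
    by_cases ht : t ∈ Icc 0 T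
    · obtain ⟨a, ha⟩ := exists_of_memX (hb.mem t ht)
      exact ⟨a, fun _ => ha⟩
    · exact ⟨0, fun h => absurd h ht⟩
  choose B hB using hex
  have hBc : ContinuousOn B (Icc 0 T) := by
    intro t ht
    rw [ContinuousWithinAt, tendsto_iff_norm_sub_tendsto_zero]
    have h1 : Tendsto (fun τ => ENNReal.ofReal ‖B τ - B t‖) (𝓝[Icc 0 T] t) (𝓝 0) := by
      refine tendsto_of_tendsto_of_tendsto_of_le_of_le' tendsto_const_nhds (hb.continuous t ht)
        (Eventually.of_forall fun _ => zero_le) ?_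
      filter_upwards [self_mem_nhdsWithin] with τ hτ
      refine (ofReal_norm_le_profileNorm _).trans (le_of_eq ?_)
      congr 1
      ext κ x
      rw [map_sub, W.phys_sub, hB τ hτ, hB t ht]
      rfl
    have h2 := (ENNReal.tendsto_toReal ENNReal.zero_ne_top).comp h1
    simpa [Function.comp_def, ENNReal.toReal_ofReal] using h2
  set c' : ℝ → Y d (Modes d ν) := fun t => profileU d ν (-t) (B t) with hc'
  have hUc' : ∀ t, profileU d ν t (c' t) = B t := fun t => profileU_neg_cancel t _
  have hc'c : ContinuousOn c' (Icc 0 T) := by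
    rw [continuousOn_iff_continuous_domRestrict]
    exact continuous_isometries continuous_profileU continuous_subtype_val.neg
      (continuousOn_iff_continuous_domRestrict.1 hBc)
  set f : ℝ → Y d (Modes d ν) → Y d (Modes d ν) := fun t a =>
    coupling μ J ε • field (profileN d ν) (profileU d ν) t a with hf
  have hfc : Continuous (Function.uncurry f) :=
    (continuous_field (N := profileN d ν) continuous_profileU continuous_fst
      continuous_snd).const_smul (coupling μ J ε)
  have hG : ∀ t ∈ Icc 0 T, HasDerivWithinAt (ODE.picard f 0 (c' 0) c') (f t (c' t)) (Icc 0 T) t :=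
    fun t ht => ODE.hasDerivWithinAt_picard_Icc ⟨le_rfl, hT⟩ (u := univ) hfc.continuousOn hc'c
      (fun _ _ => mem_univ _) _ ht
  have hphys : ∀ t ∈ Icc 0 T, ∀ κ x, (Y.mode κ (c' t)).phys x = b t κ (x + t • (κ : E d)) :=
    fun t ht κ x => by
      rw [hc', phys_profileU, hB t ht, neg_smul, sub_neg_eq_add]
  have hfphys : ∀ t ∈ Icc 0 T, ∀ κ x, (Y.mode κ (f t (c' t))).phys x =
      coupling μ J ε * interaction (b t) κ (x + t • (κ : E d)) := fun t ht κ x => by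
    rw [hf, map_smul, W.phys_smul, Pi.smul_apply, phys_field_profile, hUc', smul_eq_mul]
    congr 2
    exact funext fun κ => hB t ht κ
  -- both curves have the same derivative after evaluation at a point
  have heq : EqOn c' (ODE.picard f 0 (c' 0) c') (Icc 0 T) := by
    intro t ht
    refine Y.ext fun κ => W.phys_injective (funext fun x => ?_)
    set g : ℝ → ℂ := fun τ => (Y.mode κ (c' τ)).phys x -
      (Y.mode κ (ODE.picard f 0 (c' 0) c' τ)).phys x with hg
    have hgd : ∀ τ ∈ Icc 0 T, HasDerivWithinAt g 0 (Icc 0 T) τ := fun τ hτ => by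
      have h1 : HasDerivWithinAt (fun τ => (Y.mode κ (ODE.picard f 0 (c' 0) c' τ)).phys x)
          ((Y.mode κ (f τ (c' τ))).phys x) (Icc 0 T) τ :=
        (((W.evalCLM x).comp (Y.mode κ)).restrictScalars ℝ).hasFDerivAt
          |>.comp_hasDerivWithinAt τ (hG τ hτ)
      have h2 := hb.transport κ (x + τ • (κ : E d)) τ hτ
      have h3 : HasDerivWithinAt (fun τ => (Y.mode κ (c' τ)).phys x)
          ((Y.mode κ (f τ (c' τ))).phys x) (Icc 0 T) τ := by
        rw [hfphys τ hτ]
        refine h2.congr (fun σ hσ => ?_) ?_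
        · rw [hphys σ hσ, sub_smul]
          congr 1; abel
        · rw [hphys τ hτ, sub_self, zero_smul, add_zero]
      have h4 := h3.sub h1
      rw [sub_self] at h4
      exact h4
    have hconst : g t = g 0 :=
      constant_of_has_deriv_right_zero (fun τ hτ => (hgd τ hτ).continuousWithinAt)
        (fun τ hτ => (hgd τ (Ico_subset_Icc_self hτ)).mono_of_mem_nhdsWithin
          (mem_of_superset (Icc_mem_nhdsGE hτ.2) (Icc_subset_Icc_left hτ.1))) t ht
    have hg0 : g 0 = 0 := by simp [hg]
    rw [hg0] at hconst
    exact sub_eq_zero.1 hconst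
  have hc'd : ∀ t ∈ Icc 0 T, HasDerivWithinAt c' (f t (c' t)) (Icc 0 T) t := fun t ht =>
    (hG t ht).congr heq (heq ht)
  have hc'0 : c 0 = c' 0 := by
    rw [h0]
    have h0T : (0 : ℝ) ∈ Icc 0 T := ⟨le_rfl, hT⟩
    refine Y.ext fun κ => W.phys_injective (funext fun x => ?_)
    rw [hphys 0 h0T, zero_smul, add_zero]
    by_cases hκ : ∃ j : Fin 3, (κ : E d) = waveVec d j
    · obtain ⟨j, hj⟩ := hκ
      rw [hb.initial_mode κ j hj]
      obtain rfl : κ = waveMode d ν j := Subtype.ext hj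
      rw [mode_profileData_wave hd, W.phys_ofSchwartz]
    · push Not at hκ
      rw [hb.initial_zero κ hκ, mode_profileData_other α κ hκ, W.phys_zero]
  have hfin := evolution_unique (Y.norm_interaction_le _) h hc'd hc'0 ht
  ext κ x
  rw [hfin, hUc', hB t ht]

end WeakNLS

namespace WeakNLS

variable {d : ℕ}

/-! ### Duality with Schwartz functions -/

/-- The bilinear form `∫ f g` on `L²`. -/
noncomputable def pairing (d : ℕ) : Lp (α := E d) ℂ 2 volume →L[ℂ]
    Lp (α := E d) ℂ 2 volume →L[ℂ] ℂ :=
  (ContinuousLinearMap.mul ℂ ℂ).lpPairing volume 2 2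

theorem pairing_apply (f g : Lp (α := E d) ℂ 2 volume) : pairing d f g = ∫ x, f x * g x := by
  rw [pairing, ContinuousLinearMap.lpPairing_eq_integral]
  rfl

theorem pairing_schwartz (φ : 𝓢(E d, ℂ)) (g : Lp (α := E d) ℂ 2 volume) :
    pairing d (φ.toLp 2) g = ∫ x, φ x * g x := by
  rw [pairing_apply]
  refine integral_congr_ae ?_
  filter_upwards [φ.coeFn_toLp 2 volume] with x hx
  rw [hx]

/-- Complex conjugation on `L²`. -/
noncomputable def conjL2 (f : Lp (α := E d) ℂ 2 volume) : Lp (α := E d) ℂ 2 volume :=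
  (Lp.memLp f).star.toLp

theorem conjL2_ae (f : Lp (α := E d) ℂ 2 volume) : conjL2 f =ᵐ[volume] fun x => conj (f x) :=
  (Lp.memLp f).star.coeFn_toLp

theorem norm_conjL2 (f : Lp (α := E d) ℂ 2 volume) : ‖conjL2 f‖ = ‖f‖ := by
  rw [Lp.norm_def, Lp.norm_def, eLpNorm_congr_ae (conjL2_ae f)]
  congr 1
  exact eLpNorm_congr_norm_ae (Eventually.of_forall fun x => by simp)

theorem pairing_eq_inner (f g : Lp (α := E d) ℂ 2 volume) :
    pairing d f g = inner ℂ (conjL2 f) g := by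
  rw [pairing_apply, L2.inner_def]
  refine integral_congr_ae ?_
  filter_upwards [conjL2_ae f] with x hx
  rw [hx]
  simp [mul_comm]

theorem norm_pairing_le (f g : Lp (α := E d) ℂ 2 volume) : ‖pairing d f g‖ ≤ ‖f‖ * ‖g‖ := by
  rw [pairing_eq_inner, ← norm_conjL2 f]
  exact norm_inner_le_norm _ _

/-- By density, Schwartz functions suffice to compute the `L²` norm by duality. -/
theorem norm_le_of_pairing_schwartz {g : Lp (α := E d) ℂ 2 volume} {M : ℝ} (hM : 0 ≤ M)
    (h : ∀ φ : 𝓢(E d, ℂ), ‖pairing d (φ.toLp 2) g‖ ≤ M * ‖φ.toLp 2 (volume : Measure (E d))‖) :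
    ‖g‖ ≤ M := by
  have h1 : ∀ f : Lp (α := E d) ℂ 2 volume, ‖pairing d f g‖ ≤ M * ‖f‖ := by
    intro f
    refine DenseRange.induction_on (p := fun f => ‖pairing d f g‖ ≤ M * ‖f‖)
      (SchwartzMap.denseRange_toLpCLM (F := ℂ) (E := E d) (p := 2) (μ := volume)
        ENNReal.ofNat_ne_top) f ?_ (fun φ => h φ)
    refine isClosed_le ?_ (continuous_const.mul continuous_norm)
    exact (((pairing d).flip g).continuous).norm
  have h2 := h1 (conjL2 g)
  have h3 : conjL2 (conjL2 g) = g := by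
    refine Lp.ext ?_
    filter_upwards [conjL2_ae (conjL2 g), conjL2_ae g] with x h4 h5
    rw [h4, h5, Complex.conj_conj]
  rw [pairing_eq_inner, h3, norm_conjL2, inner_self_eq_norm_sq_to_K, norm_pow] at h2
  simp only [Complex.coe_algebraMap, Complex.norm_real, norm_norm, sq] at h2
  by_cases hg : ‖g‖ = 0
  · rwa [hg]
  · exact le_of_mul_le_mul_right h2 (lt_of_le_of_ne (norm_nonneg _) (Ne.symm hg))

theorem hasTemperateGrowth_phase (a : ℝ) :
    (fun η : E d => Complex.exp (-Complex.I * (a * ‖η‖ ^ 2 : ℝ))).HasTemperateGrowth := by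
  have h1 : (fun x : ℝ => Complex.exp (-Complex.I * x)).HasTemperateGrowth := by
    have hd : ∀ n : ℕ, iteratedDeriv n (fun x : ℝ => Complex.exp (-Complex.I * x)) =
        fun x : ℝ => (-Complex.I) ^ n * Complex.exp (-Complex.I * x) := by
      intro n
      induction n with
      | zero => simp
      | succ n ih =>
        rw [iteratedDeriv_succ, ih]
        ext x
        have h0 : HasDerivAt (fun x : ℝ => Complex.exp (-Complex.I * x))
            (Complex.exp (-Complex.I * x) * -Complex.I) x := by
          have := ((hasDerivAt_id x).ofReal_comp.const_mul (-Complex.I)).cexp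
          simpa using this
        rw [(h0.const_mul _).deriv]
        ring
    refine ⟨?_, fun n => ⟨0, 1, fun x => ?_⟩⟩
    · exact (contDiff_const.mul Complex.ofRealCLM.contDiff).cexp
    · rw [norm_iteratedFDeriv_eq_norm_iteratedDeriv, hd]
      simp [W.norm_phase, -neg_mul]
  have h2 : (fun η : E d => a * ‖η‖ ^ 2).HasTemperateGrowth := by fun_prop
  exact h1.comp h2

/-- Multiplication of a Schwartz function by the quadratic phase `e^{-ia|η|²}`. -/
noncomputable def modulate (a : ℝ) (ψ : 𝓢(E d, ℂ)) : 𝓢(E d, ℂ) :=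
  SchwartzMap.smulLeftCLM ℂ (fun η : E d => Complex.exp (-Complex.I * (a * ‖η‖ ^ 2 : ℝ))) ψ

theorem modulate_apply (a : ℝ) (ψ : 𝓢(E d, ℂ)) (η : E d) :
    modulate a ψ η = Complex.exp (-Complex.I * (a * ‖η‖ ^ 2 : ℝ)) * ψ η := by
  rw [modulate, SchwartzMap.smulLeftCLM_apply_apply (hasTemperateGrowth_phase a), smul_eq_mul]

/-- Multiplication of a Schwartz function by `|η|²`. -/
noncomputable def mulNormSq (ψ : 𝓢(E d, ℂ)) : 𝓢(E d, ℂ) :=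
  SchwartzMap.smulLeftCLM ℂ (fun η : E d => ((‖η‖ ^ 2 : ℝ) : ℂ)) ψ

theorem mulNormSq_apply (ψ : 𝓢(E d, ℂ)) (η : E d) : mulNormSq ψ η = (‖η‖ ^ 2 : ℝ) * ψ η := by
  have h2 : (fun η : E d => ((‖η‖ ^ 2 : ℝ) : ℂ)).HasTemperateGrowth := by fun_prop
  rw [mulNormSq, SchwartzMap.smulLeftCLM_apply_apply h2, smul_eq_mul]

theorem norm_toLp_modulate (a : ℝ) (ψ : 𝓢(E d, ℂ)) :
    ‖(modulate a ψ).toLp 2 (volume : Measure (E d))‖ = ‖ψ.toLp 2 (volume : Measure (E d))‖ := by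
  rw [SchwartzMap.norm_toLp, SchwartzMap.norm_toLp]
  congr 1
  refine eLpNorm_congr_norm_ae (Eventually.of_forall fun x => ?_)
  rw [modulate_apply, norm_mul, W.norm_phase, one_mul]

theorem norm_phase_diff_le (x : ℝ) : ‖Complex.exp (-Complex.I * x) - 1‖ ≤ |x| := by
  have := Real.norm_exp_I_mul_ofReal_sub_one_le (x := -x)
  simpa using this

/-- The derivative of `τ ↦ e^{-iτa|η|²} ψ` in `L²`. The difference quotients are dominated by
`|a| |η|² |ψ|`, so that after division by `1 + |η|²` the multipliers are bounded and converge
pointwise. -/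
theorem hasDerivAt_modulate (a : ℝ) (ψ : 𝓢(E d, ℂ)) (t : ℝ) :
    HasDerivAt (fun τ : ℝ => (modulate (τ * a) ψ).toLp 2 (volume : Measure (E d)))
      ((-Complex.I * a) • (mulNormSq (modulate (t * a) ψ)).toLp 2 (volume : Measure (E d))) t := by
  rw [hasDerivAt_iff_tendsto_slope]
  rw [tendsto_iff_norm_sub_tendsto_zero]
  set e : ℝ → E d → ℂ := fun τ η => Complex.exp (-Complex.I * (τ * a * ‖η‖ ^ 2 : ℝ)) with he
  set m : ℝ → E d → ℂ := fun τ η => ((τ - t : ℝ)⁻¹ * (e τ η - e t η) -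
    -Complex.I * a * (‖η‖ ^ 2 : ℝ) * e t η) / (1 + (‖η‖ ^ 2 : ℝ)) with hm
  set f : E d → ℂ := ψ + mulNormSq ψ with hf
  have hfm : MemLp f 2 (volume : Measure (E d)) := (ψ.memLp 2).add ((mulNormSq ψ).memLp 2)
  have hpos : ∀ η : E d, (1 + (‖η‖ ^ 2 : ℝ) : ℂ) ≠ 0 := fun η => by
    have : (1 + ‖η‖ ^ 2 : ℝ) ≠ 0 := by positivity
    exact_mod_cast this
  have hnorm : ∀ τ, ‖slope (fun τ : ℝ => (modulate (τ * a) ψ).toLp 2 (volume : Measure (E d))) t τ -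
      (-Complex.I * a) • (mulNormSq (modulate (t * a) ψ)).toLp 2 (volume : Measure (E d))‖ =
      (eLpNorm (m τ * f) 2 (volume : Measure (E d))).toReal := fun τ => by
    rw [Lp.norm_def]
    congr 1
    refine eLpNorm_congr_ae ?_
    rw [slope_def_module]
    filter_upwards [Lp.coeFn_sub
        ((τ - t)⁻¹ • ((modulate (τ * a) ψ).toLp 2 (volume : Measure (E d)) -
          (modulate (t * a) ψ).toLp 2 (volume : Measure (E d))))
        ((-Complex.I * a) • (mulNormSq (modulate (t * a) ψ)).toLp 2 (volume : Measure (E d))),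
      Lp.coeFn_smul (τ - t)⁻¹ ((modulate (τ * a) ψ).toLp 2 (volume : Measure (E d)) -
        (modulate (t * a) ψ).toLp 2 (volume : Measure (E d))),
      Lp.coeFn_sub ((modulate (τ * a) ψ).toLp 2 (volume : Measure (E d)))
        ((modulate (t * a) ψ).toLp 2 (volume : Measure (E d))),
      Lp.coeFn_smul (-Complex.I * a) ((mulNormSq (modulate (t * a) ψ)).toLp 2
        (volume : Measure (E d))),
      (modulate (τ * a) ψ).coeFn_toLp 2 (volume : Measure (E d)),
      (modulate (t * a) ψ).coeFn_toLp 2 (volume : Measure (E d)),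
      (mulNormSq (modulate (t * a) ψ)).coeFn_toLp 2 (volume : Measure (E d))]
      with η h1 h2 h3 h4 h5 h6 h7
    rw [h1, Pi.sub_apply, h2, Pi.smul_apply, h3, Pi.sub_apply, h4, Pi.smul_apply, h5, h6, h7]
    simp only [modulate_apply, mulNormSq_apply, Pi.mul_apply, hm, hf, he, Pi.add_apply,
      Complex.real_smul, smul_eq_mul]
    have := hpos η
    field_simp
  simp only [hnorm]
  have hmeas : ∀ τ, AEStronglyMeasurable (m τ) (volume : Measure (E d)) := fun τ => by
    have : Continuous (m τ) := by
      simp only [hm, he]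
      exact Continuous.div (by fun_prop) (by fun_prop) hpos
    exact this.aestronglyMeasurable
  have hb : ∀ τ η, ‖m τ η‖ ≤ 2 * |a| := fun τ η => by
    have h1 : ‖e τ η - e t η‖ ≤ |τ - t| * |a| * ‖η‖ ^ 2 := by
      have h2 : e τ η - e t η =
          e t η * (Complex.exp (-Complex.I * ((τ - t) * a * ‖η‖ ^ 2 : ℝ)) - 1) := by
        simp only [he]
        rw [mul_sub, ← Complex.exp_add, mul_one]
        congr 2
        push_cast; ring
      rw [h2, norm_mul, he, W.norm_phase, one_mul]
      refine (norm_phase_diff_le _).trans (le_of_eq ?_)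
      rw [abs_mul, abs_mul, abs_of_nonneg (by positivity : 0 ≤ ‖η‖ ^ 2)]
    have h3 : ‖((τ - t : ℝ)⁻¹ * (e τ η - e t η) : ℂ)‖ ≤ |a| * ‖η‖ ^ 2 := by
      rw [norm_mul, Complex.norm_real, norm_inv, Real.norm_eq_abs]
      by_cases ht : τ = t
      · simp [ht]; positivity
      · have : 0 < |τ - t| := abs_pos.2 (sub_ne_zero.2 ht)
        rw [inv_mul_le_iff₀ this]
        linarith
    have h4 : ‖(-Complex.I * a * (‖η‖ ^ 2 : ℝ) * e t η : ℂ)‖ ≤ |a| * ‖η‖ ^ 2 := by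
      rw [norm_mul, he, W.norm_phase, mul_one, norm_mul, norm_mul, norm_neg, Complex.norm_I,
        one_mul, Complex.norm_real, Complex.norm_real, Real.norm_eq_abs,
        Real.norm_of_nonneg (by positivity : 0 ≤ ‖η‖ ^ 2)]
    have h5 : ‖(1 + (‖η‖ ^ 2 : ℝ) : ℂ)‖ = 1 + ‖η‖ ^ 2 := by
      rw [← Complex.ofReal_one, ← Complex.ofReal_add, Complex.norm_real,
        Real.norm_of_nonneg (by positivity)]
    rw [hm, norm_div, h5, div_le_iff₀ (by positivity)]
    refine (norm_sub_le _ _).trans ((add_le_add h3 h4).trans ?_)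
    nlinarith [abs_nonneg a, sq_nonneg ‖η‖]
  have hl : ∀ η, Tendsto (fun τ => m τ η) (𝓝[≠] t) (𝓝 0) := fun η => by
    have h0 : HasDerivAt (fun τ : ℝ => e τ η) (-Complex.I * a * (‖η‖ ^ 2 : ℝ) * e t η) t := by
      have h1 : HasDerivAt (fun τ : ℝ => ((τ * a * ‖η‖ ^ 2 : ℝ) : ℂ))
          ((a * ‖η‖ ^ 2 : ℝ) : ℂ) t := by
        have := (((hasDerivAt_id t).mul_const a).mul_const (‖η‖ ^ 2)).ofReal_comp
        simpa using this
      have h2 := (h1.const_mul (-Complex.I)).cexp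
      refine h2.congr_deriv ?_
      simp only [he]
      push_cast; ring
    rw [hasDerivAt_iff_tendsto_slope] at h0
    have h3 := (h0.sub_const (-Complex.I * a * (‖η‖ ^ 2 : ℝ) * e t η)).div_const
      (1 + (‖η‖ ^ 2 : ℝ) : ℂ)
    simp only [sub_self, zero_div] at h3
    refine h3.congr fun τ => ?_
    rw [slope_def_module, Complex.real_smul, hm]
  have h := tendsto_eLpNorm_mul_zero (l := 𝓝[≠] t) two_ne_zero ENNReal.ofNat_ne_top hmeas hb hfm hl
  exact (ENNReal.tendsto_toReal ENNReal.zero_ne_top).comp h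

/-- Product rule at a point where one factor is differentiable and vanishes, and the other one is
merely continuous. -/
theorem hasDerivWithinAt_pairing_of_eq_zero {f g : ℝ → Lp (α := E d) ℂ 2 volume}
    {f' : Lp (α := E d) ℂ 2 volume} {s : Set ℝ} {t : ℝ} (hf : HasDerivWithinAt f f' s t)
    (h0 : f t = 0) (hg : ContinuousWithinAt g s t) :
    HasDerivWithinAt (fun τ => pairing d (f τ) (g τ)) (pairing d f' (g t)) s t := by
  rw [hasDerivWithinAt_iff_tendsto_slope] at hf ⊢
  have h1 : Tendsto g (𝓝[s \ {t}] t) (𝓝 (g t)) :=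
    hg.tendsto.mono_left (nhdsWithin_mono _ sdiff_subset)
  have hc : Continuous fun p : Lp (α := E d) ℂ 2 volume × Lp (α := E d) ℂ 2 volume =>
      pairing d p.1 p.2 := (pairing d).isBoundedBilinearMap.continuous
  have h2 := (hc.tendsto (f', g t)).comp (hf.prodMk_nhds h1)
  refine h2.congr fun τ => ?_
  simp only [Function.comp_apply, slope_def_module, h0, sub_zero, map_zero,
    zero_apply]
  rw [RCLike.real_smul_eq_coe_smul (K := ℂ) (τ - t)⁻¹ (f τ), map_smul, smul_apply,
    RCLike.real_smul_eq_coe_smul (K := ℂ)]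

end WeakNLS

namespace WeakNLS

variable {d : ℕ}

/-! ### The nonlinear Schrödinger equation -/

theorem fourierInv_laplacian_apply (φ : 𝓢(E d, ℂ)) (η : E d) :
    (𝓕⁻ (Δ φ) : 𝓢(E d, ℂ)) η = -(2 * Real.pi) ^ 2 * mulNormSq (𝓕⁻ φ) η := by
  have h1 : ∀ f : 𝓢(E d, ℂ), ∀ η, (𝓕⁻ f : 𝓢(E d, ℂ)) η = (𝓕 f : 𝓢(E d, ℂ)) (-η) := by
    intro f η
    rw [SchwartzMap.fourierInv_coe, SchwartzMap.fourier_coe, Real.fourierInv_eq_fourier_neg]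
  have h2 : (fun η : E d => ‖η‖ ^ 2).HasTemperateGrowth := by fun_prop
  rw [mulNormSq_apply, h1, h1, SchwartzMap.laplacian_eq_fourierMultiplierCLM,
    FourierTransform.fourier_smul, SchwartzMap.fourierMultiplierCLM_apply,
    FourierTransform.fourier_fourierInv_eq]
  rw [smul_apply, SchwartzMap.smulLeftCLM_apply_apply h2]
  simp

/-- The coefficient of `|η|²` in the symbol of `-(ε/2) Δ`. -/
noncomputable def dispersion (ε : ℝ) : ℝ := 2 * Real.pi ^ 2 * ε

/-- The quadratic function `a |η|²`. -/
noncomputable def quad (d : ℕ) (a : ℝ) : C(E d, ℝ) := ⟨fun η => a * ‖η‖ ^ 2, by fun_prop⟩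

@[simp] theorem quad_apply (a : ℝ) (η : E d) : quad d a η = a * ‖η‖ ^ 2 := rfl

/-- The free Schrödinger group, which multiplies the Fourier transform by `e^{-2π²iεt|η|²}`. -/
noncomputable def nlsU (d : ℕ) (ε t : ℝ) : W d →ₗᵢ[ℂ] W d := W.phase (quad d (t * dispersion ε))

theorem continuous_nlsU (ε : ℝ) (z : W d) : Continuous fun t => nlsU d ε t z := by
  rw [continuous_iff_continuousAt]
  intro t
  refine W.tendsto_phase (fun η => ?_) z
  have : Continuous fun τ : ℝ => (quad d (τ * dispersion ε)) η := by
    simp only [quad_apply]; fun_prop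
  exact this.tendsto t

theorem nlsU_neg_cancel (ε t : ℝ) (z : W d) : nlsU d ε t (nlsU d ε (-t) z) = z := by
  rw [nlsU, nlsU, W.phase_phase]
  have : quad d (t * dispersion ε) + quad d (-t * dispersion ε) = 0 := by
    ext η; simp
  rw [this, W.phase_zero]

@[simp] theorem nlsU_zero (ε : ℝ) (z : W d) : nlsU d ε 0 z = z := by
  have : quad d (0 * dispersion ε) = 0 := by ext η; simp
  rw [nlsU, this, W.phase_zero]

theorem prod_alternating_conj (ν : ℕ) (a : ℂ) :
    (∏ k : Fin (2 * ν + 1), if Even (k : ℕ) then a else conj a) = (‖a‖ : ℂ) ^ (2 * ν) * a := by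
  rw [Fin.prod_univ_eq_prod_range (fun k => if Even k then a else conj a)]
  induction ν with
  | zero => simp
  | succ n ih =>
    rw [show 2 * (n + 1) + 1 = 2 * n + 1 + 1 + 1 by ring, Finset.prod_range_succ,
      Finset.prod_range_succ, ih, if_neg (by simp [parity_simps]), if_pos (by simp [parity_simps])]
    have h : (‖a‖ : ℂ) ^ 2 = conj a * a := by
      rw [mul_comm, Complex.mul_conj, Complex.normSq_eq_norm_sq]; push_cast; rfl
    rw [show 2 * (n + 1) = 2 * n + 2 by ring, pow_add, h]
    ring

theorem phys_mulConj_diag (ν : ℕ) (z : W d) (x : E d) :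
    (W.mulConj d (2 * ν) fun _ => z).phys x = (‖z.phys x‖ : ℂ) ^ (2 * ν) * z.phys x := by
  rw [W.phys_mulConj, W.physProd_apply, prod_alternating_conj]

theorem integral_phys_mul (z : W d) (φ : 𝓢(E d, ℂ)) :
    ∫ x, z.phys x * φ x = pairing d ((𝓕⁻ φ : 𝓢(E d, ℂ)).toLp 2) (W.toL2 z) := by
  rw [pairing_schwartz]
  simp_rw [mul_comm (z.phys _)]
  rw [W.phys, integral_schwartz_mul_fourierInv z.integrable]
  refine integral_congr_ae ?_
  filter_upwards [z.toL2_ae] with η h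
  rw [h]

theorem pairing_nlsU (ε t : ℝ) (ψ : 𝓢(E d, ℂ)) (z : W d) :
    pairing d (ψ.toLp 2) (W.toL2 (nlsU d ε t z)) =
      pairing d ((modulate (t * dispersion ε) ψ).toLp 2) (W.toL2 z) := by
  rw [pairing_schwartz, pairing_schwartz]
  refine integral_congr_ae ?_
  filter_upwards [z.toL2_ae, (nlsU d ε t z).toL2_ae, W.fn_phase (quad d (t * dispersion ε)) z]
    with η h1 h2 h3
  rw [← h2, nlsU, h3, ← h1, modulate_apply, quad_apply]
  ring

theorem modulate_mulNormSq (a : ℝ) (ψ : 𝓢(E d, ℂ)) :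
    modulate a (mulNormSq ψ) = mulNormSq (modulate a ψ) := by
  ext η
  simp only [modulate_apply, mulNormSq_apply]
  ring

theorem modulate_modulate (a b : ℝ) (ψ : 𝓢(E d, ℂ)) :
    modulate a (modulate b ψ) = modulate (a + b) ψ := by
  ext η
  simp only [modulate_apply, ← mul_assoc, ← Complex.exp_add]
  congr 2
  push_cast; ring

@[simp] theorem modulate_zero (ψ : 𝓢(E d, ℂ)) : modulate 0 ψ = ψ := by
  ext η
  simp [modulate_apply]

theorem fourierInv_laplacian_toLp (φ : 𝓢(E d, ℂ)) :
    (𝓕⁻ (Δ φ) : 𝓢(E d, ℂ)).toLp 2 (volume : Measure (E d)) =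
      (-(2 * Real.pi) ^ 2 : ℂ) • (mulNormSq (𝓕⁻ φ)).toLp 2 (volume : Measure (E d)) := by
  refine Lp.ext ?_
  filter_upwards [(𝓕⁻ (Δ φ) : 𝓢(E d, ℂ)).coeFn_toLp 2 (volume : Measure (E d)),
    (mulNormSq (𝓕⁻ φ)).coeFn_toLp 2 (volume : Measure (E d)),
    Lp.coeFn_smul (-(2 * Real.pi) ^ 2 : ℂ) ((mulNormSq (𝓕⁻ φ)).toLp 2 (volume : Measure (E d)))]
    with η h1 h2 h3
  rw [h1, h3, Pi.smul_apply, h2, fourierInv_laplacian_apply, smul_eq_mul]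

/-- Product rule for `τ ↦ ∫ e^{-iτa|η|²} ψ(η) g(τ, η) dη` in terms of the derivative of the
pairing of `g` with the test function frozen at time `t`. -/
theorem hasDerivWithinAt_pairing_modulate (a : ℝ) (ψ : 𝓢(E d, ℂ))
    {g : ℝ → Lp (α := E d) ℂ 2 volume} {s : Set ℝ} {t : ℝ} {D : ℂ}
    (hg : ContinuousWithinAt g s t)
    (hD : HasDerivWithinAt (fun τ => pairing d ((modulate (t * a) ψ).toLp 2) (g τ)) D s t) :
    HasDerivWithinAt (fun τ => pairing d ((modulate (τ * a) ψ).toLp 2) (g τ))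
      (-Complex.I * a * pairing d ((mulNormSq (modulate (t * a) ψ)).toLp 2) (g t) + D) s t := by
  have h1 := hasDerivWithinAt_pairing_of_eq_zero
    (((hasDerivAt_modulate a ψ t).sub_const
      ((modulate (t * a) ψ).toLp 2 (volume : Measure (E d)))).hasDerivWithinAt (s := s))
    (sub_self _) hg
  have h2 := h1.add hD
  rw [map_smul, smul_apply, smul_eq_mul] at h2
  refine h2.congr (fun τ _ => ?_) ?_ <;> simp

theorem integral_nlsU_mul_laplacian {ε a : ℝ} (ha : a = dispersion ε) (t : ℝ) (z : W d)
    {φ ψ : 𝓢(E d, ℂ)} (hψ : ψ = 𝓕⁻ φ) :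
    ∫ x, (nlsU d ε t z).phys x * (Δ φ) x = (-(2 * Real.pi) ^ 2 : ℂ) *
      pairing d ((mulNormSq (modulate (t * a) ψ)).toLp 2) (W.toL2 z) := by
  subst hψ ha
  have h1 : ∀ χ : 𝓢(E d, ℂ), ∀ ψ, χ = ψ → ∫ x, (nlsU d ε t z).phys x * χ x =
      pairing d ((𝓕⁻ ψ : 𝓢(E d, ℂ)).toLp 2) (W.toL2 (nlsU d ε t z)) := by
    rintro χ _ rfl
    exact integral_phys_mul _ χ
  -- the two coercions to functions are definitionally but not syntactically equal
  have h2 : ∀ x, (Δ φ) x = (Δ φ : 𝓢(E d, ℂ)) x := fun x => rfl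
  simp only [h2]
  rw [h1 _ _ rfl, fourierInv_laplacian_toLp, map_smul, smul_apply, smul_eq_mul,
    pairing_nlsU, modulate_mulNormSq]

theorem coupling_mul (μ J : ℝ) {ε : ℝ} (hε : 0 < ε) :
    Complex.I * ε * coupling μ J ε = μ * ((ε ^ J : ℝ) : ℂ) := by
  have h : ε ^ J = ε * ε ^ (J - 1) := by
    rw [Real.rpow_sub_one hε.ne']; field_simp
  rw [coupling, h]
  push_cast
  linear_combination (-(ε : ℂ) * μ * ((ε ^ (J - 1) : ℝ) : ℂ)) * Complex.I_sq

theorem hasDerivWithinAt_clm {X : Type*} [NormedAddCommGroup X] [NormedSpace ℂ X]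
    (L : X →L[ℂ] ℂ) {c : ℝ → X} {c' : X} {s : Set ℝ} {t : ℝ} (h : HasDerivWithinAt c c' s t) :
    HasDerivWithinAt (fun τ => L (c τ)) (L c') s t :=
  (L.restrictScalars ℝ).hasFDerivAt.comp_hasDerivWithinAt t h

/-- The weak Schrödinger equation in terms of pairings on the Fourier side: the derivative of the
phase cancels the Laplacian. -/
theorem schrodinger_balance {ε : ℝ} {a lam F I₁ I₂ P₁ P₂ : ℂ} (e1 : I₁ = P₁)
    (e2 : I₂ = -(2 * Real.pi) ^ 2 * P₂) (e3 : a = 2 * Real.pi ^ 2 * ε)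
    (e4 : Complex.I * ε * lam = F) :
    Complex.I * ε * (-Complex.I * a * P₂ + lam * P₁) + (ε : ℂ) ^ 2 / 2 * I₂ = F * I₁ := by
  rw [e1, e2, e3, ← e4]
  linear_combination (-2 * Real.pi ^ 2 * (ε : ℂ) ^ 2 * P₂) * Complex.I_sq

/-- A solution in the interaction picture gives a solution of the Schrödinger equation. -/
theorem isNLSSolution_of_evolution {ν : ℕ} {μ J ε T : ℝ} (hε : 0 < ε) {u₀ : E d → ℂ}
    {c : ℝ → W d} (hc : Continuous c) (h0 : (c 0).phys = u₀)
    (h : ∀ t ∈ Icc 0 T, HasDerivWithinAt c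
      (coupling μ J ε • field (W.mulConj d (2 * ν)) (nlsU d ε) t (c t)) (Icc 0 T) t) :
    IsNLSSolution ν μ J ε T u₀ (fun t => (nlsU d ε t (c t)).phys) := by
  have hcont : Continuous fun t => nlsU d ε t (c t) :=
    continuous_isometries (continuous_nlsU ε) continuous_id hc
  have hlim : ∀ t, Tendsto (fun τ => ENNReal.ofReal ‖nlsU d ε τ (c τ) - nlsU d ε t (c t)‖)
      (𝓝[Icc 0 T] t) (𝓝 0) := fun t => by
    have h2 := tendsto_iff_norm_sub_tendsto_zero.1 (hcont.tendsto t)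
    have h3 := ENNReal.tendsto_ofReal h2
    rw [ENNReal.ofReal_zero] at h3
    exact h3.mono_left nhdsWithin_le_nhds
  refine ⟨⟨fun t _ => W.memLp_phys _, fun t _ => ?_⟩, ⟨fun t _ => ?_, fun t _ => ?_⟩, ?_, ?_⟩
  · refine tendsto_of_tendsto_of_tendsto_of_le_of_le tendsto_const_nhds (hlim t)
      (fun _ => zero_le) fun τ => ?_
    simp only
    rw [← W.phys_sub, W.eLpNorm_phys,
      ← ENNReal.ofReal_toReal (nlsU d ε τ (c τ) - nlsU d ε t (c t)).memLp_two.2.ne]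
    exact ENNReal.ofReal_le_ofReal ((W.norm_eq _).symm ▸ le_max_right _ _)
  · exact ⟨(W.continuous_phys _).aestronglyMeasurable,
      (W.eLpNorm_top_phys_le _).trans_lt ENNReal.ofReal_lt_top⟩
  · refine tendsto_of_tendsto_of_tendsto_of_le_of_le tendsto_const_nhds (hlim t)
      (fun _ => zero_le) fun τ => ?_
    simp only
    rw [← W.phys_sub]
    exact W.eLpNorm_top_phys_le _
  · simp [h0]
  · intro φ t ht
    obtain ⟨ψ, hψ⟩ : ∃ ψ : 𝓢(E d, ℂ), ψ = 𝓕⁻ φ := ⟨_, rfl⟩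
    obtain ⟨a, ha⟩ : ∃ a, a = dispersion ε := ⟨_, rfl⟩
    set n : W d := W.mulConj d (2 * ν) fun _ => nlsU d ε t (c t) with hn
    have h1 : HasDerivWithinAt
        (fun τ => pairing d ((modulate (t * a) ψ).toLp 2) (W.toL2 (c τ)))
        (coupling μ J ε * pairing d (ψ.toLp 2) (W.toL2 n)) (Icc 0 T) t := by
      have h2 := hasDerivWithinAt_clm ((pairing d ((modulate (t * a) ψ).toLp 2)).comp W.toL2)
        (h t ht)
      rw [map_smul, smul_eq_mul, ContinuousLinearMap.comp_apply, field, ha, ← pairing_nlsU,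
        nlsU_neg_cancel, ← ha] at h2
      exact h2
    have h2 := hasDerivWithinAt_pairing_modulate a ψ
      ((W.toL2.continuous.comp hc).continuousWithinAt) h1
    refine ⟨_, h2.congr (fun τ _ => ?_) ?_, ?_⟩
    · rw [integral_phys_mul, pairing_nlsU, ← ha, ← hψ]; rfl
    · rw [integral_phys_mul, pairing_nlsU, ← ha, ← hψ]; rfl
    · have e1 : ∫ x, (‖(nlsU d ε t (c t)).phys x‖ : ℂ) ^ (2 * ν) * (nlsU d ε t (c t)).phys x * φ x =
          pairing d (ψ.toLp 2 (volume : Measure (E d))) (W.toL2 n) := by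
        rw [hψ, ← integral_phys_mul]
        simp only [hn, phys_mulConj_diag]
      exact schrodinger_balance e1 (integral_nlsU_mul_laplacian ha t (c t) hψ)
        (by rw [ha, dispersion]; push_cast; ring) (coupling_mul μ J hε)

end WeakNLS

namespace WeakNLS

variable {d : ℕ}

/-! ### Uniqueness for the nonlinear Schrödinger equation -/

open Classical in
/-- The class of `f` in `L^p`, with the value `0` if `f` is not in `L^p`. -/
noncomputable def classLp (p : ℝ≥0∞) (f : E d → ℂ) : Lp (α := E d) ℂ p volume :=
  if h : MemLp f p (volume : Measure (E d)) then h.toLp f else 0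

theorem classLp_ae {p : ℝ≥0∞} {f : E d → ℂ} (h : MemLp f p (volume : Measure (E d))) :
    classLp p f =ᵐ[volume] f := by
  rw [classLp, dif_pos h]
  exact h.coeFn_toLp

theorem norm_classLp {p : ℝ≥0∞} {f : E d → ℂ} (h : MemLp f p (volume : Measure (E d))) :
    ‖classLp p f‖ = (eLpNorm f p (volume : Measure (E d))).toReal := by
  rw [Lp.norm_def, eLpNorm_congr_ae (classLp_ae h)]

theorem classLp_sub {p : ℝ≥0∞} {f g : E d → ℂ} (hf : MemLp f p (volume : Measure (E d)))
    (hg : MemLp g p (volume : Measure (E d))) :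
    classLp p (f - g) = classLp p f - classLp p g := by
  refine Lp.ext ?_
  filter_upwards [classLp_ae (hf.sub hg), classLp_ae hf, classLp_ae hg,
    Lp.coeFn_sub (classLp p f) (classLp p g)] with x h1 h2 h3 h4
  rw [h1, h4, Pi.sub_apply, Pi.sub_apply, h2, h3]

theorem ContinuousInLp.continuousOn {p : ℝ≥0∞} [Fact (1 ≤ p)] {T : ℝ} {u : ℝ → E d → ℂ}
    (h : ContinuousInLp p T u) : ContinuousOn (fun t => classLp p (u t)) (Icc 0 T) := by
  intro t ht
  rw [ContinuousWithinAt, tendsto_iff_norm_sub_tendsto_zero]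
  have h1 := (ENNReal.tendsto_toReal ENNReal.zero_ne_top).comp (h.2 t ht)
  refine h1.congr' ?_
  filter_upwards [self_mem_nhdsWithin] with τ hτ
  rw [← classLp_sub (h.1 τ hτ) (h.1 t ht), norm_classLp ((h.1 τ hτ).sub (h.1 t ht))]
  rfl

theorem ContinuousInLp.exists_ae_bound {T : ℝ} {u : ℝ → E d → ℂ} (h : ContinuousInLp ∞ T u) :
    ∃ M : ℝ, ∀ t ∈ Icc 0 T, ∀ᵐ x, ‖u t x‖ ≤ M := by
  obtain ⟨M, hM⟩ := isCompact_Icc.exists_bound_of_continuousOn h.continuousOn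
  refine ⟨M, fun t ht => ?_⟩
  have h1 := hM t ht
  rw [norm_classLp (h.1 t ht)] at h1
  have h2 : eLpNorm (u t) ∞ (volume : Measure (E d)) ≤ ENNReal.ofReal M := by
    rw [← ENNReal.ofReal_toReal (h.1 t ht).2.ne]
    exact ENNReal.ofReal_le_ofReal h1
  rw [eLpNorm_exponent_top] at h2
  filter_upwards [ae_le_eLpNormEssSup (f := u t) (μ := (volume : Measure (E d)))] with x hx
  have h3 := hx.trans h2
  rw [← ofReal_norm] at h3
  rcases le_or_gt 0 M with hM0 | hM0
  · exact (ENNReal.ofReal_le_ofReal_iff hM0).1 h3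
  · exact absurd (h1.trans_lt hM0) (not_lt.2 ENNReal.toReal_nonneg)

/-- The nonlinearity `|f|^{2ν} f`. -/
noncomputable def powerNonlinearity (ν : ℕ) (f : E d → ℂ) (x : E d) : ℂ :=
  (‖f x‖ : ℂ) ^ (2 * ν) * f x

theorem norm_power_sub_le (n : ℕ) {M : ℝ} {a b : ℂ} (ha : ‖a‖ ≤ M) (hb : ‖b‖ ≤ M) :
    ‖(‖a‖ : ℂ) ^ n * a - (‖b‖ : ℂ) ^ n * b‖ ≤ (n + 1) * M ^ n * ‖a - b‖ := by
  have hM : 0 ≤ M := (norm_nonneg a).trans ha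
  have h1 : (‖a‖ : ℂ) ^ n * a - (‖b‖ : ℂ) ^ n * b =
      (‖a‖ : ℂ) ^ n * (a - b) + ((‖a‖ ^ n - ‖b‖ ^ n : ℝ) : ℂ) * b := by push_cast; ring
  have h2 : |‖a‖ ^ n - ‖b‖ ^ n| * ‖b‖ ≤ n * M ^ n * ‖a - b‖ := by
    rcases n with _ | m
    · simp
    · have h3 := abs_pow_sub_pow_le ‖a‖ ‖b‖ (m + 1)
      have h4 : max |‖a‖| |‖b‖| ≤ M := by simp [ha, hb]
      have h5 : (max |‖a‖| |‖b‖|) ^ m ≤ M ^ m :=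
        pow_le_pow_left₀ (le_max_of_le_left (abs_nonneg _)) h4 m
      rw [Nat.add_sub_cancel] at h3
      calc |‖a‖ ^ (m + 1) - ‖b‖ ^ (m + 1)| * ‖b‖
          ≤ (‖a - b‖ * ((m + 1 : ℕ) : ℝ) * M ^ m) * M := by
            refine mul_le_mul (h3.trans ?_) hb (norm_nonneg _) (by positivity)
            gcongr
            exact abs_norm_sub_norm_le a b
        _ = ((m + 1 : ℕ) : ℝ) * M ^ (m + 1) * ‖a - b‖ := by ring
  rw [h1]
  refine (norm_add_le _ _).trans ?_
  rw [norm_mul, norm_mul, norm_pow, Complex.norm_real, Complex.norm_real, norm_norm,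
    Real.norm_eq_abs]
  have h3 : ‖a‖ ^ n * ‖a - b‖ ≤ M ^ n * ‖a - b‖ := by gcongr
  linarith

theorem memLp_powerNonlinearity (ν : ℕ) {M : ℝ} {f : E d → ℂ}
    (hf : MemLp f 2 (volume : Measure (E d))) (hM : ∀ᵐ x, ‖f x‖ ≤ M) :
    MemLp (powerNonlinearity ν f) 2 (volume : Measure (E d)) := by
  refine (hf.norm.const_mul ((2 * ν : ℕ) + 1 : ℝ)).const_mul (M ^ (2 * ν)) |>.mono ?_ ?_
  · have h := hf.1.norm
    exact ((Complex.continuous_ofReal.comp_aestronglyMeasurable h).pow _).mul hf.1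
  · filter_upwards [hM] with x hx
    have h := norm_power_sub_le (2 * ν) hx (b := 0) (by simpa using (norm_nonneg _).trans hx)
    simp only [mul_zero, sub_zero] at h
    refine h.trans (le_of_eq_of_le ?_ (le_abs_self _))
    ring

theorem norm_classLp_powerNonlinearity_sub_le (ν : ℕ) {M : ℝ} {f g : E d → ℂ}
    (hf : MemLp f 2 (volume : Measure (E d))) (hg : MemLp g 2 (volume : Measure (E d)))
    (hfM : ∀ᵐ x, ‖f x‖ ≤ M) (hgM : ∀ᵐ x, ‖g x‖ ≤ M) :
    ‖classLp 2 (powerNonlinearity ν f) - classLp 2 (powerNonlinearity ν g)‖ ≤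
      ((2 * ν : ℕ) + 1) * M ^ (2 * ν) * ‖classLp 2 f - classLp 2 g‖ := by
  refine Lp.norm_le_mul_norm_of_ae_le_mul ?_
  have hf' := memLp_powerNonlinearity ν hf hfM
  have hg' := memLp_powerNonlinearity ν hg hgM
  filter_upwards [hfM, hgM, Lp.coeFn_sub (classLp 2 f) (classLp 2 g),
    Lp.coeFn_sub (classLp 2 (powerNonlinearity ν f)) (classLp 2 (powerNonlinearity ν g)),
    classLp_ae hf, classLp_ae hg, classLp_ae hf', classLp_ae hg'] with x h1 h2 h3 h4 h5 h6 h7 h8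
  rw [h3, h4, Pi.sub_apply, Pi.sub_apply, h5, h6, h7, h8]
  exact norm_power_sub_le (2 * ν) h1 h2

theorem integral_mul_eq_pairing {f : E d → ℂ} (hf : MemLp f 2 (volume : Measure (E d)))
    (φ : 𝓢(E d, ℂ)) :
    ∫ x, f x * φ x =
      pairing d ((𝓕⁻ φ : 𝓢(E d, ℂ)).toLp 2 (volume : Measure (E d))) (𝓕 (classLp 2 f)) := by
  rw [pairing_schwartz, ← integral_schwartz_mul_fourierInv_L2,
    FourierTransform.fourierInv_fourier_eq]
  refine integral_congr_ae ?_
  filter_upwards [classLp_ae hf] with x hx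
  rw [hx, mul_comm]

theorem integral_mul_laplacian_eq_pairing {f : E d → ℂ}
    (hf : MemLp f 2 (volume : Measure (E d))) (φ : 𝓢(E d, ℂ)) :
    ∫ x, f x * (Δ φ) x = (-(2 * Real.pi) ^ 2 : ℂ) *
      pairing d ((mulNormSq (𝓕⁻ φ)).toLp 2 (volume : Measure (E d))) (𝓕 (classLp 2 f)) := by
  have h1 : ∀ χ : 𝓢(E d, ℂ), ∀ ψ, χ = ψ → ∫ x, f x * χ x =
      pairing d ((𝓕⁻ ψ : 𝓢(E d, ℂ)).toLp 2 (volume : Measure (E d))) (𝓕 (classLp 2 f)) := by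
    rintro χ _ rfl
    exact integral_mul_eq_pairing hf χ
  -- the two coercions to functions are definitionally but not syntactically equal
  have h2 : ∀ x, (Δ φ) x = (Δ φ : 𝓢(E d, ℂ)) x := fun x => rfl
  simp only [h2]
  rw [h1 _ _ rfl, fourierInv_laplacian_toLp, map_smul, smul_apply, smul_eq_mul]

/-- Conversely, the weak equation determines the derivative in the interaction picture. -/
theorem schrodinger_derivative {ε : ℝ} (hε : ε ≠ 0) {a lam F I₁ I₂ P₁ P₂ g : ℂ} (e1 : I₁ = P₁)
    (e2 : I₂ = -(2 * Real.pi) ^ 2 * P₂) (e3 : a = 2 * Real.pi ^ 2 * ε)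
    (e4 : Complex.I * ε * lam = F)
    (h : Complex.I * ε * g + (ε : ℂ) ^ 2 / 2 * I₂ = F * I₁) :
    -Complex.I * (-a) * P₂ + g = lam * P₁ := by
  have hε' : Complex.I * (ε : ℂ) ≠ 0 :=
    mul_ne_zero Complex.I_ne_zero (Complex.ofReal_ne_zero.2 hε)
  refine mul_left_cancel₀ hε' ?_
  rw [e1, e2, ← e4] at h
  rw [e3]
  linear_combination h + (2 * Real.pi ^ 2 * (ε : ℂ) ^ 2 * P₂) * Complex.I_sq

/-- Passing to the interaction picture removes the Laplacian from the weak equation. -/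
theorem IsNLSSolution.hasDerivWithinAt_pairing {ν : ℕ} {μ J ε T : ℝ} (hε : 0 < ε)
    {u₀ : E d → ℂ} {v : ℝ → E d → ℂ} (h : IsNLSSolution ν μ J ε T u₀ v) {M : ℝ}
    (hM : ∀ t ∈ Icc 0 T, ∀ᵐ x, ‖v t x‖ ≤ M) (ψ : 𝓢(E d, ℂ)) {t : ℝ} (ht : t ∈ Icc 0 T) :
    HasDerivWithinAt
      (fun τ => pairing d ((modulate (τ * -dispersion ε) ψ).toLp 2 (volume : Measure (E d)))
        (𝓕 (classLp 2 (v τ))))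
      (coupling μ J ε *
        pairing d ((modulate (t * -dispersion ε) ψ).toLp 2 (volume : Measure (E d)))
          (𝓕 (classLp 2 (powerNonlinearity ν (v t))))) (Icc 0 T) t := by
  obtain ⟨χ, hχ⟩ : ∃ χ, χ = modulate (t * -dispersion ε) ψ := ⟨_, rfl⟩
  obtain ⟨φ, hφ⟩ : ∃ φ : 𝓢(E d, ℂ), φ = 𝓕 χ := ⟨_, rfl⟩
  have hχφ : 𝓕⁻ φ = χ := by rw [hφ, FourierTransform.fourierInv_fourier_eq]
  obtain ⟨g, hg, heq⟩ := h.equation φ t ht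
  have h2 := h.continuous_two
  have h1 : HasDerivWithinAt (fun τ => pairing d
      ((modulate (t * -dispersion ε) ψ).toLp 2 (volume : Measure (E d)))
      (𝓕 (classLp 2 (v τ)))) g (Icc 0 T) t := by
    refine hg.congr (fun τ hτ => ?_) ?_
    · rw [integral_mul_eq_pairing (h2.1 τ hτ), hχφ, hχ]
    · rw [integral_mul_eq_pairing (h2.1 t ht), hχφ, hχ]
  have hcont : ContinuousWithinAt (fun τ => 𝓕 (classLp 2 (v τ))) (Icc 0 T) t :=
    (Lp.fourierTransformₗᵢ (E d) ℂ).continuous.continuousAt.comp_continuousWithinAt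
      (h2.continuousOn t ht)
  refine (hasDerivWithinAt_pairing_modulate (-dispersion ε) ψ hcont h1).congr_deriv ?_
  have e1 := integral_mul_eq_pairing (memLp_powerNonlinearity ν (h2.1 t ht) (hM t ht)) φ
  have e2 := integral_mul_laplacian_eq_pairing (h2.1 t ht) φ
  rw [hχφ, hχ] at e1
  rw [hχφ, hχ] at e2
  rw [Complex.ofReal_neg]
  exact schrodinger_derivative hε.ne' e1 e2 (by rw [dispersion]; push_cast; ring)
    (coupling_mul μ J hε) heq

/-- Solutions of the nonlinear Schrödinger equation in `C([0,T]; L² ∩ L^∞)` are unique.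
If `m` is the maximum of `e^{-2Kt} ‖v(t) - w(t)‖_{L²}`, where `K` is the Lipschitz constant of the
right-hand side in the interaction picture, then testing the equation yields `m ≤ m / 2`. -/
theorem nlsSolution_unique {ν : ℕ} {μ J ε T : ℝ} (hε : 0 < ε)
    {u₀ : E d → ℂ} {v w : ℝ → E d → ℂ} (hv : IsNLSSolution ν μ J ε T u₀ v)
    (hw : IsNLSSolution ν μ J ε T u₀ w) {t : ℝ} (ht : t ∈ Icc 0 T) : v t =ᵐ[volume] w t := by
  obtain ⟨M₁, hM₁⟩ := hv.continuous_top.exists_ae_bound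
  obtain ⟨M₂, hM₂⟩ := hw.continuous_top.exists_ae_bound
  set M := max |M₁| |M₂| with hMdef
  have hvM : ∀ t ∈ Icc 0 T, ∀ᵐ x, ‖v t x‖ ≤ M := fun t ht => by
    filter_upwards [hM₁ t ht] with x hx
    exact hx.trans ((le_abs_self _).trans (le_max_left _ _))
  have hwM : ∀ t ∈ Icc 0 T, ∀ᵐ x, ‖w t x‖ ≤ M := fun t ht => by
    filter_upwards [hM₂ t ht] with x hx
    exact hx.trans ((le_abs_self _).trans (le_max_right _ _))
  have hM0 : 0 ≤ M := le_max_of_le_left (abs_nonneg _)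
  obtain ⟨K, hK0, hK⟩ : ∃ K : ℝ, 0 < K ∧ ∀ t ∈ Icc 0 T, ‖coupling μ J ε‖ *
      ‖classLp 2 (powerNonlinearity ν (v t)) - classLp 2 (powerNonlinearity ν (w t))‖ ≤
      K * ‖classLp 2 (v t) - classLp 2 (w t)‖ := by
    refine ⟨‖coupling μ J ε‖ * (((2 * ν : ℕ) + 1) * M ^ (2 * ν)) + 1, by positivity,
      fun t ht => ?_⟩
    have h := norm_classLp_powerNonlinearity_sub_le ν (hv.continuous_two.1 t ht)
      (hw.continuous_two.1 t ht) (hvM t ht) (hwM t ht)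
    have h' := mul_le_mul_of_nonneg_left h (norm_nonneg (coupling μ J ε))
    have h0 := norm_nonneg (classLp 2 (v t) - classLp 2 (w t))
    linarith
  have hT : 0 ≤ T := ht.1.trans ht.2
  set D : ℝ → Lp (α := E d) ℂ 2 volume := fun t => classLp 2 (v t) - classLp 2 (w t) with hD
  have hDc : ContinuousOn D (Icc 0 T) :=
    hv.continuous_two.continuousOn.sub hw.continuous_two.continuousOn
  have h0T : (0 : ℝ) ∈ Icc 0 T := ⟨le_rfl, hT⟩
  have hD0 : D 0 = 0 := by
    rw [hD, sub_eq_zero]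
    refine Lp.ext ?_
    filter_upwards [classLp_ae (hv.continuous_two.1 0 h0T),
      classLp_ae (hw.continuous_two.1 0 h0T), hv.initial, hw.initial] with x h1 h2 h3 h4
    rw [h1, h2, h3, h4]
  obtain ⟨t₀, ht₀, hmax⟩ := isCompact_Icc.exists_isMaxOn ⟨0, h0T⟩
    (f := fun t => Real.exp (-(2 * K * t)) * ‖D t‖)
    ((Continuous.continuousOn (by fun_prop)).mul hDc.norm)
  set m := Real.exp (-(2 * K * t₀)) * ‖D t₀‖ with hm
  have hm0 : 0 ≤ m := by positivity
  have hDm : ∀ t ∈ Icc 0 T, ‖D t‖ ≤ m * Real.exp (2 * K * t) := fun t ht => by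
    have h1 : Real.exp (-(2 * K * t)) * ‖D t‖ ≤ m := hmax ht
    rw [Real.exp_neg, inv_mul_le_iff₀ (Real.exp_pos _)] at h1
    linarith
  have hF : ∀ f g : Lp (α := E d) ℂ 2 volume, 𝓕 f - 𝓕 g = 𝓕 (f - g) := fun f g =>
    ((Lp.fourierTransformₗᵢ (E d) ℂ).map_sub f g).symm
  have hFn : ∀ f : Lp (α := E d) ℂ 2 volume, ‖𝓕 f‖ = ‖f‖ := fun f =>
    (Lp.fourierTransformₗᵢ (E d) ℂ).norm_map f
  have hhalf : ∀ t ∈ Icc 0 T, ‖D t‖ ≤ m / 2 * Real.exp (2 * K * t) := fun t ht => by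
    rw [← hFn]
    refine norm_le_of_pairing_schwartz (by positivity) fun χ => ?_
    -- at time `t` the freely evolved test function is `χ`
    set ψ := modulate (t * dispersion ε) χ with hψ
    have hψχ : modulate (t * -dispersion ε) ψ = χ := by
      rw [hψ, modulate_modulate]; simp
    have hn := norm_toLp_modulate (t * dispersion ε) χ
    set q : ℝ → ℂ := fun τ =>
      pairing d ((modulate (τ * -dispersion ε) ψ).toLp 2 (volume : Measure (E d))) (𝓕 (D τ)) with hq
    have hq' : ∀ τ ∈ Icc 0 T, HasDerivWithinAt q (coupling μ J ε *
        pairing d ((modulate (τ * -dispersion ε) ψ).toLp 2 (volume : Measure (E d)))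
          (𝓕 (classLp 2 (powerNonlinearity ν (v τ)) - classLp 2 (powerNonlinearity ν (w τ)))))
        (Icc 0 T) τ := fun τ hτ => by
      have h1 := (hv.hasDerivWithinAt_pairing hε hvM ψ hτ).sub
        (hw.hasDerivWithinAt_pairing hε hwM ψ hτ)
      rw [← mul_sub, ← map_sub, hF] at h1
      refine h1.congr (fun σ _ => ?_) ?_ <;>
      · simp only [hq, Pi.sub_apply, ← map_sub, hF, hD]
    have hb := image_norm_le_of_norm_deriv_right_le_deriv_boundary (a := 0) (b := T)
      (f := q) (B := fun τ => ‖ψ.toLp 2 (volume : Measure (E d))‖ * (m / 2) * Real.exp (2 * K * τ))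
      (B' := fun τ => ‖ψ.toLp 2 (volume : Measure (E d))‖ * (m / 2) *
        (Real.exp (2 * K * τ) * (2 * K)))
      (fun τ hτ => (hq' τ hτ).continuousWithinAt)
      (fun τ hτ => (hq' τ (Ico_subset_Icc_self hτ)).mono_of_mem_nhdsWithin
        (Icc_mem_nhdsGE_of_mem hτ)) ?_ ?_ ?_ ht
    · rw [hq] at hb
      simp only [hψχ] at hb
      rw [hn] at hb
      linarith
    · have : 𝓕 (D 0) = 0 := by
        rw [← norm_eq_zero, hFn, hD0, norm_zero]
      simp only [hq, this, map_zero, norm_zero]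
      positivity
    · intro τ
      have h1 : HasDerivAt (fun τ => 2 * K * τ) (2 * K) τ := by
        simpa using (hasDerivAt_id τ).const_mul (2 * K)
      exact h1.exp.const_mul _
    · intro τ hτ
      have hτ' := Ico_subset_Icc_self hτ
      rw [norm_mul]
      have h1 := norm_pairing_le
        ((modulate (τ * -dispersion ε) ψ).toLp 2 (volume : Measure (E d)))
        (𝓕 (classLp 2 (powerNonlinearity ν (v τ)) - classLp 2 (powerNonlinearity ν (w τ))))
      rw [norm_toLp_modulate, hFn] at h1
      have h2 := mul_le_mul_of_nonneg_left h1 (norm_nonneg (coupling μ J ε))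
      have h3 := hK τ hτ'
      have h4 := hDm τ hτ'
      have h5 : 0 ≤ ‖ψ.toLp 2 (volume : Measure (E d))‖ := norm_nonneg _
      refine h2.trans ?_
      calc _ = ‖ψ.toLp 2 (volume : Measure (E d))‖ * (‖coupling μ J ε‖ *
            ‖classLp 2 (powerNonlinearity ν (v τ)) - classLp 2 (powerNonlinearity ν (w τ))‖) := by
            ring
        _ ≤ ‖ψ.toLp 2 (volume : Measure (E d))‖ * (K * (m * Real.exp (2 * K * τ))) := by
            refine mul_le_mul_of_nonneg_left (h3.trans ?_) h5
            exact mul_le_mul_of_nonneg_left h4 hK0.le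
        _ = _ := by ring
  have hm_zero : m = 0 := by
    have h1 := hhalf t₀ ht₀
    have h2 : ‖D t₀‖ = m * Real.exp (2 * K * t₀) := by
      rw [hm, mul_right_comm, ← Real.exp_add]; simp
    have h3 := Real.exp_pos (2 * K * t₀)
    rw [h2] at h1
    have h4 := le_of_mul_le_mul_right h1 h3
    linarith
  have h1 := hDm t ht
  rw [hm_zero, zero_mul] at h1
  have h2 : D t = 0 := norm_le_zero_iff.1 h1
  rw [hD, sub_eq_zero] at h2
  have h3 := classLp_ae (hv.continuous_two.1 t ht)
  have h4 := classLp_ae (hw.continuous_two.1 t ht)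
  have h5 : classLp 2 (v t) = classLp 2 (w t) := h2
  rw [h5] at h3
  exact h3.symm.trans h4

end WeakNLS

namespace WeakNLS

variable {d : ℕ} {s : ℝ}

/-! ### Sobolev norms on the Wiener space -/

/-- The weight `(1 + |2πη|²)^{s/2}`. -/
noncomputable def bracket (s : ℝ) (η : E d) : ℝ := (1 + ‖(2 * Real.pi) • η‖ ^ 2) ^ (s / 2)

theorem bracket_pos (s : ℝ) (η : E d) : 0 < bracket s η := by
  rw [bracket]; positivity

theorem bracket_le_one (hs : s ≤ 0) (η : E d) : bracket s η ≤ 1 :=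
  Real.rpow_le_one_of_one_le_of_nonpos (by simp) (by linarith)

theorem bracket_sq (s : ℝ) (η : E d) :
    bracket s η ^ 2 = (1 + ‖(2 * Real.pi) • η‖ ^ 2) ^ s := by
  rw [bracket, ← Real.rpow_natCast, ← Real.rpow_mul (by positivity)]
  congr 1
  push_cast; ring

theorem continuous_bracket (s : ℝ) : Continuous (bracket s : E d → ℝ) := by
  unfold bracket
  refine Continuous.rpow_const (by fun_prop) fun η => Or.inl ?_
  positivity

theorem norm_bracket (s : ℝ) (η : E d) : ‖(bracket s η : ℂ)‖ = bracket s η := by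
  rw [Complex.norm_real, Real.norm_of_nonneg (bracket_pos s η).le]

theorem tendsto_bracket {ι : Type*} {l : Filter ι} (hs : s < 0) {h : ι → E d}
    (hh : Tendsto (fun i => ‖h i‖) l atTop) : Tendsto (fun i => bracket s (h i)) l (𝓝 0) := by
  have h1 : Tendsto (fun i => 1 + ‖(2 * Real.pi) • h i‖ ^ 2) l atTop := by
    refine tendsto_atTop_add_const_left _ _ ((tendsto_pow_atTop two_ne_zero).comp ?_)
    simp only [norm_smul]
    exact hh.const_mul_atTop (norm_pos_iff.2 (by positivity))
  have h2 := (tendsto_rpow_neg_atTop (y := -(s / 2)) (by linarith)).comp h1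
  rw [neg_neg] at h2
  exact h2

theorem norm_sq_eq_integral (f : Lp (α := E d) ℂ 2 volume) : ‖f‖ ^ 2 = ∫ x, ‖f x‖ ^ 2 := by
  have h := inner_self_eq_norm_sq_to_K (𝕜 := ℂ) f
  rw [L2.inner_def] at h
  have h1 : (∫ x, inner ℂ (f x) (f x)) = ((∫ x, ‖f x‖ ^ 2 : ℝ) : ℂ) := by
    rw [← integral_complex_ofReal]
    refine integral_congr_ae (Eventually.of_forall fun x => ?_)
    simp only [inner_self_eq_norm_sq_to_K]
    push_cast; rfl
  rw [h1] at h
  refine Complex.ofReal_injective (Eq.trans ?_ h.symm)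
  push_cast; rfl

namespace W

theorem memLp_bracket_mul (hs : s ≤ 0) (z : W d) :
    MemLp (fun η => (bracket s η : ℂ) * z.fn η) 2 (volume : Measure (E d)) := by
  refine z.memLp_two.mono ?_ (Eventually.of_forall fun η => ?_)
  · exact ((Complex.continuous_ofReal.comp (continuous_bracket s)).aestronglyMeasurable).mul
      z.memLp_two.1
  · rw [norm_mul, norm_bracket]
    exact mul_le_of_le_one_left (norm_nonneg _) (bracket_le_one hs η)

/-- Multiplication by the weight `(1 + |2πη|²)^{s/2}`, `s ≤ 0`, as a map into `L²`; the norm of the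
image is the `H^s` norm. -/
noncomputable def weight (hs : s ≤ 0) : W d →L[ℂ] Lp (α := E d) ℂ 2 volume :=
  LinearMap.mkContinuous
    { toFun := fun z => (memLp_bracket_mul hs z).toLp
      map_add' := fun z w => by
        refine Lp.ext ?_
        filter_upwards [(memLp_bracket_mul hs (z + w)).coeFn_toLp,
          (memLp_bracket_mul hs z).coeFn_toLp, (memLp_bracket_mul hs w).coeFn_toLp,
          Lp.coeFn_add (memLp_bracket_mul hs z).toLp (memLp_bracket_mul hs w).toLp,
          fn_add z w] with η h1 h2 h3 h4 h5
        rw [h1, h4, Pi.add_apply, h2, h3, h5, Pi.add_apply, mul_add]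
      map_smul' := fun c z => by
        refine Lp.ext ?_
        filter_upwards [(memLp_bracket_mul hs (c • z)).coeFn_toLp,
          (memLp_bracket_mul hs z).coeFn_toLp, Lp.coeFn_smul c (memLp_bracket_mul hs z).toLp,
          fn_smul c z] with η h1 h2 h4 h5
        rw [h1, RingHom.id_apply, h4, Pi.smul_apply, h2, h5, Pi.smul_apply, smul_eq_mul,
          smul_eq_mul, mul_left_comm] } 1
    (fun z => by
      rw [one_mul]
      refine le_trans ?_ (norm_toL2_le z)
      refine Lp.norm_le_norm_of_ae_le ?_
      filter_upwards [(memLp_bracket_mul hs z).coeFn_toLp, z.toL2_ae] with η h1 h2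
      change ‖(memLp_bracket_mul hs z).toLp _ η‖ ≤ _
      rw [h1, ← h2, norm_mul, norm_bracket]
      exact mul_le_of_le_one_left (norm_nonneg _) (bracket_le_one hs η))

theorem weight_ae (hs : s ≤ 0) (z : W d) :
    weight hs z =ᵐ[volume] fun η => (bracket s η : ℂ) * z.fn η :=
  (memLp_bracket_mul hs z).coeFn_toLp

theorem norm_weight_le (hs : s ≤ 0) (z : W d) : ‖weight hs z‖ ≤ ‖z‖ := by
  have h := (weight hs).le_of_opNorm_le (LinearMap.mkContinuous_norm_le _ zero_le_one _) z
  rwa [one_mul] at h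

theorem norm_weight (hs : s ≤ 0) (z : W d) : ‖weight hs z‖ =
    (eLpNorm (fun η => (bracket s η : ℂ) * z.fn η) 2 (volume : Measure (E d))).toReal := by
  rw [Lp.norm_def, eLpNorm_congr_ae (weight_ae hs z)]

theorem sobolevNorm_phys (hs : s ≤ 0) (z : W d) : sobolevNorm s z.phys = ‖weight hs z‖ := by
  rw [sobolevNorm, Real.sqrt_eq_iff_eq_sq (integral_nonneg fun η => by positivity)
    (norm_nonneg _), norm_sq_eq_integral]
  refine integral_congr_ae ?_
  filter_upwards [weight_ae hs z, z.fourierL2_phys] with η h1 h2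
  rw [h1, h2, norm_mul, norm_bracket, mul_pow, bracket_sq]

theorem weight_injective (hs : s ≤ 0) : Function.Injective (weight hs : W d → _) := by
  intro z w h
  refine ext ?_
  have h1 := weight_ae hs w
  rw [← h] at h1
  filter_upwards [weight_ae hs z, h1] with η h2 h3
  rw [h2] at h3
  exact mul_left_cancel₀ (Complex.ofReal_ne_zero.2 (bracket_pos s η).ne') h3

theorem norm_weight_phase (hs : s ≤ 0) (ω : C(E d, ℝ)) (z : W d) :
    ‖weight hs (phase ω z)‖ = ‖weight hs z‖ := by
  rw [norm_weight, norm_weight]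
  congr 1
  refine eLpNorm_congr_norm_ae ?_
  filter_upwards [fn_phase ω z] with η h
  rw [h, norm_mul, norm_mul, norm_mul, norm_phase, one_mul]

theorem shift_sub (h : E d) (z w : W d) : shift h (z - w) = shift h z - shift h w := by
  refine phys_injective (funext fun x => ?_)
  rw [phys_sub, phys_shift, phys_sub, Pi.sub_apply, Pi.sub_apply, phys_shift, phys_shift, mul_sub]

@[simp] theorem shift_zero (z : W d) : shift 0 z = z := by
  refine phys_injective (funext fun x => ?_)
  simp [phys_shift]

/-- Negative Sobolev norms tend to zero when the frequency tends to infinity. -/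
theorem tendsto_weight_shift {ι : Type*} {l : Filter ι} [l.IsCountablyGenerated] (hs : s < 0)
    {h : ι → E d} (hh : Tendsto (fun i => ‖h i‖) l atTop) {z : ι → W d} {z₀ : W d}
    (hz : Tendsto z l (𝓝 z₀)) : Tendsto (fun i => weight hs.le (shift (h i) (z i))) l (𝓝 0) := by
  rw [tendsto_zero_iff_norm_tendsto_zero]
  have h1 : Tendsto (fun i => ‖weight hs.le (shift (h i) z₀)‖) l (𝓝 0) := by
    set m : ι → E d → ℂ := fun i η => (bracket s (η + h i) : ℂ) with hm
    have h2 : Tendsto (fun i => eLpNorm (m i * z₀.fn) 2 (volume : Measure (E d))) l (𝓝 0) := by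
      refine tendsto_eLpNorm_mul_zero two_ne_zero ENNReal.ofNat_ne_top (fun i => ?_) (C := 1)
        (fun i η => ?_) z₀.memLp_two fun η => ?_
      · exact (Complex.continuous_ofReal.comp ((continuous_bracket s).comp
          (continuous_add_const (h i)))).aestronglyMeasurable
      · rw [hm, norm_bracket]; exact bracket_le_one hs.le _
      · have h3 : Tendsto (fun i => ‖η + h i‖) l atTop := by
          refine tendsto_atTop_mono (fun i => ?_) (tendsto_atTop_add_const_right l (-‖η‖) hh)
          have := norm_sub_le (η + h i) η
          rw [add_sub_cancel_left] at this
          linarith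
        have h4 := (tendsto_bracket hs h3)
        exact_mod_cast (Complex.continuous_ofReal.tendsto 0).comp h4
    have h3 := (ENNReal.tendsto_toReal ENNReal.zero_ne_top).comp h2
    refine h3.congr fun i => ?_
    rw [norm_weight, Function.comp_apply]
    congr 1
    have h4 : eLpNorm (m i * z₀.fn) 2 (volume : Measure (E d)) =
        eLpNorm ((m i * z₀.fn) ∘ fun η => η - h i) 2 (volume : Measure (E d)) := by
      refine (eLpNorm_comp_measurePreserving ?_ (measurePreserving_sub_right volume (h i))).symm
      exact ((Complex.continuous_ofReal.comp ((continuous_bracket s).comp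
          (continuous_add_const (h i)))).aestronglyMeasurable).mul z₀.memLp_two.1
    rw [h4]
    refine eLpNorm_congr_ae ?_
    filter_upwards [fn_shift (h i) z₀] with η h5
    rw [h5]
    simp [hm]
  have h2 := tendsto_iff_norm_sub_tendsto_zero.1 hz
  refine squeeze_zero (fun _ => norm_nonneg _) (fun i => ?_) (by simpa using h1.add h2)
  have h3 : shift (h i) (z i) = shift (h i) z₀ + shift (h i) (z i - z₀) := by
    rw [shift_sub]; abel
  rw [h3, map_add]
  refine (norm_add_le _ _).trans (add_le_add_right ?_ _)
  exact (norm_weight_le _ _).trans (norm_shift _ _).le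

theorem norm_weight_le_of_le (hs : s ≤ 0) (z : W d) {B : ℝ}
    (h : ∀ᵐ η, z.fn η ≠ 0 → bracket s η ≤ B) : ‖weight hs z‖ ≤ B * ‖toL2 z‖ := by
  refine Lp.norm_le_mul_norm_of_ae_le_mul ?_
  filter_upwards [h, weight_ae hs z, z.toL2_ae] with η h1 h2 h3
  rw [h2, ← h3, norm_mul, norm_bracket]
  by_cases h0 : z.fn η = 0
  · simp [h0]
  · gcongr
    exact h1 h0

theorem norm_weight_ge_of_ge (hs : s ≤ 0) (z : W d) {B : ℝ} (hB : 0 < B)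
    (h : ∀ᵐ η, z.fn η ≠ 0 → B ≤ bracket s η) : B * ‖toL2 z‖ ≤ ‖weight hs z‖ := by
  rw [← le_div_iff₀' hB, div_eq_inv_mul]
  refine Lp.norm_le_mul_norm_of_ae_le_mul ?_
  filter_upwards [h, weight_ae hs z, z.toL2_ae] with η h1 h2 h3
  rw [h2, ← h3, norm_mul, norm_bracket, le_inv_mul_iff₀ hB]
  by_cases h0 : z.fn η = 0
  · simp [h0]
  · gcongr
    exact h1 h0

theorem norm_toL2_shift (h : E d) (z : W d) : ‖toL2 (shift h z)‖ = ‖toL2 z‖ := by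
  have e : ∀ z : W d, ‖toL2 z‖ = (eLpNorm z.fn 2 (volume : Measure (E d))).toReal := norm_snd
  rw [e, e, eLpNorm_congr_ae (fn_shift h z)]
  congr 1
  exact eLpNorm_comp_measurePreserving z.memLp_two.1 (measurePreserving_sub_right volume h)

theorem phase_shift {h : E d} {ω ω' : C(E d, ℝ)} (hω : ∀ η, ω' η = ω (η + h)) (z : W d) :
    phase ω (shift h z) = shift h (phase ω' z) := by
  refine ext ?_
  have h1 := (measurePreserving_sub_right (volume : Measure (E d)) h)
    |>.quasiMeasurePreserving.ae_eq_comp (fn_phase ω' z)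
  filter_upwards [fn_phase ω (shift h z), fn_shift h z, fn_shift h (phase ω' z), h1]
    with η h2 h3 h4 h5
  simp only [Function.comp_apply] at h5
  rw [h2, h3, h4, h5, hω, sub_add_cancel]

theorem phase_const (ω : C(E d, ℝ)) {c : ℝ} (z : W d) :
    phase (ω + ContinuousMap.const _ c) z = Complex.exp (-Complex.I * c) • phase ω z := by
  refine ext ?_
  filter_upwards [fn_phase (ω + ContinuousMap.const _ c) z, fn_phase ω z,
    fn_smul (Complex.exp (-Complex.I * c)) (phase ω z)] with η h1 h2 h3
  rw [h1, h3, Pi.smul_apply, h2, smul_eq_mul, ← mul_assoc, ← Complex.exp_add]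
  simp only [ContinuousMap.add_apply, ContinuousMap.const_apply]
  push_cast
  ring_nf

/-- Multiplying modulated functions: the frequencies and the phases add up with alternating
signs. -/
theorem mulConj_smul_shift {n : ℕ} (θ : Fin (n + 1) → ℝ) (h : Fin (n + 1) → E d)
    (z : Fin (n + 1) → W d) :
    mulConj d n (fun k => Complex.exp (-Complex.I * θ k) • shift (h k) (z k)) =
      Complex.exp (-Complex.I * (∑ k : Fin (n + 1), (-1 : ℝ) ^ (k : ℕ) * θ k : ℝ)) •
        shift (∑ k : Fin (n + 1), (-1 : ℝ) ^ (k : ℕ) • h k) (mulConj d n z) := by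
  refine phys_injective (funext fun x => ?_)
  rw [phys_smul, Pi.smul_apply, phys_shift, phys_mulConj, phys_mulConj, physProd_apply,
    physProd_apply, sum_inner, smul_eq_mul, ← mul_assoc, ← Complex.exp_add]
  have h1 : -Complex.I * (∑ k : Fin (n + 1), (-1 : ℝ) ^ (k : ℕ) * θ k : ℝ) +
      2 * Real.pi * Complex.I * (∑ k : Fin (n + 1), inner ℝ ((-1 : ℝ) ^ (k : ℕ) • h k) x : ℝ) =
      ∑ k : Fin (n + 1), (-1 : ℂ) ^ (k : ℕ) *
        (-Complex.I * θ k + 2 * Real.pi * Complex.I * (inner ℝ (h k) x : ℝ)) := by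
    push_cast
    rw [Finset.mul_sum, Finset.mul_sum, ← Finset.sum_add_distrib]
    refine Finset.sum_congr rfl fun k _ => ?_
    rw [real_inner_smul_left]
    push_cast
    ring
  rw [h1, Complex.exp_sum, ← Finset.prod_mul_distrib]
  refine Finset.prod_congr rfl fun k _ => ?_
  rw [phys_smul, Pi.smul_apply, phys_shift, smul_eq_mul, ← mul_assoc, ← Complex.exp_add]
  by_cases hk : Even (k : ℕ)
  · simp [hk, hk.neg_one_pow]
  · rw [if_neg hk, if_neg hk, (Nat.not_even_iff_odd.1 hk).neg_one_pow, map_mul, ← Complex.exp_conj]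
    congr 2
    simp only [map_add, map_mul, map_neg, Complex.conj_I, Complex.conj_ofReal, Complex.conj_ofNat]
    ring

end W

end WeakNLS

namespace WeakNLS

variable {d ν : ℕ} {s : ℝ}

/-! ### The first Duhamel iterate in the limit of high frequencies -/

theorem W.shift_smul (h : E d) (c : ℂ) (z : W d) : W.shift h (c • z) = c • W.shift h z := by
  refine W.phys_injective (funext fun x => ?_)
  rw [W.phys_smul, W.phys_shift, W.phys_smul, Pi.smul_apply, Pi.smul_apply, W.phys_shift,
    smul_eq_mul, smul_eq_mul, mul_left_comm]

theorem W.tendsto_phase_of_tendsto {ι : Type*} {l : Filter ι} [l.IsCountablyGenerated]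
    {ω : ι → C(E d, ℝ)} {ω₀ : C(E d, ℝ)} (h : ∀ η, Tendsto (fun i => ω i η) l (𝓝 (ω₀ η)))
    {z : ι → W d} {z₀ : W d} (hz : Tendsto z l (𝓝 z₀)) :
    Tendsto (fun i => W.phase (ω i) (z i)) l (𝓝 (W.phase ω₀ z₀)) := by
  have h1 := tendsto_iff_norm_sub_tendsto_zero.1 (W.tendsto_phase h z₀)
  have h2 := tendsto_iff_norm_sub_tendsto_zero.1 hz
  rw [tendsto_iff_norm_sub_tendsto_zero]
  refine squeeze_zero (fun _ => norm_nonneg _) (fun i => ?_) (by simpa using h2.add h1)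
  have h3 : W.phase (ω i) (z i) - W.phase ω₀ z₀ =
      W.phase (ω i) (z i - z₀) + (W.phase (ω i) z₀ - W.phase ω₀ z₀) := by rw [map_sub]; abel
  rw [h3]
  exact (norm_add_le _ _).trans (by rw [LinearIsometry.norm_map])

/-- The frequency of `e^{i κ_j·x/ε}` in the normalization of Mathlib's Fourier transform. -/
noncomputable def waveFreq (d : ℕ) (ε : ℝ) (j : Fin 3) : E d :=
  (2 * Real.pi * ε)⁻¹ • waveVec d j

/-- The element of the Wiener space belonging to the initial datum. -/
noncomputable def nlsData (α : Fin 3 → 𝓢(E d, ℂ)) (ε : ℝ) : W d :=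
  ∑ j, W.shift (waveFreq d ε j) (W.ofSchwartz (α j))

theorem phys_nlsData (α : Fin 3 → 𝓢(E d, ℂ)) (ε : ℝ) :
    (nlsData α ε).phys = initialDatum α ε := by
  ext x
  rw [← W.evalCLM_apply, nlsData, map_sum, initialDatum]
  refine Finset.sum_congr rfl fun j _ => ?_
  rw [W.evalCLM_apply, W.phys_shift, W.phys_ofSchwartz, mul_comm, waveFreq, real_inner_smul_left]
  congr 2
  push_cast
  by_cases hε : (ε : ℂ) = 0
  · simp [hε]
  · have : (Real.pi : ℂ) ≠ 0 := Complex.ofReal_ne_zero.2 Real.pi_ne_zero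
    field_simp

theorem norm_nlsData_le (α : Fin 3 → 𝓢(E d, ℂ)) (ε : ℝ) :
    ‖nlsData α ε‖ ≤ ∑ j, ‖W.ofSchwartz (α j)‖ :=
  (norm_sum_le _ _).trans (le_of_eq (Finset.sum_congr rfl fun _ _ => W.norm_shift _ _))

/-- The alternating sum of the initial wave vectors selected by `J`. -/
noncomputable def alternatingSum (d : ℕ) {n : ℕ} (J : Fin n → Fin 3) : E d :=
  ∑ k : Fin n, (-1 : ℝ) ^ (k : ℕ) • waveVec d (J k)

/-- For the three initial wave vectors the squared length is a linear function, so that tuples with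
vanishing alternating sum generate the zero mode by resonance. -/
theorem alternating_norm_sq_eq_zero (hd : 2 ≤ d) {n : ℕ} {J : Fin n → Fin 3}
    (hJ : alternatingSum d J = 0) :
    ∑ k : Fin n, (-1 : ℝ) ^ (k : ℕ) * ‖waveVec d (J k)‖ ^ 2 = 0 := by
  obtain ⟨h0, h1, h2⟩ := norm_waveVec_sq hd
  have h : ∀ j : Fin 3, ‖waveVec d j‖ ^ 2 =
      waveVec d j ⟨0, by omega⟩ + waveVec d j ⟨1, by omega⟩ := by
    intro j
    fin_cases j
    · exact h0.trans (by simp [waveVec])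
    · exact h1.trans (by simp [waveVec]; norm_num)
    · exact h2.trans (by simp [waveVec])
  have e : ∀ i : Fin d, ∑ k : Fin n, (-1 : ℝ) ^ (k : ℕ) * waveVec d (J k) i = 0 := fun i => by
    have h3 := congrArg (fun v : E d => v i) hJ
    simpa [alternatingSum] using h3
  simp only [h, mul_add, Finset.sum_add_distrib, e, add_zero]

/-- Under the free Schrödinger group the wave packet with wave vector `κ_j / ε` moves with the group
velocity `κ_j`, disperses at rate `ε`, and acquires the phase `e^{-iτ|κ_j|²/(2ε)}`. -/
theorem nlsU_shift (τ : ℝ) {ε : ℝ} (hε : ε ≠ 0) (j : Fin 3) (z : W d) :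
    nlsU d ε τ (W.shift (waveFreq d ε j) z) =
      Complex.exp (-Complex.I * (τ / (2 * ε) * ‖waveVec d j‖ ^ 2 : ℝ)) •
        W.shift (waveFreq d ε j)
          (W.phase (quad d (τ * dispersion ε) + τ • drift (waveVec d j)) z) := by
  rw [nlsU, ← W.shift_smul, ← W.phase_const]
  refine W.phase_shift (fun η => ?_) z
  simp only [ContinuousMap.add_apply, ContinuousMap.const_apply, ContinuousMap.smul_apply,
    quad_apply, drift_apply, smul_eq_mul, dispersion, waveFreq]
  rw [norm_add_sq_real, real_inner_smul_right, norm_smul, mul_pow, Real.norm_eq_abs, sq_abs,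
    real_inner_comm η]
  have := Real.pi_ne_zero
  field_simp

/-- The term with indices `J` of the nonlinearity, in the limit of high frequencies. -/
noncomputable def limitTerm (α : Fin 3 → 𝓢(E d, ℂ)) (τ : ℝ) (J : Fin (2 * ν + 1) → Fin 3) : W d :=
  W.mulConj d (2 * ν) fun k =>
    W.phase (τ • drift (waveVec d (J k))) (W.ofSchwartz (α (J k)))

open Classical in
/-- The source of the zero mode at leading order: the resonant interactions of the three initial
profiles, each transported with its group velocity. -/
noncomputable def zeroModeSource (ν : ℕ) (α : Fin 3 → 𝓢(E d, ℂ)) (τ : ℝ) : W d :=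
  ∑ J : Fin (2 * ν + 1) → Fin 3, if alternatingSum d J = 0 then limitTerm α τ J else 0

theorem continuous_zeroModeSource (α : Fin 3 → 𝓢(E d, ℂ)) :
    Continuous (zeroModeSource ν α) := by
  unfold zeroModeSource
  refine continuous_finsetSum _ fun J _ => ?_
  split_ifs
  · unfold limitTerm
    refine (W.mulConj d (2 * ν)).cont.comp (continuous_pi fun k => ?_)
    rw [continuous_iff_continuousAt]
    refine fun τ => W.tendsto_phase (fun η => ?_) _
    have : Continuous fun τ : ℝ => (τ • drift (waveVec d (J k))) η := by
      simp only [ContinuousMap.smul_apply]; fun_prop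
    exact this.tendsto τ
  · exact continuous_const

/-- Expansion of the nonlinearity into products of wave packets. -/
theorem field_nlsData (α : Fin 3 → 𝓢(E d, ℂ)) (τ : ℝ) {ε : ℝ} (hε : ε ≠ 0) :
    field (W.mulConj d (2 * ν)) (nlsU d ε) τ (nlsData α ε) =
      ∑ J : Fin (2 * ν + 1) → Fin 3, nlsU d ε (-τ)
        (Complex.exp (-Complex.I * (∑ k : Fin (2 * ν + 1),
            (-1 : ℝ) ^ (k : ℕ) * (τ / (2 * ε) * ‖waveVec d (J k)‖ ^ 2) : ℝ)) •
          W.shift ((2 * Real.pi * ε)⁻¹ • alternatingSum d J) (W.mulConj d (2 * ν) fun k =>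
            W.phase (quad d (τ * dispersion ε) + τ • drift (waveVec d (J k)))
              (W.ofSchwartz (α (J k))))) := by
  rw [field, nlsData]
  simp only [map_sum, nlsU_shift τ hε]
  rw [ContinuousMultilinearMap.map_sum, map_sum]
  refine Finset.sum_congr rfl fun J _ => ?_
  rw [W.mulConj_smul_shift]
  congr 4
  simp only [alternatingSum, waveFreq, Finset.smul_sum]
  exact Finset.sum_congr rfl fun k _ => smul_comm _ _ _

theorem tendsto_inv_smul {v : E d} (hv : v ≠ 0) :
    Tendsto (fun ε : ℝ => ‖(2 * Real.pi * ε)⁻¹ • v‖) (𝓝[>] 0) atTop := by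
  simp only [norm_smul]
  refine Tendsto.atTop_mul_const (norm_pos_iff.2 hv) ?_
  refine tendsto_norm_atTop_atTop.comp ?_
  have h : Tendsto (fun ε : ℝ => (2 * Real.pi)⁻¹ * ε⁻¹) (𝓝[>] 0) atTop :=
    tendsto_inv_nhdsGT_zero.const_mul_atTop (by positivity)
  refine h.congr fun ε => ?_
  rw [mul_inv (2 * Real.pi)]

theorem tendsto_quad (τ : ℝ) (ω : C(E d, ℝ)) (η : E d) :
    Tendsto (fun ε : ℝ => (quad d (τ * dispersion ε) + ω) η) (𝓝[>] 0) (𝓝 (ω η)) := by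
  have h : Continuous fun ε : ℝ => (quad d (τ * dispersion ε) + ω) η := by
    simp only [ContinuousMap.add_apply, quad_apply, dispersion]; fun_prop
  have h1 := h.tendsto 0
  simp only [ContinuousMap.add_apply, quad_apply, dispersion, mul_zero, zero_mul, zero_add] at h1
  exact h1.mono_left nhdsWithin_le_nhds

/-- As `ε → 0`, only the interactions that produce the zero mode survive in a negative Sobolev
norm: all others have frequencies of size `1/ε`. -/
theorem tendsto_weight_field (hd : 2 ≤ d) (hs : s < 0) (α : Fin 3 → 𝓢(E d, ℂ)) (τ : ℝ) :
    Tendsto (fun ε => W.weight hs.le (field (W.mulConj d (2 * ν)) (nlsU d ε) τ (nlsData α ε)))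
      (𝓝[>] 0) (𝓝 (W.weight hs.le (zeroModeSource ν α τ))) := by
  have hterm : ∀ J : Fin (2 * ν + 1) → Fin 3, Tendsto (fun ε : ℝ => W.mulConj d (2 * ν) fun k =>
      W.phase (quad d (τ * dispersion ε) + τ • drift (waveVec d (J k)))
        (W.ofSchwartz (α (J k)))) (𝓝[>] 0) (𝓝 (limitTerm α τ J)) := fun J =>
    ((W.mulConj d (2 * ν)).cont.tendsto _).comp
      (tendsto_pi_nhds.2 fun k => W.tendsto_phase (fun η => tendsto_quad _ _ η) _)
  rw [zeroModeSource, map_sum]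
  have hsum : Tendsto (fun ε : ℝ => ∑ J : Fin (2 * ν + 1) → Fin 3, W.weight hs.le (nlsU d ε (-τ)
        (Complex.exp (-Complex.I * (∑ k : Fin (2 * ν + 1),
            (-1 : ℝ) ^ (k : ℕ) * (τ / (2 * ε) * ‖waveVec d (J k)‖ ^ 2) : ℝ)) •
          W.shift ((2 * Real.pi * ε)⁻¹ • alternatingSum d J) (W.mulConj d (2 * ν) fun k =>
            W.phase (quad d (τ * dispersion ε) + τ • drift (waveVec d (J k)))
              (W.ofSchwartz (α (J k))))))) (𝓝[>] 0)
      (𝓝 (∑ J : Fin (2 * ν + 1) → Fin 3, W.weight hs.le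
        (open Classical in if alternatingSum d J = 0 then limitTerm α τ J else 0))) := by
    refine tendsto_finsetSum _ fun J _ => ?_
    split_ifs with hJ
    -- the frequencies cancel, and by resonance the phases cancel as well
    · refine ((W.weight hs.le).continuous.tendsto _).comp ?_
      have h1 : ∀ ε : ℝ, ∑ k : Fin (2 * ν + 1),
          (-1 : ℝ) ^ (k : ℕ) * (τ / (2 * ε) * ‖waveVec d (J k)‖ ^ 2) = 0 := fun ε => by
        have h2 := alternating_norm_sq_eq_zero hd hJ
        simp only [mul_left_comm _ (τ / (2 * ε)), ← Finset.mul_sum, h2, mul_zero]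
      simp only [h1, hJ, Complex.ofReal_zero, mul_zero, Complex.exp_zero, one_smul, smul_zero,
        W.shift_zero]
      have h2 : Tendsto (fun ε : ℝ => nlsU d ε (-τ) (W.mulConj d (2 * ν) fun k =>
          W.phase (quad d (τ * dispersion ε) + τ • drift (waveVec d (J k)))
            (W.ofSchwartz (α (J k))))) (𝓝[>] 0) (𝓝 (W.phase 0 (limitTerm α τ J))) := by
        refine W.tendsto_phase_of_tendsto (fun η => ?_) (hterm J)
        simpa using tendsto_quad (-τ) 0 η
      simpa using h2
    -- the product has a frequency of size `1/ε`
    · rw [map_zero, tendsto_zero_iff_norm_tendsto_zero]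
      have h1 := (W.tendsto_weight_shift hs (tendsto_inv_smul hJ) (hterm J)).norm
      rw [norm_zero] at h1
      refine h1.congr fun ε => ?_
      rw [nlsU, W.norm_weight_phase, map_smul, norm_smul, W.norm_phase, one_mul]
  refine hsum.congr' ?_
  filter_upwards [self_mem_nhdsWithin] with ε hε
  rw [field_nlsData α τ (ne_of_gt hε), map_sum]

theorem tendsto_weight_integral (hd : 2 ≤ d) (hs : s < 0) (α : Fin 3 → 𝓢(E d, ℂ)) (t : ℝ) :
    Tendsto (fun ε => W.weight hs.le
        (∫ τ in (0 : ℝ)..t, field (W.mulConj d (2 * ν)) (nlsU d ε) τ (nlsData α ε)))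
      (𝓝[>] 0) (𝓝 (W.weight hs.le (∫ τ in (0 : ℝ)..t, zeroModeSource ν α τ))) := by
  have hc : ∀ ε, Continuous fun τ =>
      field (W.mulConj d (2 * ν)) (nlsU d ε) τ (nlsData α ε) := fun ε =>
    continuous_field (continuous_nlsU ε) continuous_id continuous_const
  have e1 : ∀ f : ℝ → W d, Continuous f → W.weight hs.le (∫ τ in (0 : ℝ)..t, f τ) =
      ∫ τ in (0 : ℝ)..t, W.weight hs.le (f τ) := fun f hf =>
    ((W.weight hs.le).intervalIntegral_comp_comm (hf.intervalIntegrable 0 t)).symm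
  rw [e1 _ (continuous_zeroModeSource α)]
  simp only [e1 _ (hc _)]
  refine intervalIntegral.tendsto_integral_filter_of_dominated_convergence
    (fun _ => (∑ j, ‖W.ofSchwartz (α j)‖) ^ (2 * ν + 1))
    (Eventually.of_forall fun ε => ((W.weight hs.le).continuous.comp (hc ε)).aestronglyMeasurable)
    (Eventually.of_forall fun ε => Eventually.of_forall fun τ _ => ?_)
    intervalIntegrable_const (Eventually.of_forall fun τ _ => tendsto_weight_field hd hs α τ)
  refine (W.norm_weight_le _ _).trans ((norm_field_le W.norm_mulConj_le _ _).trans ?_)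
  gcongr
  exact norm_nlsData_le α ε

theorem mode_profileU_wave (hd : 2 ≤ d) (α : Fin 3 → 𝓢(E d, ℂ)) (τ : ℝ) (j : Fin 3) :
    Y.mode (waveMode d ν j) (profileU d ν τ (profileData ν α)) =
      W.phase (τ • drift (waveVec d j)) (W.ofSchwartz (α j)) := by
  rw [mode_profileU, mode_profileData_wave hd]; rfl

theorem mode_zero_profileU (hd : 2 ≤ d) (hν : 1 ≤ ν) (t : ℝ) (a : Y d (Modes d ν)) :
    Y.mode (zeroMode hd hν) (profileU d ν t a) = Y.mode (zeroMode hd hν) a := by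
  rw [mode_profileU]
  have h : t • drift ((zeroMode hd hν : Modes d ν) : E d) = 0 := by
    ext η; simp [zeroMode]
  rw [h, W.phase_zero]

/-- The first Duhamel iterate of the profile system has exactly the same source for the zero
mode. -/
theorem mode_zero_field (hd : 2 ≤ d) (hν : 1 ≤ ν) (α : Fin 3 → 𝓢(E d, ℂ)) (τ : ℝ) :
    Y.mode (zeroMode hd hν) (field (profileN d ν) (profileU d ν) τ (profileData ν α)) =
      zeroModeSource ν α τ := by
  classical
  rw [field, mode_zero_profileU, Y.mode_interaction]
  set f : ResonantTuple (zeroMode hd hν) → W d := fun ℓ => W.mulConj d (2 * ν) fun k =>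
    Y.mode (ℓ.1 k) (profileU d ν τ (profileData ν α)) with hf
  set g : {J : Fin (2 * ν + 1) → Fin 3 // alternatingSum d J = 0} →
      ResonantTuple (zeroMode hd hν) := fun J => ⟨fun k => waveMode d ν (J.1 k), J.2, by
        simpa [zeroMode] using! alternating_norm_sq_eq_zero hd J.2⟩ with hg
  have hginj : Function.Injective g := by
    intro J J' h
    refine Subtype.ext (funext fun k => waveVec_injective hd ?_)
    exact congrArg Subtype.val (congrFun (congrArg Subtype.val h) k)
  -- at this order only the three initial modes are nonzero
  have hsupp : Function.support f ⊆ range g := by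
    intro ℓ hℓ
    have h1 : ∀ k, ∃ j, (ℓ.1 k : E d) = waveVec d j := by
      intro k
      by_contra! hk
      refine hℓ ((W.mulConj d (2 * ν)).map_coord_zero k ?_)
      rw [mode_profileU, mode_profileData_other α _ hk, map_zero]
    choose J hJ using h1
    have h2 : alternatingSum d J = 0 := by
      have h3 := ℓ.2.1
      simp only [hJ] at h3
      exact h3
    exact ⟨⟨J, h2⟩, Subtype.ext (funext fun k => Subtype.ext (hJ k).symm)⟩
  have h1 := hginj.tsum_eq hsupp
  refine h1.symm.trans ?_
  rw [tsum_fintype, zeroModeSource, ← Finset.sum_filter, Finset.sum_subtype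
    (p := fun J : Fin (2 * ν + 1) → Fin 3 => alternatingSum d J = 0) _ (fun J => by simp)]
  refine Finset.sum_congr rfl fun J _ => ?_
  simp only [hf, hg, mode_profileU_wave hd, limitTerm]

theorem mode_zero_profileData (hd : 2 ≤ d) (hν : 1 ≤ ν) (α : Fin 3 → 𝓢(E d, ℂ)) :
    Y.mode (zeroMode hd hν) (profileData ν α) = 0 := by
  refine mode_profileData_other α _ fun j hj => ?_
  obtain ⟨h0, h1, h2⟩ := norm_waveVec_sq hd
  have h : ‖waveVec d j‖ ^ 2 = 0 := by rw [← hj]; simp [zeroMode]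
  fin_cases j
  · exact one_ne_zero (h0.symm.trans h)
  · exact two_ne_zero (h1.symm.trans h)
  · exact one_ne_zero (h2.symm.trans h)

end WeakNLS

namespace WeakNLS

variable {d ν : ℕ} {s : ℝ}

/-! ### The size of the initial datum -/

theorem fn_nlsData (α : Fin 3 → 𝓢(E d, ℂ)) (ε : ℝ) : (nlsData α ε).fn =ᵐ[volume] fun η =>
    ∑ j, (𝓕 (α j) : 𝓢(E d, ℂ)) (η - waveFreq d ε j) := by
  have h : ∀ j, (W.shift (waveFreq d ε j) (W.ofSchwartz (α j))).fn =ᵐ[volume] fun η =>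
      (𝓕 (α j) : 𝓢(E d, ℂ)) (η - waveFreq d ε j) := fun j =>
    (W.fn_shift _ _).trans ((measurePreserving_sub_right (volume : Measure (E d))
      (waveFreq d ε j)).quasiMeasurePreserving.ae_eq_comp (W.fn_ofSchwartz (α j)))
  rw [nlsData, Fin.sum_univ_three]
  filter_upwards [h 0, h 1, h 2, W.fn_add
    (W.shift (waveFreq d ε 0) (W.ofSchwartz (α 0)) + W.shift (waveFreq d ε 1) (W.ofSchwartz (α 1)))
    (W.shift (waveFreq d ε 2) (W.ofSchwartz (α 2))),
    W.fn_add (W.shift (waveFreq d ε 0) (W.ofSchwartz (α 0)))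
      (W.shift (waveFreq d ε 1) (W.ofSchwartz (α 1)))] with η h0 h1 h2 h3 h4
  rw [h3, Pi.add_apply, h4, Pi.add_apply, h0, h1, h2, Fin.sum_univ_three]

theorem norm_waveVec_mem_Icc (hd : 2 ≤ d) (j : Fin 3) : ‖waveVec d j‖ ∈ Icc 1 2 := by
  obtain ⟨h0, h1, h2⟩ := norm_waveVec_sq hd
  have h : 1 ≤ ‖waveVec d j‖ ^ 2 ∧ ‖waveVec d j‖ ^ 2 ≤ 2 := by
    fin_cases j
    · exact ⟨h0.ge, h0.le.trans one_le_two⟩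
    · exact ⟨one_le_two.trans h1.ge, h1.le⟩
    · exact ⟨h2.ge, h2.le.trans one_le_two⟩
  have := norm_nonneg (waveVec d j)
  constructor <;> nlinarith

/-- If the `α_j` have Fourier transforms supported in the unit ball, then the frequencies of the
initial datum are comparable to `1/ε`. -/
theorem norm_freq_mem_Icc (hd : 2 ≤ d) {α : Fin 3 → 𝓢(E d, ℂ)}
    (hα : ∀ j η, 1 < ‖η‖ → (𝓕 (α j) : 𝓢(E d, ℂ)) η = 0) {ε : ℝ} (hε : 0 < ε)
    (hε' : 4 * Real.pi * ε ≤ 1) :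
    ∀ᵐ η, (nlsData α ε).fn η ≠ 0 → ‖(2 * Real.pi) • η‖ ∈ Icc (1 / (2 * ε)) (3 / ε) := by
  filter_upwards [fn_nlsData α ε] with η h1 h2
  rw [h1] at h2
  obtain ⟨j, -, hj⟩ := Finset.exists_ne_zero_of_sum_ne_zero h2
  have h3 : ‖η - waveFreq d ε j‖ ≤ 1 := by
    by_contra! h
    exact hj (hα j _ h)
  have hπ := Real.pi_pos
  have h4 : (2 * Real.pi) • waveFreq d ε j = ε⁻¹ • waveVec d j := by
    rw [waveFreq, smul_smul]
    congr 1
    field_simp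
  have h5 : ‖(2 * Real.pi) • η - ε⁻¹ • waveVec d j‖ ≤ 1 / (2 * ε) := by
    rw [← h4, ← smul_sub, norm_smul, Real.norm_of_nonneg (by positivity)]
    rw [le_div_iff₀ (by positivity)]
    nlinarith [norm_nonneg (η - waveFreq d ε j)]
  obtain ⟨h6, h7⟩ := norm_waveVec_mem_Icc hd j
  have h8 : ‖ε⁻¹ • waveVec d j‖ = ε⁻¹ * ‖waveVec d j‖ := by
    rw [norm_smul, Real.norm_of_nonneg (by positivity)]
  have hi : 0 < ε⁻¹ := by positivity
  have h9 := norm_sub_norm_le (ε⁻¹ • waveVec d j) ((2 * Real.pi) • η)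
  have h10 := norm_sub_norm_le ((2 * Real.pi) • η) (ε⁻¹ • waveVec d j)
  rw [norm_sub_rev] at h9
  rw [h8] at h9 h10
  have h11 : 1 / (2 * ε) = ε⁻¹ / 2 := by field_simp
  have h12 : 3 / ε = 3 * ε⁻¹ := by rw [div_eq_mul_inv]
  rw [h11] at h5 ⊢
  rw [h12]
  constructor <;> nlinarith

theorem rpow_half_sq {x : ℝ} (hx : 0 < x) (s : ℝ) : (x ^ 2) ^ (s / 2) = x ^ s := by
  rw [← Real.rpow_natCast, ← Real.rpow_mul hx.le]
  congr 1
  push_cast; ring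

/-- The initial datum has frequencies comparable to `1/ε` and `L²` norm bounded above and below, so
that its `H^s` norm is comparable to `ε^{|s|}`. -/
theorem isTheta_weight_nlsData (hd : 2 ≤ d) (hs : s < 0) {α : Fin 3 → 𝓢(E d, ℂ)}
    (hα : ∀ j η, 1 < ‖η‖ → (𝓕 (α j) : 𝓢(E d, ℂ)) η = 0) {m : ℝ} (hm : 0 < m)
    (hlow : ∀ ε, m ≤ ‖W.toL2 (nlsData α ε)‖) :
    (fun ε => ‖W.weight hs.le (nlsData α ε)‖) =Θ[𝓝[>] 0] fun ε => ε ^ |s| := by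
  have hsmall : ∀ᶠ ε in 𝓝[>] (0 : ℝ), 0 < ε ∧ 4 * Real.pi * ε ≤ 1 := by
    have h0 : (0 : ℝ) < (4 * Real.pi)⁻¹ := by positivity
    filter_upwards [self_mem_nhdsWithin, Ioo_mem_nhdsGT h0] with ε h1 h2
    refine ⟨h1, ?_⟩
    have := (mul_le_mul_iff_right₀ (by positivity : 0 < 4 * Real.pi)).2 h2.2.le
    rwa [mul_inv_cancel₀ (by positivity)] at this
  have hs2 : s / 2 ≤ 0 := by linarith
  rw [abs_of_neg hs]
  constructor
  · refine IsBigO.of_bound (2 ^ (-s) * ∑ j, ‖W.ofSchwartz (α j)‖) ?_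
    filter_upwards [hsmall] with ε ⟨h1, h2⟩
    have h3 : ‖W.weight hs.le (nlsData α ε)‖ ≤ (1 / (2 * ε)) ^ s * ‖W.toL2 (nlsData α ε)‖ := by
      refine W.norm_weight_le_of_le hs.le _ ?_
      filter_upwards [norm_freq_mem_Icc hd hα h1 h2] with η h4 h5
      rw [bracket, ← rpow_half_sq (x := 1 / (2 * ε)) (by positivity) s]
      refine Real.rpow_le_rpow_of_nonpos (by positivity) ?_ hs2
      have h6 := pow_le_pow_left₀ (by positivity : 0 ≤ 1 / (2 * ε)) (h4 h5).1 2
      linarith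
    rw [norm_norm, Real.norm_of_nonneg (Real.rpow_nonneg h1.le _)]
    have h4 : (1 / (2 * ε)) ^ s = 2 ^ (-s) * ε ^ (-s) := by
      rw [one_div, Real.inv_rpow (by positivity), ← Real.rpow_neg (by positivity),
        Real.mul_rpow (by norm_num) h1.le]
    rw [h4] at h3
    have h5 := (W.norm_toL2_le _).trans (norm_nlsData_le α ε)
    calc _ ≤ _ := h3
      _ ≤ 2 ^ (-s) * ε ^ (-s) * ∑ j, ‖W.ofSchwartz (α j)‖ := by gcongr
      _ = _ := by ring
  · refine IsBigO.of_bound (4 ^ (-s) / m) ?_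
    filter_upwards [hsmall] with ε ⟨h1, h2⟩
    have hπ := Real.pi_gt_three
    have h3 : (4 / ε) ^ s * ‖W.toL2 (nlsData α ε)‖ ≤ ‖W.weight hs.le (nlsData α ε)‖ := by
      refine W.norm_weight_ge_of_ge hs.le _ (by positivity) ?_
      filter_upwards [norm_freq_mem_Icc hd hα h1 h2] with η h4 h5
      rw [bracket, ← rpow_half_sq (x := 4 / ε) (by positivity) s]
      refine Real.rpow_le_rpow_of_nonpos (by positivity) ?_ hs2
      have h6 := pow_le_pow_left₀ (norm_nonneg _) (h4 h5).2 2
      have h7 : 1 ≤ 1 / ε := by rw [le_div_iff₀ h1]; nlinarith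
      have h8 : (3 / ε) ^ 2 = 9 * (1 / ε) ^ 2 := by ring
      have h9 : (4 / ε) ^ 2 = 16 * (1 / ε) ^ 2 := by ring
      nlinarith
    rw [norm_norm, Real.norm_of_nonneg (Real.rpow_nonneg h1.le _)]
    have h4 : (4 / ε) ^ s = (4 ^ (-s))⁻¹ * ε ^ (-s) := by
      rw [Real.div_rpow (by norm_num) h1.le, Real.rpow_neg (by norm_num), Real.rpow_neg h1.le,
        inv_inv, div_eq_mul_inv]
    rw [h4] at h3
    have h5 : (4 ^ (-s))⁻¹ * ε ^ (-s) * m ≤ ‖W.weight hs.le (nlsData α ε)‖ :=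
      (mul_le_mul_of_nonneg_left (hlow ε) (by positivity)).trans h3
    have h6 : (0 : ℝ) < 4 ^ (-s) := by positivity
    rw [div_mul_eq_mul_div, le_div_iff₀ hm]
    rw [mul_assoc, inv_mul_le_iff₀ h6] at h5
    linarith

/-! ### Choice of the initial data -/

/-- A Schwartz function with Fourier transform supported in the unit ball, positive at the origin. -/
theorem exists_bandLimited (d : ℕ) : ∃ (φ : 𝓢(E d, ℂ)) (p : ℝ), 0 < p ∧ φ 0 = p ∧
    ∀ η, 1 < ‖η‖ → (𝓕 φ : 𝓢(E d, ℂ)) η = 0 := by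
  let b : ContDiffBump (0 : E d) := ⟨1 / 2, 1, by norm_num, by norm_num⟩
  have h1 : HasCompactSupport fun x => (b x : ℂ) :=
    b.hasCompactSupport.comp_left (g := Complex.ofReal) rfl
  have h2 : ContDiff ℝ ((⊤ : ℕ∞) : WithTop ℕ∞) fun x => (b x : ℂ) :=
    Complex.ofRealCLM.contDiff.comp b.contDiff
  refine ⟨𝓕⁻ (h1.toSchwartzMap h2), ∫ x, b x, b.integral_pos, ?_, fun η hη => ?_⟩
  · rw [SchwartzMap.fourierInv_coe, Real.fourierInv_eq]
    simp only [inner_zero_right, AddChar.map_zero_eq_one, one_smul]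
    exact integral_complex_ofReal
  · rw [FourierTransform.fourier_fourierInv_eq]
    have h3 : b η = 0 := by
      have h4 : η ∉ Function.support b := by
        rw [b.support_eq, Metric.mem_ball, dist_zero_right]
        exact not_lt.2 hη.le
      simpa using h4
    change ((b η : ℝ) : ℂ) = 0
    rw [h3]; rfl

/-- The tuple `(κ₁, κ₂, κ₃, κ₁, …, κ₁)` generates the zero mode. -/
theorem exists_alternatingSum_eq_zero (d : ℕ) (hν : 1 ≤ ν) :
    ∃ J : Fin (2 * ν + 1) → Fin 3, alternatingSum d J = 0 := by
  obtain ⟨n, rfl⟩ : ∃ n, ν = n + 1 := ⟨ν - 1, by omega⟩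
  let σ : ℕ → Fin 3 := fun k => if k = 1 then 1 else if k = 2 then 2 else 0
  refine ⟨fun k => σ k, (sum_alternating n (fun k => waveVec d (σ k)) fun k hk => ?_).trans ?_⟩
  · have h1' : k ≠ 1 := by omega
    have h2' : k ≠ 2 := by omega
    simp [σ, h1', h2']
  · ext i
    simp only [σ, waveVec, PiLp.add_apply, PiLp.sub_apply, PiLp.zero_apply]
    by_cases hi : (i : ℕ) = 0
    · simp [hi]
    · by_cases hi' : (i : ℕ) = 1 <;> simp [hi, hi']

/-- At the origin and at time zero every resonant tuple contributes a product of positive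
amplitudes, and there is at least one such tuple. -/
theorem zeroModeSource_zero_pos (hν : 1 ≤ ν) {α : Fin 3 → 𝓢(E d, ℂ)} {p : Fin 3 → ℝ}
    (hp : ∀ j, 0 < p j) (hα : ∀ j, α j 0 = p j) :
    0 < (W.evalCLM 0 (zeroModeSource ν α 0)).re := by
  classical
  have h1 : ∀ J : Fin (2 * ν + 1) → Fin 3,
      W.evalCLM 0 (limitTerm α 0 J) = ((∏ k, p (J k) : ℝ) : ℂ) := fun J => by
    rw [W.evalCLM_apply, limitTerm, W.phys_mulConj, W.physProd_apply, Complex.ofReal_prod]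
    refine Finset.prod_congr rfl fun k _ => ?_
    rw [zero_smul, W.phase_zero, W.phys_ofSchwartz, hα, Complex.conj_ofReal, ite_self]
  rw [zeroModeSource, map_sum, Complex.re_sum]
  obtain ⟨J₀, hJ₀⟩ := exists_alternatingSum_eq_zero d hν
  have h2 : ∀ J : Fin (2 * ν + 1) → Fin 3, alternatingSum d J = 0 →
      0 < (W.evalCLM 0 (if alternatingSum d J = 0 then limitTerm α 0 J else 0)).re := fun J hJ => by
    rw [if_pos hJ, h1, Complex.ofReal_re]
    exact Finset.prod_pos fun k _ => hp _
  refine Finset.sum_pos' (fun J _ => ?_) ⟨J₀, Finset.mem_univ _, ?_⟩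
  · by_cases hJ : alternatingSum d J = 0
    · convert (h2 J hJ).le
    · simp [hJ]
  · convert h2 J₀ hJ₀

/-- At the origin the resonant interactions start with a positive real part, which persists for a
short time. -/
theorem exists_time_integral_ne_zero {α : Fin 3 → 𝓢(E d, ℂ)}
    (h : 0 < (W.evalCLM 0 (zeroModeSource ν α 0)).re) :
    ∃ T : ℝ, 0 < T ∧ ∀ t ∈ Ioc 0 T, ∫ τ in (0 : ℝ)..t, zeroModeSource ν α τ ≠ 0 := by
  set g : ℝ → ℝ := fun τ => (W.evalCLM 0 (zeroModeSource ν α τ)).re with hg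
  have hQ := continuous_zeroModeSource (ν := ν) α
  have hgc : Continuous g := Complex.continuous_re.comp ((W.evalCLM 0).continuous.comp hQ)
  obtain ⟨δ, hδ, hpos⟩ := Metric.eventually_nhds_iff.1 (hgc.continuousAt.eventually (lt_mem_nhds h))
  refine ⟨δ / 2, by positivity, fun t ht h0 => ?_⟩
  have h1 : 0 < ∫ τ in (0 : ℝ)..t, g τ := by
    refine intervalIntegral.intervalIntegral_pos_of_pos_on (hgc.intervalIntegrable 0 t)
      (fun τ hτ => hpos ?_) ht.1
    rw [Real.dist_eq, sub_zero, abs_of_pos hτ.1]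
    linarith [hτ.2, ht.2]
  have h2 : ∫ τ in (0 : ℝ)..t, g τ =
      (W.evalCLM 0 (∫ τ in (0 : ℝ)..t, zeroModeSource ν α τ)).re := by
    rw [← (W.evalCLM 0).intervalIntegral_comp_comm (hQ.intervalIntegrable 0 t)]
    exact Complex.reCLM.intervalIntegral_comp_comm
      (((W.evalCLM 0).continuous.comp hQ).intervalIntegrable 0 t)
  rw [h2, h0] at h1
  simp at h1

theorem W.ofSchwartz_smul (a : ℂ) (φ : 𝓢(E d, ℂ)) :
    W.ofSchwartz (a • φ) = a • W.ofSchwartz φ := by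
  refine W.phys_injective ?_
  rw [W.phys_smul, W.phys_ofSchwartz, W.phys_ofSchwartz]
  rfl

/-- Initial data for which the zero mode is created at once, and for which the frequencies of the
initial datum are of order `1/ε`. The amplitudes `3, 1, 1` serve to bound the `L²` norm of the
initial datum from below by the triangle inequality. -/
theorem exists_initialData (d : ℕ) (hν : 1 ≤ ν) :
    ∃ (α : Fin 3 → 𝓢(E d, ℂ)) (T : ℝ), 0 < T ∧
      (∀ t ∈ Ioc 0 T, ∫ τ in (0 : ℝ)..t, zeroModeSource ν α τ ≠ 0) ∧
      (∀ j η, 1 < ‖η‖ → (𝓕 (α j) : 𝓢(E d, ℂ)) η = 0) ∧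
      ∃ m : ℝ, 0 < m ∧ ∀ ε, m ≤ ‖W.toL2 (nlsData α ε)‖ := by
  obtain ⟨φ, p, hp, hφ0, hφ⟩ := exists_bandLimited d
  set r : Fin 3 → ℝ := ![3, 1, 1] with hr
  have hr0 : ∀ j, 0 < r j := fun j => by fin_cases j <;> simp [hr]
  set α : Fin 3 → 𝓢(E d, ℂ) := fun j => (r j : ℂ) • φ with hα
  obtain ⟨T, hT, hQ⟩ := exists_time_integral_ne_zero (ν := ν) (α := α)
    (zeroModeSource_zero_pos hν (p := fun j => r j * p) (fun j => mul_pos (hr0 j) hp)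
      fun j => by
        change (r j : ℂ) * φ 0 = _
        rw [hφ0]; push_cast; rfl)
  refine ⟨α, T, hT, hQ, fun j η hη => ?_, ‖W.toL2 (W.ofSchwartz φ)‖, ?_, fun ε => ?_⟩
  · rw [hα, FourierTransform.fourier_smul]
    change (r j : ℂ) * (𝓕 φ : 𝓢(E d, ℂ)) η = 0
    rw [hφ η hη, mul_zero]
  · rw [norm_pos_iff]
    intro h
    have h1 : W.ofSchwartz φ = 0 := by
      refine W.ext ((W.toL2_ae _).trans ?_)
      rw [h]
      have h2 := W.toL2_ae (0 : W d)
      rw [map_zero] at h2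
      exact h2.symm
    have h2 := congrArg (fun z : W d => z.phys 0) h1
    simp only [W.phys_ofSchwartz, W.phys_zero, hφ0, Pi.zero_apply, Complex.ofReal_eq_zero] at h2
    exact hp.ne' h2
  · have h1 : ∀ j, ‖W.toL2 (W.shift (waveFreq d ε j) (W.ofSchwartz (α j)))‖ =
        r j * ‖W.toL2 (W.ofSchwartz φ)‖ := fun j => by
      rw [W.norm_toL2_shift, hα, W.ofSchwartz_smul, map_smul, norm_smul, Complex.norm_real,
        Real.norm_of_nonneg (hr0 j).le]
    rw [nlsData, Fin.sum_univ_three, map_add, map_add]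
    have h2 := h1 0
    have h3 := h1 1
    have h4 := h1 2
    simp only [hr, Matrix.cons_val_zero, Matrix.cons_val_one, Matrix.cons_val] at h2 h3 h4
    have h5 := norm_sub_le_norm_add (W.toL2 (W.shift (waveFreq d ε 0) (W.ofSchwartz (α 0))) +
      W.toL2 (W.shift (waveFreq d ε 1) (W.ofSchwartz (α 1))))
      (W.toL2 (W.shift (waveFreq d ε 2) (W.ofSchwartz (α 2))))
    have h6 := norm_sub_le_norm_add (W.toL2 (W.shift (waveFreq d ε 0) (W.ofSchwartz (α 0))))
      (W.toL2 (W.shift (waveFreq d ε 1) (W.ofSchwartz (α 1))))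
    linarith

/-! ### Leading order asymptotics -/

/-- If `f = g + λ G + O(|λ|²)` with `g = o(λ)` and `G → G₀`, then `‖f‖ / |λ| → ‖G₀‖`. -/
theorem tendsto_norm_div {Z : Type*} [NormedAddCommGroup Z] [NormedSpace ℂ Z] {l : Filter ℝ}
    {lam : ℝ → ℂ} {f g G : ℝ → Z} {G₀ : Z} {C : ℝ} (hlam : Tendsto (fun ε => ‖lam ε‖) l (𝓝 0))
    (hne : ∀ᶠ ε in l, lam ε ≠ 0)
    (hest : ∀ᶠ ε in l, ‖f ε - g ε - lam ε • G ε‖ ≤ C * ‖lam ε‖ ^ 2)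
    (hg : Tendsto (fun ε => ‖g ε‖ / ‖lam ε‖) l (𝓝 0)) (hG : Tendsto G l (𝓝 G₀)) :
    Tendsto (fun ε => ‖f ε‖ / ‖lam ε‖) l (𝓝 ‖G₀‖) := by
  have h1 : Tendsto (fun ε => ‖f ε‖ / ‖lam ε‖ - ‖G ε‖) l (𝓝 0) := by
    have h2 : Tendsto (fun ε => C * ‖lam ε‖ + ‖g ε‖ / ‖lam ε‖) l (𝓝 0) := by
      simpa using (hlam.const_mul C).add hg
    refine squeeze_zero_norm' ?_ h2
    filter_upwards [hne, hest] with ε h3 h4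
    have h5 : 0 < ‖lam ε‖ := norm_pos_iff.2 h3
    have h6 : ‖f ε‖ / ‖lam ε‖ - ‖G ε‖ = (‖f ε‖ - ‖lam ε • G ε‖) / ‖lam ε‖ := by
      rw [norm_smul]; field_simp
    have h7 : |‖f ε‖ - ‖lam ε • G ε‖| ≤ C * ‖lam ε‖ ^ 2 + ‖g ε‖ := by
      refine (abs_norm_sub_norm_le _ _).trans ?_
      have h8 : f ε - lam ε • G ε = (f ε - g ε - lam ε • G ε) + g ε := by abel
      rw [h8]
      exact (norm_add_le _ _).trans (add_le_add_left h4 _)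
    rw [h6, norm_div, Real.norm_eq_abs, norm_norm, div_le_iff₀ h5, add_mul,
      div_mul_cancel₀ _ h5.ne']
    linarith
  simpa using h1.add hG.norm

theorem tendsto_norm_coupling (μ : ℝ) {J : ℝ} (hJ : 1 - J < 0) :
    Tendsto (fun ε => ‖coupling μ J ε‖) (𝓝[>] 0) (𝓝 0) := by
  have h1 : Tendsto (fun ε : ℝ => |μ| * ε ^ (J - 1)) (𝓝[>] 0) (𝓝 0) := by
    have h2 := (Real.continuousAt_rpow_const 0 (J - 1) (Or.inr (by linarith))).tendsto
    rw [Real.zero_rpow (by linarith)] at h2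
    simpa using (h2.mono_left nhdsWithin_le_nhds).const_mul |μ|
  refine h1.congr' ?_
  filter_upwards [self_mem_nhdsWithin] with ε hε
  rw [norm_coupling μ J hε]

theorem coupling_ne_zero {μ : ℝ} (hμ : μ ≠ 0) (J : ℝ) {ε : ℝ} (hε : 0 < ε) :
    coupling μ J ε ≠ 0 := by
  rw [← norm_pos_iff, norm_coupling μ J hε]
  positivity

theorem isTheta_norm_coupling {μ : ℝ} (hμ : μ ≠ 0) (J : ℝ) :
    (fun ε => ‖coupling μ J ε‖) =Θ[𝓝[>] 0] fun ε => ε ^ (J - 1) := by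
  have h1 : (fun ε : ℝ => |μ| * ε ^ (J - 1)) =Θ[𝓝[>] 0] fun ε => ε ^ (J - 1) :=
    (isTheta_refl _ _).const_mul_left (abs_ne_zero.2 hμ)
  refine EventuallyEq.trans_isTheta ?_ h1
  filter_upwards [self_mem_nhdsWithin] with ε hε
  rw [norm_coupling μ J hε]

theorem isLittleO_rpow {a b : ℝ} (h : a < b) :
    (fun ε : ℝ => ε ^ b) =o[𝓝[>] 0] fun ε => ε ^ a := by
  refine (isLittleO_iff_tendsto' ?_).2 ?_
  · filter_upwards [self_mem_nhdsWithin] with ε hε h0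
    exact absurd h0 (Real.rpow_pos_of_pos hε a).ne'
  · have h2 := (Real.continuousAt_rpow_const 0 (b - a) (Or.inr (by linarith))).tendsto
    rw [Real.zero_rpow (by linarith)] at h2
    refine (h2.mono_left nhdsWithin_le_nhds).congr' ?_
    filter_upwards [self_mem_nhdsWithin] with ε hε
    rw [Real.rpow_sub hε]

/-- The solution of the Schrödinger equation in a negative Sobolev norm: the initial datum is
negligible, and the first Duhamel iterate dominates. -/
theorem tendsto_weight_nls (hd : 2 ≤ d) (hs : s < 0) {μ J : ℝ} (hμ : μ ≠ 0) (hJ : 1 - J < 0)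
    (hsJ : s < 1 - J) {α : Fin 3 → 𝓢(E d, ℂ)}
    (hα : (fun ε => ‖W.weight hs.le (nlsData α ε)‖) =Θ[𝓝[>] 0] fun ε => ε ^ |s|) {C t : ℝ}
    {c : ℝ → W d}
    (hc : ∀ᶠ ε in 𝓝[>] 0, ‖c ε - nlsData α ε - coupling μ J ε •
      ∫ τ in (0 : ℝ)..t, field (W.mulConj d (2 * ν)) (nlsU d ε) τ (nlsData α ε)‖ ≤
        C * ‖coupling μ J ε‖ ^ 2) :
    Tendsto (fun ε => ‖W.weight hs.le (c ε)‖ / ‖coupling μ J ε‖) (𝓝[>] 0)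
      (𝓝 ‖W.weight hs.le (∫ τ in (0 : ℝ)..t, zeroModeSource ν α τ)‖) := by
  have hne : ∀ᶠ ε in 𝓝[>] 0, coupling μ J ε ≠ 0 := by
    filter_upwards [self_mem_nhdsWithin] with ε hε using coupling_ne_zero hμ J hε
  refine tendsto_norm_div (g := fun ε => W.weight hs.le (nlsData α ε)) (C := C)
    (tendsto_norm_coupling μ hJ) hne ?_ ?_ (tendsto_weight_integral hd hs α t)
  · filter_upwards [hc] with ε h
    rw [← map_sub, ← map_smul, ← map_sub]
    exact (W.norm_weight_le _ _).trans h
  · have h1 : (fun ε => ‖W.weight hs.le (nlsData α ε)‖) =o[𝓝[>] 0]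
        fun ε => ‖coupling μ J ε‖ := by
      refine hα.trans_isLittleO ((isLittleO_rpow ?_).trans_isTheta
        (isTheta_norm_coupling hμ J).symm)
      rw [abs_of_neg hs]; linarith
    exact h1.tendsto_div_nhds_zero

/-- The zero mode of the profile system has the same leading order. -/
theorem tendsto_weight_profile (hd : 2 ≤ d) (hν : 1 ≤ ν) (hs : s < 0) {μ J : ℝ} (hμ : μ ≠ 0)
    (hJ : 1 - J < 0) {α : Fin 3 → 𝓢(E d, ℂ)} {C t : ℝ} {c : ℝ → Y d (Modes d ν)}
    (hc : ∀ᶠ ε in 𝓝[>] 0, ‖c ε - profileData ν α - coupling μ J ε •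
      ∫ τ in (0 : ℝ)..t, field (profileN d ν) (profileU d ν) τ (profileData ν α)‖ ≤
        C * ‖coupling μ J ε‖ ^ 2) :
    Tendsto (fun ε => ‖W.weight hs.le (Y.mode (zeroMode hd hν) (c ε))‖ / ‖coupling μ J ε‖) (𝓝[>] 0)
      (𝓝 ‖W.weight hs.le (∫ τ in (0 : ℝ)..t, zeroModeSource ν α τ)‖) := by
  have hne : ∀ᶠ ε in 𝓝[>] 0, coupling μ J ε ≠ 0 := by
    filter_upwards [self_mem_nhdsWithin] with ε hε using coupling_ne_zero hμ J hε
  have hcont : Continuous fun τ => field (profileN d ν) (profileU d ν) τ (profileData ν α) :=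
    continuous_field continuous_profileU continuous_id continuous_const
  have h1 : Y.mode (zeroMode hd hν)
      (∫ τ in (0 : ℝ)..t, field (profileN d ν) (profileU d ν) τ (profileData ν α)) =
      ∫ τ in (0 : ℝ)..t, zeroModeSource ν α τ := by
    rw [← (Y.mode (zeroMode hd hν)).intervalIntegral_comp_comm (hcont.intervalIntegrable 0 t)]
    simp only [mode_zero_field]
  refine tendsto_norm_div (g := fun _ => 0) (C := C)
    (tendsto_norm_coupling μ hJ) hne ?_ (by simp) tendsto_const_nhds
  filter_upwards [hc] with ε h
  refine le_trans ?_ h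
  rw [sub_zero, ← h1, ← map_smul, ← map_smul, ← map_sub]
  refine (W.norm_weight_le _ _).trans ?_
  have h2 := Y.norm_mode_le (c ε - profileData ν α - coupling μ J ε •
      ∫ τ in (0 : ℝ)..t, field (profileN d ν) (profileU d ν) τ (profileData ν α)) (zeroMode hd hν)
  rwa [map_sub, map_sub, mode_zero_profileData, sub_zero, ← map_sub] at h2

end WeakNLS

theorem mainTheorem5 (d ν : ℕ) (hd : 2 ≤ d) (hν : 1 ≤ ν) (μ : ℝ) (hμ : μ ≠ 0) :
    ∃ α : Fin 3 → 𝓢(WeakNLS.E d, ℂ), ∃ T : ℝ, 0 < T ∧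
      ∀ s J : ℝ, s < 1 - J → 1 - J < 0 → J < 2 →
        ∃ ε₀ : ℝ, 0 < ε₀ ∧
          ∃ (u : ℝ → ℝ → WeakNLS.E d → ℂ) (a : ℝ → ℝ → WeakNLS.Modes d ν → WeakNLS.E d → ℂ),
            (∀ ε ∈ Ioc 0 ε₀,
              WeakNLS.IsNLSSolution ν μ J ε T (WeakNLS.initialDatum α ε) (u ε) ∧
              ∀ v : ℝ → WeakNLS.E d → ℂ,
                WeakNLS.IsNLSSolution ν μ J ε T (WeakNLS.initialDatum α ε) v →
                  ∀ t ∈ Icc 0 T, v t =ᵐ[volume] u ε t) ∧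
            (∀ ε ∈ Ioc 0 ε₀,
              WeakNLS.IsProfileSolution μ J ε T α (a ε) ∧
              ∀ b : ℝ → WeakNLS.Modes d ν → WeakNLS.E d → ℂ,
                WeakNLS.IsProfileSolution μ J ε T α b → ∀ t ∈ Icc 0 T, b t = a ε t) ∧
            ∀ t ∈ Ioc 0 T,
              (∀ᶠ ε in 𝓝[>] (0 : ℝ), a ε t (WeakNLS.zeroMode hd hν) ≠ 0) ∧
              (fun ε => WeakNLS.sobolevNorm s (u ε t)) ~[𝓝[>] (0 : ℝ)]
                (fun ε => WeakNLS.sobolevNorm s (a ε t (WeakNLS.zeroMode hd hν))) ∧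
              (fun ε => WeakNLS.sobolevNorm s (a ε t (WeakNLS.zeroMode hd hν)))
                =Θ[𝓝[>] (0 : ℝ)] (fun ε => ε ^ (J - 1)) ∧
              (fun ε => WeakNLS.sobolevNorm s (u ε 0)) =o[𝓝[>] (0 : ℝ)]
                (fun ε => WeakNLS.sobolevNorm s (u ε t)) ∧
              (fun ε => WeakNLS.sobolevNorm s (u ε 0)) =Θ[𝓝[>] (0 : ℝ)]
                (fun ε => ε ^ |s|) := by
  obtain ⟨α, T, hT, hQ, hsupp, m, hm, hlow⟩ := WeakNLS.exists_initialData d hν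
  refine ⟨α, T, hT, fun s J hsJ hJ _ => ?_⟩
  have hs : s < 0 := hsJ.trans hJ
  set R : ℝ := max (∑ j, ‖WeakNLS.W.ofSchwartz (α j)‖) ‖WeakNLS.profileData ν α‖ with hR
  -- for `ε ≤ ε₀` the fixed point argument works on all of `[0, T]`
  obtain ⟨ε₀, hε₀, hsmall⟩ : ∃ ε₀ : ℝ, 0 < ε₀ ∧ ∀ ε ∈ Ioc 0 ε₀,
      ‖WeakNLS.coupling μ J ε‖ * (R + 1) ^ (2 * ν + 1) * T ≤ 1 := by
    have h1 := ((WeakNLS.tendsto_norm_coupling μ hJ).mul_const ((R + 1) ^ (2 * ν + 1))).mul_const T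
    rw [zero_mul, zero_mul] at h1
    have h2 := h1.eventually (ge_mem_nhds one_pos)
    obtain ⟨ε₀, hε₀, h3⟩ := mem_nhdsGT_iff_exists_Ioc_subset.1 h2
    exact ⟨ε₀, hε₀, fun ε hε => h3 hε⟩
  have hnls := fun ε (hε : ε ∈ Ioc 0 ε₀) => WeakNLS.exists_evolution
    (N := WeakNLS.W.mulConj d (2 * ν)) (U := WeakNLS.nlsU d ε) WeakNLS.W.norm_mulConj_le
    (WeakNLS.continuous_nlsU ε) hT.le (hsmall ε hε)
    ((WeakNLS.norm_nlsData_le α ε).trans (le_max_left _ _))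
  have hprof := fun ε (hε : ε ∈ Ioc 0 ε₀) => WeakNLS.exists_evolution
    (N := WeakNLS.profileN d ν) (U := WeakNLS.profileU d ν)
    (WeakNLS.Y.norm_interaction_le WeakNLS.isResonance_unique)
    WeakNLS.continuous_profileU hT.le (hsmall ε hε) (le_max_right _ _ : _ ≤ R)
  choose! c hc hc0 hcd hce using hnls
  choose! e he he0 hed hee using hprof
  refine ⟨ε₀, hε₀, fun ε t => (WeakNLS.nlsU d ε t (c ε t)).phys,
    fun ε t κ => (WeakNLS.Y.mode κ (WeakNLS.profileU d ν t (e ε t))).phys,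
    fun ε hε => ?_, fun ε hε => ?_, fun t ht => ?_⟩
  · have h := WeakNLS.isNLSSolution_of_evolution hε.1 (hc ε hε)
      (by rw [hc0 ε hε, WeakNLS.phys_nlsData]) (hcd ε hε)
    exact ⟨h, fun v hv t ht => WeakNLS.nlsSolution_unique hε.1 hv h ht⟩
  · exact ⟨WeakNLS.isProfileSolution_of_evolution hd (he ε hε) (he0 ε hε) (hed ε hε),
      fun b hb t ht => WeakNLS.profileSolution_unique hd hT.le (he0 ε hε) (hed ε hε) hb ht⟩
  have hev : ∀ᶠ ε in 𝓝[>] (0 : ℝ), ε ∈ Ioc 0 ε₀ := Ioc_mem_nhdsGT hε₀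
  have htT : t ∈ Icc 0 T := Ioc_subset_Icc_self ht
  have hu : ∀ ε t, WeakNLS.sobolevNorm s (WeakNLS.nlsU d ε t (c ε t)).phys =
      ‖WeakNLS.W.weight hs.le (c ε t)‖ := fun ε t => by
    rw [WeakNLS.W.sobolevNorm_phys hs.le, WeakNLS.nlsU, WeakNLS.W.norm_weight_phase]
  have ha : ∀ ε, WeakNLS.sobolevNorm s (WeakNLS.Y.mode (WeakNLS.zeroMode hd hν)
      (WeakNLS.profileU d ν t (e ε t))).phys =
      ‖WeakNLS.W.weight hs.le (WeakNLS.Y.mode (WeakNLS.zeroMode hd hν) (e ε t))‖ := fun ε => by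
    rw [WeakNLS.W.sobolevNorm_phys hs.le, WeakNLS.mode_zero_profileU]
  -- the initial datum, the Duhamel expansions, and the common limit of the two rescaled norms
  have hdata := WeakNLS.isTheta_weight_nlsData hd hs hsupp hm hlow
  have h0 : (fun ε => ‖WeakNLS.W.weight hs.le (c ε 0)‖) =Θ[𝓝[>] (0 : ℝ)]
      (fun ε => ε ^ |s|) := by
    refine EventuallyEq.trans_isTheta ?_ hdata
    filter_upwards [hev] with ε hε
    rw [hc0 ε hε]
  have hlim := WeakNLS.tendsto_weight_nls hd hs hμ hJ hsJ hdata
    (hev.mono fun ε hε => hce ε hε t htT)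
  have hlim' := WeakNLS.tendsto_weight_profile hd hν hs hμ hJ
    (hev.mono fun ε hε => hee ε hε t htT)
  set ℓ : ℝ := ‖WeakNLS.W.weight hs.le (∫ τ in (0 : ℝ)..t, WeakNLS.zeroModeSource ν α τ)‖ with hℓ
  have hℓ0 : ℓ ≠ 0 := fun h => hQ t ht <| WeakNLS.W.weight_injective hs.le <| by
    rw [map_zero]; exact norm_eq_zero.1 h
  have hcoup := WeakNLS.isTheta_norm_coupling hμ J
  have hne : ∀ᶠ ε in 𝓝[>] (0 : ℝ),
      ‖WeakNLS.W.weight hs.le (WeakNLS.Y.mode (WeakNLS.zeroMode hd hν) (e ε t))‖ ≠ 0 := by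
    filter_upwards [hlim'.eventually_ne hℓ0] with ε hε h
    rw [h, zero_div] at hε
    exact hε rfl
  have hΘ := (isTheta_of_div_tendsto_nhds_ne_zero hlim hℓ0).symm.trans hcoup
  refine ⟨?_, ?_, ?_, ?_, ?_⟩
  · filter_upwards [hne] with ε hε h
    refine hε ?_
    have h' : (WeakNLS.Y.mode (WeakNLS.zeroMode hd hν) (WeakNLS.profileU d ν t (e ε t))).phys =
        (0 : WeakNLS.W d).phys := h.trans WeakNLS.W.phys_zero.symm
    rw [WeakNLS.mode_zero_profileU] at h'
    rw [WeakNLS.W.phys_injective h', map_zero, norm_zero]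
  · simp only [hu, ha]
    rw [isEquivalent_iff_tendsto_one hne]
    have h := hlim.div hlim' hℓ0
    rw [div_self hℓ0] at h
    refine h.congr' ?_
    filter_upwards [hev] with ε hε
    have h1 : ‖WeakNLS.coupling μ J ε‖ ≠ 0 :=
      norm_ne_zero_iff.2 (WeakNLS.coupling_ne_zero hμ J hε.1)
    rw [Pi.div_apply, Pi.div_apply, div_div_div_cancel_right₀ h1]
  · simp only [ha]
    exact (isTheta_of_div_tendsto_nhds_ne_zero hlim' hℓ0).symm.trans hcoup
  · simp only [hu]
    refine h0.trans_isLittleO ((WeakNLS.isLittleO_rpow ?_).trans_isTheta hΘ.symm)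
    rw [abs_of_neg hs]; linarith
  · simp only [hu]
    exact h0
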